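/- **Proposition (Evaluation).** Let $I=[0,1]$. The evaluation operator $\operatorname{eval}\colon C(I)\times I\to\mathbb R$, $(f,x)\mapsto f(x)$, is polytime computable as a function from the product $C(I)_i\times I_i$ of preparametrised spaces to $\mathbb R_i$, where the notions are the following. *Codes.* Fix the alphabet $\Sigma=\{0,1,\text{separator}\}$ and let $\mathcal B$ be the set of all functions $\Sigma^*\to\Sigma^*$. An integer is coded by a sign bit followed by the binary expansion of its absolute value without leading zeros (strings of length at most one code zero); $n\in\mathbb N$ is given by the code $010^n$ of the integer $2^n$, i.e. in unary. A dyadic rational is coded by a (signed) code of its integer part, the separator, and the finite binary expansion of its fractional part without trailing zeros. Let $\mathrm I\mathbb D$ be the set of all intervals $[r\pm\varepsilon]=[r-\varepsilon,r+\varepsilon]$ with dyadic $r$ and dyadic $\varepsilon>0$, together with the infinite interval $[-\infty,\infty]$. A finite interval is coded by the pairing $\langle a,b\rangle$ of a code $a$ of $r$ and a code $b$ of $\varepsilon$, and the infinite interval by the empty string. Here $\langle a,b\rangle$ is the string whose symbols alternate between those of $c$, $a$, $b$, where $c$ consists of $\min\{|a|,|b|\}$ ones, a zero, and a bit telling which of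 the strings is longer, and $a,b,c$ are padded with zeros at the end to a common (minimal) length. Write $\operatorname{diam}([r\pm\varepsilon])=2\varepsilon$ and $\operatorname{diam}([-\infty,\infty])=\infty$. *Preparametrised spaces.* A preparametrised space is a set $X$ with a representation, i.e. a partial surjection $\xi_X\colon{\subseteq\mathcal B}\to X$ (the elements of $\xi_X^{-1}(x)$ are the names of $x$), and a parameter $\mu_X\colon\operatorname{dom}(\xi_X)\to\mathbb N^{\mathbb N}$ with non-decreasing values. * $\mathbb R_i$: $\varphi\in\mathcal B$ is a name of $x\in\mathbb R$ if, on codes, it is a function $\varphi\colon\mathbb N\to\mathrm I\mathbb D$ with $\varphi(n+1)\subseteq\varphi(n)$ for all $n$ and $\bigcap_n\varphi(n)=\{x\}$; and $\mu(\varphi)(n)=\min\{N:\operatorname{diam}(\varphi(N))\le 2^{-n}\}+\lceil\log_2(|x|+1)\rceil$. * $I_i$: the restriction of $\mathbb R_i$ to names of elements of $I$, with the same parameter. * $C(I)_i$: $\psi\in\mathcal B$ is a name of $f\in C(I)$ if, on codes, it is a function $\psi\colon\mathrm I\mathbb D\to\mathrm I\mathbb D$ such that $\psi\circ\varphi$ is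 a name of $f(x)$ in the sense of $\mathbb R_i$ whenever $\varphi\colon\mathbb N\to\mathrm I\mathbb D$ is a name of some $x\in I$; and $$\mu(\psi)(n)=\lceil\log_2(\|f\|_\infty+1)\rceil+\min\{N:\forall J\in\mathrm I\mathbb D,\ J\cap I\neq\emptyset\text{ and }\operatorname{diam}(J)\le2^{-N}\Rightarrow\operatorname{diam}(\psi(J))\le2^{-n}\}.$$ * $X\times Y$: the names of $(x,y)$ are the functions $\langle\varphi,\psi\rangle$ with $\langle\varphi,\psi\rangle(0b)=\varphi(b)$, $\langle\varphi,\psi\rangle(1b)=\psi(b)$ and the empty string as value on all other strings, where $\varphi$ is a name of $x$ and $\psi$ is a name of $y$; the parameter is $\mu(\langle\varphi,\psi\rangle)(n)=\max\{\mu_X(\varphi)(n),\mu_Y(\psi)(n)\}$. *Polytime computability.* The second-order polynomials form the smallest class of functions $\mathbb N^{\mathbb N}\times\mathbb N\to\mathbb N$ that contains $(l,n)\mapsto p(n)$ for all $p\in\mathbb N[X]$, and with $P,Q$ also $(l,n)\mapsto l(P(l,n))$, $P+Q$ and $P\cdot Q$. An oracle machine $M^?$ is a multi-tape Turing machine with a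 query tape, an answer tape and an oracle state; when it enters the oracle state, which takes one step, the content of the answer tape is replaced by the value of the oracle on the content of the query tape, and the heads do not move. $M^\varphi$ denotes the partial function on strings that it computes with oracle $\varphi$. A function $f\colon X\to Y$ between preparametrised spaces is polytime computable if there are an oracle machine $M^?$ and second-order polynomials $P,Q$ such that for every $\varphi\in\operatorname{dom}(\xi_X)$ 1. $M^\varphi$ is total and is a name of $f(\xi_X(\varphi))$; 2. on every input $a\in\Sigma^*$ with oracle $\varphi$ the machine stops after at most $P(\mu_X(\varphi),|a|)$ steps; 3. $\mu_Y(M^\varphi)(n)\le Q(\mu_X(\varphi),n)$ for all $n\in\mathbb N$. -/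

import Mathlib

namespace IntervalComplexity

/-! ### Strings, string functions, second-order polynomials -/

/-- The alphabet: two binary digits and the separator symbol (the "decimal point"). -/
inductive Sym where
  | zero
  | one
  | sep

/-- Finite strings over the alphabet. -/
abbrev Str := List Sym

/-- The space of string functions; its elements serve as oracles and as names. -/
abbrev StrFun := Str → Str

/-- Second-order polynomials: the smallest class of functions of type
`ℕ^ℕ × ℕ → ℕ` that contains the polynomials in the number argument and is closed under
application of the function argument, pointwise sums and pointwise products. -/
inductive IsSOP : ((ℕ → ℕ) → ℕ → ℕ) → Prop
  | poly (p : Polynomial ℕ) : IsSOP (fun _ n => p.eval n)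
  | app {P : (ℕ → ℕ) → ℕ → ℕ} : IsSOP P → IsSOP (fun l n => l (P l n))
  | add {P Q : (ℕ → ℕ) → ℕ → ℕ} : IsSOP P → IsSOP Q → IsSOP (fun l n => P l n + Q l n)
  | mul {P Q : (ℕ → ℕ) → ℕ → ℕ} : IsSOP P → IsSOP Q → IsSOP (fun l n => P l n * Q l n)

/-! ### Oracle Turing machines -/

/-- The tapes of an oracle machine with `k` work tapes. -/
inductive TapeName (k : ℕ) where
  | input
  | output
  | query
  | answer
  | work (i : Fin k)

/-- Head movements. -/
inductive Move where
  | left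
  | stay
  | right

/-- The new head position; tapes are infinite to the right, and moving left from the first
cell has no effect. -/
def Move.apply : Move → ℕ → ℕ
  | .left, p => p - 1
  | .stay, p => p
  | .right, p => p + 1

/-- A deterministic multi-tape oracle Turing machine with finitely many states. A tape cell is
blank (`none`), or holds a symbol of the alphabet or one of finitely many auxiliary symbols. -/
structure OracleMachine where
  State : Type
  [finState : Finite State]
  Aux : Type
  [finAux : Finite Aux]
  numWork : ℕ
  start : State
  halt : State
  oracle : State
  δ : State → (TapeName numWork → Option (Sym ⊕ Aux)) →
    State × (TapeName numWork → Option (Sym ⊕ Aux) × Move)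

namespace OracleMachine

variable (M : OracleMachine)

/-- The content of a tape cell. -/
abbrev Cell := Option (Sym ⊕ M.Aux)

/-- Configurations: state, cell contents and head positions. -/
structure Config where
  state : M.State
  cells : TapeName M.numWork → ℕ → M.Cell
  head : TapeName M.numWork → ℕ

variable {M}

/-- The tape that holds the string `w`, starting in the first cell, and is blank elsewhere. -/
def writeStr (w : Str) : ℕ → M.Cell := fun i => (w[i]?).map Sum.inl

/-- `w` is the string that the tape holds: it starts in the first cell and ends before the
first cell that does not hold a symbol of the alphabet. -/
def Holds (c : ℕ → M.Cell) (w : Str) : Prop :=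
  (∀ i (h : i < w.length), c i = some (Sum.inl w[i])) ∧ ∀ s : Sym, c w.length ≠ some (Sum.inl s)

open Classical in
/-- The string that the tape holds (the empty string if all cells hold alphabet symbols, which
does not happen in a computation). -/
noncomputable def readStr (c : ℕ → M.Cell) : Str :=
  if h : ∃ w, Holds c w then h.choose else []

/-- The oracle call: the whole content of the answer tape is replaced by the value of the
oracle on the content of the query tape; no head moves. -/
noncomputable def callOracle (φ : StrFun) (c : M.Config) : M.Config where
  state := c.state
  cells := fun t => match t with
    | .answer => writeStr (φ (readStr (c.cells .query)))
    | t => c.cells t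
  head := c.head

/-- One application of the transition function. -/
noncomputable def move (c : M.Config) : M.Config :=
  let r := M.δ c.state (fun t => c.cells t (c.head t))
  { state := r.1
    cells := fun t => Function.update (c.cells t) (c.head t) (r.2 t).1
    head := fun t => (r.2 t).2.apply (c.head t) }

open Classical in
/-- One step with oracle `φ`. The machine rests in the halting state. The oracle is called
whenever the machine enters the oracle state; the call takes one step, in which the whole answer
appears on the answer tape. -/
noncomputable def step (φ : StrFun) (c : M.Config) : M.Config :=
  if c.state = M.halt then c
  else if (move c).state = M.oracle then callOracle φ (move c) else move c

variable (M)

/-- The initial configuration on input `a`. -/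
def init (a : Str) : M.Config where
  state := M.start
  cells := fun t => match t with
    | .input => writeStr a
    | _ => fun _ => none
  head := fun _ => 0

/-- The configuration after `t` steps with oracle `φ` on input `a`. -/
noncomputable def run (φ : StrFun) (a : Str) (t : ℕ) : M.Config := (step φ)^[t] (M.init a)

/-- The number of steps taken with oracle `φ` on input `a` (`⊤` if there is no termination). -/
noncomputable def time (φ : StrFun) (a : Str) : ℕ∞ :=
  ⨅ t : {t : ℕ // (M.run φ a t).state = M.halt}, ((t : ℕ) : ℕ∞)

/-- The partial string function computed with oracle `φ`: the string on the output tape after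
termination. -/
noncomputable def result (φ : StrFun) : Str →. Str := fun a =>
  ⟨∃ t, (M.run φ a t).state = M.halt, fun h => readStr ((M.run φ a h.choose).cells .output)⟩

/-- The partial operator computed by the machine: it is defined on those oracles for which the
machine terminates on every input. -/
noncomputable def operator : StrFun →. StrFun := fun φ =>
  ⟨∀ a, (M.result φ a).Dom, fun h a => (M.result φ a).get (h a)⟩

end OracleMachine

/-! ### Preparametrised spaces and polynomial-time computable functions -/

/-- A set with a representation (a partial surjection from string functions) and a parameter,
which assigns a non-decreasing function to every name. -/
structure PreparamSpace (α : Type*) where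
  rep : StrFun →. α
  rep_surj : ∀ x, ∃ φ, x ∈ rep φ
  param : rep.Dom → ℕ → ℕ
  param_mono : ∀ φ, Monotone (param φ)

/-- `F` translates names of arguments of `f` into names of values of `f`. -/
def IsRealiser {α β : Type*} (X : PreparamSpace α) (Y : PreparamSpace β)
    (F : StrFun →. StrFun) (f : α → β) : Prop :=
  ∀ φ x, x ∈ X.rep φ → ∃ ψ ∈ F φ, f x ∈ Y.rep ψ

/-- Polynomial-time computability of a function between preparametrised spaces: some machine
computes a realiser, with running time and parameter blowup bounded by second-order
polynomials in the parameter. -/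
def PolytimeComputable {α β : Type*} (X : PreparamSpace α) (Y : PreparamSpace β)
    (f : α → β) : Prop :=
  ∃ (M : OracleMachine) (P Q : (ℕ → ℕ) → ℕ → ℕ), IsSOP P ∧ IsSOP Q ∧
    IsRealiser X Y M.operator f ∧
    (∀ (φ : X.rep.Dom) (a : Str), M.time φ a ≤ (P (X.param φ) a.length : ℕ∞)) ∧
    (∀ (φ : X.rep.Dom) (ψ : Y.rep.Dom), (ψ : StrFun) ∈ M.operator φ →
      ∀ n, Y.param ψ n ≤ Q (X.param φ) n)

/-- The partial function with a given single-valued graph. -/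
noncomputable def graphFun {A B : Type*} (R : A → B → Prop) : A →. B :=
  fun φ => ⟨∃ x, R φ x, fun h => h.choose⟩

theorem mem_graphFun {A B : Type*} {R : A → B → Prop}
    (hR : ∀ φ x y, R φ x → R φ y → x = y) (φ : A) (x : B) : x ∈ graphFun R φ ↔ R φ x := by
  constructor
  · rintro ⟨h, rfl⟩
    exact Exists.choose_spec h
  · intro h
    exact ⟨⟨x, h⟩, hR φ _ _ (Exists.choose_spec (⟨x, h⟩ : ∃ x, R φ x)) h⟩

/-- The pairing of string functions. -/
def pairFun (φ ψ : StrFun) : StrFun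
  | .zero :: b => φ b
  | .one :: b => ψ b
  | _ => []

theorem pairFun_inj {φ ψ φ' ψ' : StrFun} (h : pairFun φ ψ = pairFun φ' ψ') :
    φ = φ' ∧ ψ = ψ' :=
  ⟨funext fun b => congrFun h (.zero :: b), funext fun b => congrFun h (.one :: b)⟩

/-- `φ` is a name of a pair if it is the pairing of names of the components. -/
def IsPairName {α β : Type*} (X : PreparamSpace α) (Y : PreparamSpace β)
    (φ : StrFun) (z : α × β) : Prop :=
  ∃ φ₁ φ₂, φ = pairFun φ₁ φ₂ ∧ z.1 ∈ X.rep φ₁ ∧ z.2 ∈ Y.rep φ₂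

theorem IsPairName.unique {α β : Type*} (X : PreparamSpace α) (Y : PreparamSpace β)
    (φ : StrFun) (z w : α × β) (hz : IsPairName X Y φ z) (hw : IsPairName X Y φ w) :
    z = w := by
  obtain ⟨a, b, rfl, h1, h2⟩ := hz
  obtain ⟨a', b', h, h1', h2'⟩ := hw
  obtain ⟨rfl, rfl⟩ := pairFun_inj h
  exact Prod.ext (Part.mem_unique h1 h1') (Part.mem_unique h2 h2')

theorem IsPairName.left {α β : Type*} {X : PreparamSpace α} {Y : PreparamSpace β}
    {φ : StrFun} {z : α × β} (h : IsPairName X Y φ z) :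
    (fun b => φ (.zero :: b)) ∈ X.rep.Dom := by
  obtain ⟨a, b, rfl, h1, -⟩ := h
  exact Part.dom_iff_mem.2 ⟨_, h1⟩

theorem IsPairName.right {α β : Type*} {X : PreparamSpace α} {Y : PreparamSpace β}
    {φ : StrFun} {z : α × β} (h : IsPairName X Y φ z) :
    (fun b => φ (.one :: b)) ∈ Y.rep.Dom := by
  obtain ⟨a, b, rfl, -, h2⟩ := h
  exact Part.dom_iff_mem.2 ⟨_, h2⟩

/-- The product of two preparametrised spaces; the parameter is the pointwise maximum of the
parameters of the components of a name. -/
noncomputable def PreparamSpace.prod {α β : Type*} (X : PreparamSpace α)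
    (Y : PreparamSpace β) : PreparamSpace (α × β) where
  rep := graphFun (IsPairName X Y)
  rep_surj := fun z => by
    obtain ⟨a, ha⟩ := X.rep_surj z.1
    obtain ⟨b, hb⟩ := Y.rep_surj z.2
    exact ⟨pairFun a b, (mem_graphFun (IsPairName.unique X Y) _ _).2 ⟨a, b, rfl, ha, hb⟩⟩
  param := fun φ n =>
    max (X.param ⟨fun b => φ.1 (.zero :: b), φ.2.choose_spec.left⟩ n)
      (Y.param ⟨fun b => φ.1 (.one :: b), φ.2.choose_spec.right⟩ n)
  param_mono := fun _ _ _ h => max_le_max (X.param_mono _ h) (Y.param_mono _ h)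

/-- The subspace given by a subset: the representation is restricted in its range and the
parameter to the remaining names. -/
noncomputable def PreparamSpace.restrict {α : Type*} (X : PreparamSpace α) (S : Set α) :
    PreparamSpace S where
  rep := graphFun fun φ (x : S) => (x : α) ∈ X.rep φ
  rep_surj := fun x => by
    obtain ⟨φ, h⟩ := X.rep_surj x
    exact ⟨φ, (mem_graphFun (R := fun φ (x : S) => (x : α) ∈ X.rep φ)
      (fun _ _ _ hx hy => Subtype.ext (Part.mem_unique hx hy)) _ _).2 h⟩
  param := fun φ => X.param ⟨φ.1, φ.2.choose_spec.1⟩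
  param_mono := fun _ => X.param_mono _

/-! ### Codes of dyadic intervals -/

/-- The symbol of a bit. -/
def Sym.ofBit : Bool → Sym
  | false => .zero
  | true => .one

/-- The value of a binary expansion, most significant bit first. -/
def binVal (l : List Bool) : ℕ := l.foldl (fun n b => 2 * n + b.toNat) 0

/-- Codes of integers: a sign bit followed by the binary expansion of the absolute value without
leading zeros; strings without a second bit are (signed) codes of zero. -/
def IsIntCode (l : List Bool) : Prop := l.length ≤ 1 ∨ l[1]? = some true

/-- The sign denoted by the first bit. -/
def signVal : List Bool → ℤ
  | true :: _ => -1
  | _ => 1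

/-- The code of the integer `2 ^ n`. Natural numbers `n` are given to string functions by these
codes, hence essentially in unary. -/
def natCode (n : ℕ) : Str := .zero :: .one :: List.replicate n .zero

/-- Dyadic rationals. -/
def IsDyadic (q : ℝ) : Prop := ∃ (m : ℤ) (n : ℕ), q = m / 2 ^ n

/-- `w` is a code of the dyadic rational `q`: a code of an integer, the separator, and the finite
binary expansion of the fractional part, without trailing zeros. -/
def IsDyadicCode (w : Str) (q : ℝ) : Prop :=
  ∃ a b : List Bool, IsIntCode a ∧ b.getLast? ≠ some false ∧
    w = a.map Sym.ofBit ++ Sym.sep :: b.map Sym.ofBit ∧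
    q = signVal a * (binVal a.tail + binVal b / 2 ^ b.length)

/-- Append zeros up to the length `L`. -/
def padTo (L : ℕ) (w : Str) : Str := w ++ List.replicate (L - w.length) Sym.zero

/-- Alternate between the symbols of three strings of equal length. -/
def interleave : Str → Str → Str → Str
  | c :: cs, a :: as, b :: bs => c :: a :: b :: interleave cs as bs
  | _, _, _ => []

/-- The control string of a pair: one `1` for each position where both strings are present, then
a `0` and a bit that tells which of the strings is longer. -/
def pairControl (a b : Str) : Str :=
  List.replicate (min a.length b.length) Sym.one ++
    [Sym.zero, Sym.ofBit (decide (b.length < a.length))]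

/-- The pairing of strings. The first `n` symbols of both strings can be read off from the first
`3 * (n + 2)` symbols of the pairing. -/
def strPair (a b : Str) : Str :=
  let L := max (max a.length b.length) (pairControl a b).length
  interleave (padTo L (pairControl a b)) (padTo L a) (padTo L b)

/-- The finite (non-degenerate) closed intervals with dyadic end points, and the infinite
interval. -/
inductive DyadicInterval where
  | whole
  | fin (lo hi : ℝ) (hlo : IsDyadic lo) (hhi : IsDyadic hi) (h : lo < hi)

/-- The real numbers in an interval. -/
def DyadicInterval.toSet : DyadicInterval → Set ℝ
  | .whole => Set.univ
  | .fin lo hi _ _ _ => Set.Icc lo hi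

/-- The diameter of an interval. -/
noncomputable def DyadicInterval.diam : DyadicInterval → EReal
  | .whole => ⊤
  | .fin lo hi _ _ _ => ((hi - lo : ℝ) : EReal)

/-- `w` is a code of the interval: the empty string for the infinite interval, the pairing of a
code of the midpoint and a code of the radius for a finite one. -/
def IntervalCode (w : Str) : DyadicInterval → Prop
  | .whole => w = []
  | .fin lo hi _ _ _ => ∃ a b, IsDyadicCode a ((lo + hi) / 2) ∧
      IsDyadicCode b ((hi - lo) / 2) ∧ w = strPair a b

/-! Every dyadic interval has a code, and a code belongs to only one interval. -/

theorem binVal_append (l : List Bool) (b : Bool) :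
    binVal (l ++ [b]) = 2 * binVal l + b.toNat := by
  simp [binVal, List.foldl_append]

theorem exists_bits (n : ℕ) : ∀ B < 2 ^ n, ∃ l : List Bool, l.length = n ∧ binVal l = B ∧
    (B % 2 = 1 → l.getLast? ≠ some false) := by
  induction n with
  | zero =>
    intro B hB
    refine ⟨[], rfl, ?_, by simp⟩
    simp [binVal] at *
    omega
  | succ n ih =>
    intro B hB
    obtain ⟨l, h1, h2, -⟩ := ih (B / 2) (by rw [pow_succ] at hB; omega)
    refine ⟨l ++ [decide (B % 2 = 1)], by simp [h1], ?_, ?_⟩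
    · rw [binVal_append, h2]
      by_cases h : B % 2 = 1 <;> simp [h] <;> omega
    · intro h
      simp [h]

theorem exists_lead (A : ℕ) : 0 < A → ∃ l : List Bool, binVal (true :: l) = A := by
  induction A using Nat.strong_induction_on with
  | _ A ih =>
    intro hA
    by_cases h1 : A = 1
    · exact ⟨[], by simp [binVal, h1]⟩
    · obtain ⟨l, hl⟩ := ih (A / 2) (by omega) (by omega)
      refine ⟨l ++ [decide (A % 2 = 1)], ?_⟩
      rw [← List.cons_append, binVal_append, hl]
      by_cases h : A % 2 = 1 <;> simp [h] <;> omega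

theorem exists_dyadicCode_aux (n : ℕ) : ∀ m : ℤ, ∃ w, IsDyadicCode w (m / 2 ^ n) := by
  have key : ∀ (n : ℕ) (m : ℤ), (n = 0 ∨ m % 2 = 1) → ∃ w, IsDyadicCode w (m / 2 ^ n) := by
    intro n m hmn
    have hpos : 0 < 2 ^ n := by positivity
    obtain ⟨b, hb1, hb2, hb3⟩ := exists_bits n (m.natAbs % 2 ^ n) (Nat.mod_lt _ hpos)
    have hlast : b.getLast? ≠ some false := by
      rcases hmn with rfl | hm
      · have : b = [] := by simpa using hb1
        simp [this]
      · rcases n with _ | n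
        · have : b = [] := by simpa using hb1
          simp [this]
        · apply hb3
          rw [Nat.mod_mod_of_dvd _ (dvd_pow_self 2 (by omega))]
          omega
    have hA : ∃ a : List Bool, IsIntCode a ∧ signVal a = (if m < 0 then -1 else 1) ∧
        binVal a.tail = m.natAbs / 2 ^ n := by
      by_cases hz : m.natAbs / 2 ^ n = 0
      · refine ⟨[decide (m < 0)], Or.inl (by simp), ?_, by simp [binVal, hz]⟩
        by_cases h : m < 0 <;> simp [h, signVal]
      · obtain ⟨l, hl⟩ := exists_lead _ (Nat.pos_of_ne_zero hz)
        refine ⟨decide (m < 0) :: true :: l, Or.inr (by simp), ?_, by simpa using hl⟩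
        by_cases h : m < 0 <;> simp [h, signVal]
    obtain ⟨a, ha1, ha2, ha3⟩ := hA
    refine ⟨_, a, b, ha1, hlast, rfl, ?_⟩
    rw [ha2, ha3, hb2, hb1]
    have hdm : ((m.natAbs : ℕ) : ℝ) = 2 ^ n * ((m.natAbs / 2 ^ n : ℕ) : ℝ)
        + ((m.natAbs % 2 ^ n : ℕ) : ℝ) := by
      exact_mod_cast (Nat.div_add_mod m.natAbs (2 ^ n)).symm
    have habs : (m : ℝ) = (if m < 0 then -1 else 1 : ℤ) * ((m.natAbs : ℕ) : ℝ) := by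
      rw [Nat.cast_natAbs]
      by_cases h : m < 0
      · have : |m| = -m := abs_of_neg h
        simp [h, this]
      · have : |m| = m := abs_of_nonneg (not_lt.1 h)
        simp [h, this]
    have h2 : (2 : ℝ) ^ n ≠ 0 := by positivity
    rw [habs, hdm]
    field_simp
  induction n with
  | zero => exact fun m => key 0 m (Or.inl rfl)
  | succ n ih =>
    intro m
    by_cases h : m % 2 = 1
    · exact key _ m (Or.inr h)
    · obtain ⟨k, rfl⟩ : ∃ k, m = 2 * k := ⟨m / 2, by omega⟩
      obtain ⟨w, hw⟩ := ih k
      refine ⟨w, ?_⟩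
      convert hw using 1
      push_cast
      rw [pow_succ]
      field_simp

theorem exists_dyadicCode {q : ℝ} (h : IsDyadic q) : ∃ w, IsDyadicCode w q := by
  obtain ⟨m, n, rfl⟩ := h
  exact exists_dyadicCode_aux n m

theorem ofBit_inj : Function.Injective Sym.ofBit := by
  intro a b h
  cases a <;> cases b <;> simp_all [Sym.ofBit]

theorem split_inj : ∀ {a a' : List Bool} {v v' : Str},
    a.map Sym.ofBit ++ Sym.sep :: v = a'.map Sym.ofBit ++ Sym.sep :: v' → a = a' ∧ v = v'
  | [], [], _, _, h => by simpa using h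
  | [], c :: _, _, _, h => by cases c <;> simp [Sym.ofBit] at h
  | c :: _, [], _, _, h => by cases c <;> simp [Sym.ofBit] at h
  | c :: l, c' :: l', v, v', h => by
    simp only [List.map_cons, List.cons_append, List.cons.injEq] at h
    obtain ⟨h1, h2⟩ := split_inj h.2
    exact ⟨by rw [ofBit_inj h.1, h1], h2⟩

theorem IsDyadicCode.unique {w : Str} {p q : ℝ} (hp : IsDyadicCode w p)
    (hq : IsDyadicCode w q) : p = q := by
  obtain ⟨a, b, -, -, rfl, rfl⟩ := hp
  obtain ⟨a', b', -, -, h, rfl⟩ := hq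
  obtain ⟨rfl, h'⟩ := split_inj h
  obtain rfl := ofBit_inj.list_map h'
  rfl

theorem IsDyadicCode.last {w : Str} {p : ℝ} (hp : IsDyadicCode w p) :
    w.getLast? ≠ some Sym.zero := by
  obtain ⟨a, b, -, hb, rfl, -⟩ := hp
  rcases List.eq_nil_or_concat b with rfl | ⟨b, c, rfl⟩
  · simp
  · cases c
    · simp at hb
    · rw [List.concat_eq_append, List.map_append, ← List.cons_append, ← List.append_assoc]
      simp only [List.map_cons, List.map_nil, List.getLast?_concat]
      simp [Sym.ofBit]

theorem pad_inj {a a' : Str} {k k' : ℕ} (ha : a.getLast? ≠ some Sym.zero)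
    (ha' : a'.getLast? ≠ some Sym.zero)
    (h : a ++ List.replicate k Sym.zero = a' ++ List.replicate k' Sym.zero) : a = a' := by
  have main : ∀ (u t : Str) (k k' : ℕ), (u ++ t).getLast? ≠ some Sym.zero →
      List.replicate k Sym.zero = t ++ List.replicate k' Sym.zero → t = [] := by
    intro u t k k' hu ht
    rcases List.eq_nil_or_concat t with rfl | ⟨t, c, rfl⟩
    · rfl
    · have hc : c ∈ List.replicate k Sym.zero := by rw [ht]; simp
      rw [List.eq_of_mem_replicate hc] at hu
      simp [List.getLast?_append] at hu
  rcases List.append_eq_append_iff.1 h with ⟨t, h1, h2⟩ | ⟨t, h1, h2⟩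
  · have := main a t k k' (h1 ▸ ha') h2
    simp [h1, this]
  · have := main a' t k' k (h1 ▸ ha) h2
    simp [h1, this]

theorem interleave_inj : ∀ {c a b c' a' b' : Str}, a.length = c.length → b.length = c.length →
    a'.length = c'.length → b'.length = c'.length →
    interleave c a b = interleave c' a' b' → a = a' ∧ b = b'
  | [], a, b, [], a', b', h1, h2, h3, h4, _ => by
    simp_all
  | [], a, b, c' :: cs', a', b', h1, h2, h3, h4, h => by
    obtain ⟨x, a', rfl⟩ := List.exists_cons_of_length_eq_add_one h3
    obtain ⟨y, b', rfl⟩ := List.exists_cons_of_length_eq_add_one h4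
    simp [interleave] at h
  | c :: cs, a, b, [], a', b', h1, h2, h3, h4, h => by
    obtain ⟨x, a, rfl⟩ := List.exists_cons_of_length_eq_add_one h1
    obtain ⟨y, b, rfl⟩ := List.exists_cons_of_length_eq_add_one h2
    simp [interleave] at h
  | c :: cs, a, b, c' :: cs', a', b', h1, h2, h3, h4, h => by
    obtain ⟨x, a, rfl⟩ := List.exists_cons_of_length_eq_add_one h1
    obtain ⟨y, b, rfl⟩ := List.exists_cons_of_length_eq_add_one h2
    obtain ⟨x', a', rfl⟩ := List.exists_cons_of_length_eq_add_one h3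
    obtain ⟨y', b', rfl⟩ := List.exists_cons_of_length_eq_add_one h4
    simp only [interleave, List.cons.injEq] at h
    obtain ⟨-, h5, h6, h⟩ := h
    obtain ⟨r1, r2⟩ := interleave_inj (by simpa using h1) (by simpa using h2)
      (by simpa using h3) (by simpa using h4) h
    exact ⟨by rw [h5, r1], by rw [h6, r2]⟩

theorem length_padTo {L : ℕ} {w : Str} (h : w.length ≤ L) : (padTo L w).length = L := by
  simp [padTo, h]

theorem strPair_inj {a b a' b' : Str} (ha : a.getLast? ≠ some Sym.zero)
    (hb : b.getLast? ≠ some Sym.zero) (ha' : a'.getLast? ≠ some Sym.zero)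
    (hb' : b'.getLast? ≠ some Sym.zero) (h : strPair a b = strPair a' b') :
    a = a' ∧ b = b' := by
  have key := interleave_inj ?_ ?_ ?_ ?_ h
  · exact ⟨pad_inj ha ha' key.1, pad_inj hb hb' key.2⟩
  all_goals
    rw [length_padTo (by simp), length_padTo (by simp)]

theorem strPair_ne_nil (a b : Str) : strPair a b ≠ [] := by
  intro h
  have key := interleave_inj (c' := []) (a' := []) (b' := []) ?_ ?_ rfl rfl h
  · have h2 := congrArg List.length key.1
    rw [length_padTo (by simp)] at h2
    simp [pairControl] at h2
  all_goals
    rw [length_padTo (by simp), length_padTo (by simp)]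

theorem IntervalCode.unique {w : Str} {J K : DyadicInterval} (hJ : IntervalCode w J)
    (hK : IntervalCode w K) : J = K := by
  cases J with
  | whole =>
    cases K with
    | whole => rfl
    | fin =>
      obtain ⟨a, b, -, -, h⟩ := hK
      exact absurd (h.symm.trans hJ) (strPair_ne_nil _ _)
  | fin lo hi h1 h2 h3 =>
    cases K with
    | whole =>
      obtain ⟨a, b, -, -, h⟩ := hJ
      exact absurd (h.symm.trans hK) (strPair_ne_nil _ _)
    | fin lo' hi' h1' h2' h3' =>
      obtain ⟨a, b, ha, hb, rfl⟩ := hJ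
      obtain ⟨a', b', ha', hb', h⟩ := hK
      obtain ⟨rfl, rfl⟩ := strPair_inj ha.last hb.last ha'.last hb'.last h
      have e1 := ha.unique ha'
      have e2 := hb.unique hb'
      obtain rfl : lo = lo' := by linarith
      obtain rfl : hi = hi' := by linarith
      rfl

theorem IsDyadic.add {p q : ℝ} (hp : IsDyadic p) (hq : IsDyadic q) : IsDyadic (p + q) := by
  obtain ⟨m, n, rfl⟩ := hp
  obtain ⟨m', n', rfl⟩ := hq
  refine ⟨m * 2 ^ n' + m' * 2 ^ n, n + n', ?_⟩
  push_cast
  rw [pow_add]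
  field_simp

theorem IsDyadic.sub {p q : ℝ} (hp : IsDyadic p) (hq : IsDyadic q) : IsDyadic (p - q) := by
  obtain ⟨m, n, rfl⟩ := hq
  rw [sub_eq_add_neg]
  exact hp.add ⟨-m, n, by push_cast; ring⟩

theorem IsDyadic.half {p : ℝ} (hp : IsDyadic p) : IsDyadic (p / 2) := by
  obtain ⟨m, n, rfl⟩ := hp
  exact ⟨m, n + 1, by rw [pow_succ]; field_simp⟩

theorem exists_intervalCode (J : DyadicInterval) : ∃ w, IntervalCode w J := by
  cases J with
  | whole => exact ⟨[], rfl⟩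
  | fin lo hi h1 h2 h3 =>
    obtain ⟨a, ha⟩ := exists_dyadicCode (h1.add h2).half
    obtain ⟨b, hb⟩ := exists_dyadicCode (h2.sub h1).half
    exact ⟨_, a, b, ha, hb, rfl⟩

/-! ### The preparametrised space of interval reals -/

/-- A nested sequence of dyadic intervals whose intersection is `{x}`. -/
def IsIntervalName (J : ℕ → DyadicInterval) (x : ℝ) : Prop :=
  (∀ n, (J (n + 1)).toSet ⊆ (J n).toSet) ∧ ⋂ n, (J n).toSet = {x}

/-- `φ` is a name of the real number `x`: as a function on codes, it is a nested sequence of dyadic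
intervals whose intersection is `{x}`. -/
def IsRealName (φ : StrFun) (x : ℝ) : Prop :=
  ∃ J : ℕ → DyadicInterval, (∀ n, IntervalCode (φ (natCode n)) (J n)) ∧ IsIntervalName J x

theorem DyadicInterval.ordConnected (J : DyadicInterval) : J.toSet.OrdConnected := by
  cases J with
  | whole => exact Set.ordConnected_univ
  | fin => exact Set.ordConnected_Icc

theorem IsIntervalName.anti {J : ℕ → DyadicInterval} {x : ℝ} (h : IsIntervalName J x) {m n : ℕ}
    (hmn : m ≤ n) : (J n).toSet ⊆ (J m).toSet :=
  antitone_nat_of_succ_le (f := fun n => (J n).toSet) h.1 hmn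

theorem IsIntervalName.mem {J : ℕ → DyadicInterval} {x : ℝ} (h : IsIntervalName J x) (n : ℕ) :
    x ∈ (J n).toSet := by
  have : x ∈ ⋂ n, (J n).toSet := by rw [h.2]; rfl
  exact Set.mem_iInter.1 this n

theorem IsIntervalName.unique {J : ℕ → DyadicInterval} {x y : ℝ} (h : IsIntervalName J x)
    (h' : IsIntervalName J y) : x = y :=
  Set.singleton_injective (h.2.symm.trans h'.2)

theorem IsIntervalName.shrink {J : ℕ → DyadicInterval} {x δ : ℝ} (h : IsIntervalName J x)
    (hδ : 0 < δ) : ∃ n, (J n).toSet ⊆ Set.Ioo (x - δ) (x + δ) := by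
  have key : ∀ y, y ≠ x → ∃ n, y ∉ (J n).toSet := by
    intro y hy
    by_contra hc
    push Not at hc
    have : y ∈ ⋂ n, (J n).toSet := Set.mem_iInter.2 hc
    rw [h.2] at this
    exact hy this
  obtain ⟨a, ha⟩ := key (x - δ) (by linarith)
  obtain ⟨b, hb⟩ := key (x + δ) (by linarith)
  refine ⟨max a b, fun y hy => ⟨?_, ?_⟩⟩
  · by_contra hc
    exact ha (h.anti (le_max_left a b) ((DyadicInterval.ordConnected _).out hy (h.mem _)
      ⟨not_lt.1 hc, by linarith⟩))
  · by_contra hc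
    exact hb (h.anti (le_max_right a b) ((DyadicInterval.ordConnected _).out (h.mem _) hy
      ⟨by linarith, not_lt.1 hc⟩))

theorem DyadicInterval.exists_of_subset {J : DyadicInterval} {a b : ℝ}
    (h : J.toSet ⊆ Set.Icc a b) :
    ∃ lo hi h1 h2 h3, J = .fin lo hi h1 h2 h3 ∧ a ≤ lo ∧ hi ≤ b := by
  cases J with
  | whole =>
    have h1 := (h (Set.mem_univ (b + 1))).2
    linarith
  | fin lo hi h1 h2 h3 =>
    obtain ⟨h4, h5⟩ := (Set.Icc_subset_Icc_iff h3.le).1 h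
    exact ⟨lo, hi, h1, h2, h3, rfl, h4, h5⟩

theorem DyadicInterval.diam_mono {J K : DyadicInterval} (h : J.toSet ⊆ K.toSet) :
    J.diam ≤ K.diam := by
  cases K with
  | whole => exact le_top
  | fin lo hi h1 h2 h3 =>
    obtain ⟨lo', hi', h1', h2', h3', rfl, h4, h5⟩ := exists_of_subset h
    exact EReal.coe_le_coe_iff.2 (by linarith)

theorem DyadicInterval.diam_le {J : DyadicInterval} {a b : ℝ} (h : J.toSet ⊆ Set.Icc a b) :
    J.diam ≤ ((b - a : ℝ) : EReal) := by
  obtain ⟨lo', hi', h1', h2', h3', rfl, h4, h5⟩ := exists_of_subset h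
  exact EReal.coe_le_coe_iff.2 (by linarith)

theorem IsIntervalName.exists_diam_le {J : ℕ → DyadicInterval} {x : ℝ} (h : IsIntervalName J x)
    (n : ℕ) : ∃ N, (J N).diam ≤ (((1 / 2 : ℝ) ^ n : ℝ) : EReal) := by
  have hp : (0 : ℝ) < (1 / 2) ^ n := by positivity
  obtain ⟨N, hN⟩ := h.shrink (half_pos hp)
  refine ⟨N, (DyadicInterval.diam_le (hN.trans Set.Ioo_subset_Icc_self)).trans
    (EReal.coe_le_coe_iff.2 ?_)⟩
  linarith

/-- Rounding down to a multiple of `2 ^ (-k)`. -/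
noncomputable def gridLo (k : ℕ) (y : ℝ) : ℝ := (⌊2 ^ k * y⌋ : ℝ) / 2 ^ k

/-- The next multiple of `2 ^ (-k)`. -/
noncomputable def gridHi (k : ℕ) (y : ℝ) : ℝ := ((⌊2 ^ k * y⌋ + 1 : ℤ) : ℝ) / 2 ^ k

theorem isDyadic_gridLo (k : ℕ) (y : ℝ) : IsDyadic (gridLo k y) := ⟨_, k, rfl⟩

theorem isDyadic_gridHi (k : ℕ) (y : ℝ) : IsDyadic (gridHi k y) := ⟨_, k, rfl⟩

theorem isDyadic_half_pow (k : ℕ) : IsDyadic ((1 / 2 : ℝ) ^ k) := ⟨1, k, by simp⟩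

theorem gridLo_le (k : ℕ) (y : ℝ) : gridLo k y ≤ y := by
  rw [gridLo, div_le_iff₀ (by positivity), mul_comm y]
  exact Int.floor_le _

theorem lt_gridHi (k : ℕ) (y : ℝ) : y < gridHi k y := by
  rw [gridHi, lt_div_iff₀ (by positivity), mul_comm y]
  push_cast
  exact Int.lt_floor_add_one _

theorem gridHi_eq (k : ℕ) (y : ℝ) : gridHi k y = gridLo k y + (1 / 2) ^ k := by
  rw [gridHi, gridLo]
  push_cast
  rw [add_div, one_div_pow]

theorem gridLo_mono {k k' : ℕ} {y y' : ℝ} (hk : k ≤ k') (hy : y ≤ y') :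
    gridLo k y ≤ gridLo k' y' := by
  obtain ⟨d, rfl⟩ := Nat.exists_eq_add_of_le hk
  have h1 : ⌊(2 : ℝ) ^ k * y⌋ * 2 ^ d ≤ ⌊(2 : ℝ) ^ (k + d) * y'⌋ := by
    rw [Int.le_floor]
    push_cast
    have := Int.floor_le ((2 : ℝ) ^ k * y)
    have h2 : (2 : ℝ) ^ k * y ≤ 2 ^ k * y' := by gcongr
    calc (⌊(2 : ℝ) ^ k * y⌋ : ℝ) * 2 ^ d ≤ (2 ^ k * y') * 2 ^ d := by gcongr; linarith
      _ = _ := by rw [pow_add]; ring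
  have h3 : ((⌊(2 : ℝ) ^ k * y⌋ : ℝ)) * 2 ^ d ≤ (⌊(2 : ℝ) ^ (k + d) * y'⌋ : ℝ) := by
    exact_mod_cast h1
  rw [gridLo, gridLo, div_le_div_iff₀ (by positivity) (by positivity), pow_add]
  calc (⌊(2 : ℝ) ^ k * y⌋ : ℝ) * (2 ^ k * 2 ^ d)
      = ((⌊(2 : ℝ) ^ k * y⌋ : ℝ) * 2 ^ d) * 2 ^ k := by ring
    _ ≤ _ := by rw [← pow_add]; gcongr

theorem gridHi_anti {k k' : ℕ} {y y' : ℝ} (hk : k ≤ k') (hy : y' ≤ y) :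
    gridHi k' y' ≤ gridHi k y := by
  obtain ⟨d, rfl⟩ := Nat.exists_eq_add_of_le hk
  have h1 : ⌊(2 : ℝ) ^ (k + d) * y'⌋ + 1 ≤ (⌊(2 : ℝ) ^ k * y⌋ + 1) * 2 ^ d := by
    rw [Int.add_one_le_iff, Int.floor_lt]
    push_cast
    have := Int.lt_floor_add_one ((2 : ℝ) ^ k * y)
    have h2 : (2 : ℝ) ^ k * y' ≤ 2 ^ k * y := by gcongr
    calc (2 : ℝ) ^ (k + d) * y' = (2 ^ k * y') * 2 ^ d := by rw [pow_add]; ring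
      _ < _ := by gcongr; linarith
  have h3 : ((⌊(2 : ℝ) ^ (k + d) * y'⌋ + 1 : ℤ) : ℝ)
      ≤ ((⌊(2 : ℝ) ^ k * y⌋ + 1 : ℤ) : ℝ) * 2 ^ d := by
    exact_mod_cast h1
  rw [gridHi, gridHi, div_le_div_iff₀ (by positivity) (by positivity)]
  calc ((⌊(2 : ℝ) ^ (k + d) * y'⌋ + 1 : ℤ) : ℝ) * 2 ^ k
      ≤ (((⌊(2 : ℝ) ^ k * y⌋ + 1 : ℤ) : ℝ) * 2 ^ d) * 2 ^ k := by gcongr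
    _ = _ := by rw [pow_add]; ring

theorem IsDyadic.max {p q : ℝ} (hp : IsDyadic p) (hq : IsDyadic q) : IsDyadic (max p q) := by
  rcases max_choice p q with h | h <;> rw [h] <;> assumption

theorem IsDyadic.min {p q : ℝ} (hp : IsDyadic p) (hq : IsDyadic q) : IsDyadic (min p q) := by
  rcases min_choice p q with h | h <;> rw [h] <;> assumption

/-- Every point of a dyadic interval has a name inside this interval. -/
theorem exists_intervalName (J : DyadicInterval) {x : ℝ} (hx : x ∈ J.toSet) :
    ∃ D : ℕ → DyadicInterval, IsIntervalName D x ∧ (∀ n, (D n).toSet ⊆ J.toSet) ∧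
      ∀ n, J.toSet ∩ Set.Icc (x - (1 / 2) ^ n) (x + (1 / 2) ^ n) ⊆ (D n).toSet := by
  set gl : ℕ → ℝ := fun n => gridLo n x - (1 / 2) ^ n with hgl
  set gu : ℕ → ℝ := fun n => gridHi n x + (1 / 2) ^ n with hgu
  have dl : ∀ n, IsDyadic (gl n) := fun n => (isDyadic_gridLo n x).sub (isDyadic_half_pow n)
  have du : ∀ n, IsDyadic (gu n) := fun n => (isDyadic_gridHi n x).add (isDyadic_half_pow n)
  have pw : ∀ n : ℕ, (0 : ℝ) < (1 / 2) ^ n := fun n => by positivity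
  have ps : ∀ n : ℕ, ((1 : ℝ) / 2) ^ (n + 1) ≤ (1 / 2) ^ n := fun n => by
    rw [pow_succ]; linarith [pw n]
  have l1 : ∀ n, gl n ≤ x - (1 / 2) ^ n := fun n => by
    have := gridLo_le n x; simp only [hgl]; linarith
  have u1 : ∀ n, x + (1 / 2) ^ n ≤ gu n := fun n => by
    have := lt_gridHi n x; simp only [hgu]; linarith
  have l2 : ∀ n, x - 2 * (1 / 2) ^ n ≤ gl n := fun n => by
    have := lt_gridHi n x; rw [gridHi_eq] at this; simp only [hgl]; linarith
  have u2 : ∀ n, gu n ≤ x + 2 * (1 / 2) ^ n := fun n => by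
    have := gridLo_le n x; simp only [hgu, gridHi_eq]; linarith
  have lm : ∀ n, gl n ≤ gl (n + 1) := fun n => by
    have := gridLo_mono (Nat.le_succ n) (le_refl x)
    have := ps n
    simp only [hgl]; linarith
  have um : ∀ n, gu (n + 1) ≤ gu n := fun n => by
    have := gridHi_anti (Nat.le_succ n) (le_refl x)
    have := ps n
    simp only [hgu]; linarith
  have main : ∃ D : ℕ → DyadicInterval, ∀ n, (D n).toSet = J.toSet ∩ Set.Icc (gl n) (gu n) := by
    cases J with
    | whole =>
      refine ⟨fun n => .fin (gl n) (gu n) (dl n) (du n) ?_, fun n => ?_⟩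
      · linarith [l1 n, u1 n, pw n]
      · simp [DyadicInterval.toSet]
    | fin lo hi h1 h2 h3 =>
      refine ⟨fun n => .fin (max lo (gl n)) (min hi (gu n)) (h1.max (dl n)) (h2.min (du n)) ?_,
        fun n => ?_⟩
      · have := hx.1
        have := hx.2
        have := l1 n
        have := u1 n
        have := pw n
        exact max_lt (lt_min h3 (by linarith)) (lt_min (by linarith) (by linarith))
      · simp [DyadicInterval.toSet, Set.Icc_inter_Icc]
  obtain ⟨D, hD⟩ := main
  refine ⟨D, ⟨fun n => ?_, ?_⟩, fun n => ?_, fun n => ?_⟩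
  · rw [hD, hD]
    exact Set.inter_subset_inter_right _ (Set.Icc_subset_Icc (lm n) (um n))
  · apply Set.eq_singleton_iff_unique_mem.2
    refine ⟨Set.mem_iInter.2 fun n => ?_, fun y hy => ?_⟩
    · rw [hD]
      exact ⟨hx, by linarith [l1 n, pw n], by linarith [u1 n, pw n]⟩
    · by_contra hne
      have hpos : 0 < |y - x| := abs_pos.2 (sub_ne_zero.2 hne)
      obtain ⟨n, hn⟩ := exists_pow_lt_of_lt_one (half_pos hpos) (by norm_num : (1 / 2 : ℝ) < 1)
      have h1 := Set.mem_iInter.1 hy n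
      rw [hD] at h1
      have h2 : |y - x| ≤ 2 * (1 / 2) ^ n := by
        rw [abs_le]
        constructor
        · linarith [h1.2.1, l2 n]
        · linarith [h1.2.2, u2 n]
      linarith
  · rw [hD]; exact Set.inter_subset_left
  · rw [hD]
    exact Set.inter_subset_inter_right _ (Set.Icc_subset_Icc (l1 n) (u1 n))

theorem IsIntervalName.cons {D : ℕ → DyadicInterval} {K : DyadicInterval} {x : ℝ}
    (h : IsIntervalName D x) (hK : (D 0).toSet ⊆ K.toSet) :
    IsIntervalName (fun n => Nat.casesOn n K D) x := by
  refine ⟨fun n => ?_, ?_⟩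
  · cases n with
    | zero => exact hK
    | succ n => exact h.1 n
  · rw [← h.2]
    apply Set.Subset.antisymm
    · exact fun y hy => Set.mem_iInter.2 fun n => Set.mem_iInter.1 hy (n + 1)
    · intro y hy
      refine Set.mem_iInter.2 fun n => ?_
      cases n with
      | zero => exact hK (Set.mem_iInter.1 hy 0)
      | succ n => exact Set.mem_iInter.1 hy n

theorem IsRealName.unique (φ : StrFun) (x y : ℝ) (hx : IsRealName φ x) (hy : IsRealName φ y) :
    x = y := by
  obtain ⟨J, hJ, h⟩ := hx
  obtain ⟨K, hK, h'⟩ := hy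
  obtain rfl : J = K := funext fun n => (hJ n).unique (hK n)
  exact h.unique h'

/-- The space of interval reals. The parameter of a name `φ` of `x` at `n` is the least `N` such
that the `N`-th interval has diameter at most `2 ^ (-n)`, plus `⌈log₂ (|x| + 1)⌉`. -/
noncomputable def intervalReals : PreparamSpace ℝ where
  rep := graphFun IsRealName
  rep_surj := fun x => by
    obtain ⟨D, hD, -, -⟩ := exists_intervalName .whole (Set.mem_univ x)
    choose w hw using fun n => exists_intervalCode (D n)
    refine ⟨fun a => w (a.length - 2), (mem_graphFun IsRealName.unique _ _).2 ⟨D, fun n => ?_, hD⟩⟩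
    simpa [natCode] using hw n
  param := fun φ n =>
    sInf {N : ℕ | ∃ J, IntervalCode (φ.1 (natCode N)) J ∧
        J.diam ≤ (((1 / 2 : ℝ) ^ n : ℝ) : EReal)} +
      ⌈Real.logb 2 (|(graphFun IsRealName).fn φ.1 φ.2| + 1)⌉₊
  param_mono := fun φ m n hmn => by
    obtain ⟨x, J, hJ, h⟩ := φ.2
    obtain ⟨N, hN⟩ := h.exists_diam_le n
    refine Nat.add_le_add_right (csInf_le_csInf (OrderBot.bddBelow _) (Set.nonempty_of_mem (x := N) ?_) ?_) _
    · exact ⟨J N, hJ N, hN⟩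
    rintro N ⟨K, hK, hd⟩
    refine ⟨K, hK, hd.trans (EReal.coe_le_coe_iff.2 ?_)⟩
    exact pow_le_pow_of_le_one (by norm_num) (by norm_num) hmn

/-! ### The preparametrised space of interval functions -/

/-- On codes, the string function `w` acts as the function `Ψ` on dyadic intervals. -/
def Tracks (w : StrFun) (Ψ : DyadicInterval → DyadicInterval) : Prop :=
  ∀ a J, IntervalCode a J → IntervalCode (w a) (Ψ J)

/-- A function on dyadic intervals that takes interval names of `x ∈ [0, 1]` to interval
names of `f x`. -/
def IsIntervalFun (Ψ : DyadicInterval → DyadicInterval) (f : C(unitInterval, ℝ)) : Prop :=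
  ∀ (J : ℕ → DyadicInterval) (x : unitInterval),
    IsIntervalName J x → IsIntervalName (fun n => Ψ (J n)) (f x)

/-- `w` is a name of the continuous function `f`. -/
def IsFunName (w : StrFun) (f : C(unitInterval, ℝ)) : Prop :=
  ∃ Ψ, Tracks w Ψ ∧ IsIntervalFun Ψ f

theorem Tracks.unique {w : StrFun} {Ψ Ψ' : DyadicInterval → DyadicInterval} (h : Tracks w Ψ)
    (h' : Tracks w Ψ') : Ψ = Ψ' := by
  funext J
  obtain ⟨a, ha⟩ := exists_intervalCode J
  exact (h a J ha).unique (h' a J ha)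

theorem IsFunName.unique (w : StrFun) (f g : C(unitInterval, ℝ)) (hf : IsFunName w f)
    (hg : IsFunName w g) : f = g := by
  obtain ⟨Ψ, h1, h2⟩ := hf
  obtain ⟨Ψ', h1', h2'⟩ := hg
  obtain rfl := h1.unique h1'
  ext x
  obtain ⟨D, hD, -, -⟩ := exists_intervalName .whole (Set.mem_univ (x : ℝ))
  exact (h2 D x hD).unique (h2' D x hD)

theorem exists_tracks (Ψ : DyadicInterval → DyadicInterval) : ∃ w, Tracks w Ψ := by
  classical
  choose code hcode using exists_intervalCode
  refine ⟨fun a => if h : ∃ J, IntervalCode a J then code (Ψ h.choose) else [], fun a J h => ?_⟩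
  have hex : ∃ J, IntervalCode a J := ⟨J, h⟩
  have : hex.choose = J := hex.choose_spec.unique h
  simp only [dif_pos hex, this]
  exact hcode _

theorem IsIntervalFun.mono {Ψ : DyadicInterval → DyadicInterval} {f : C(unitInterval, ℝ)}
    (h : IsIntervalFun Ψ f) {J K : DyadicInterval} (hJK : J.toSet ⊆ K.toSet)
    (hJ : (J.toSet ∩ Set.Icc 0 1).Nonempty) : (Ψ J).toSet ⊆ (Ψ K).toSet := by
  obtain ⟨x, hx, hx'⟩ := hJ
  obtain ⟨D, hD, hDJ, -⟩ := exists_intervalName J hx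
  have h1 := (hD.cons (hDJ 0)).cons (K := K) hJK
  exact (h _ ⟨x, hx'⟩ h1).1 0

/-- The second term of the parameter is a minimum over a non-empty set. -/
theorem IsIntervalFun.exists_modulus {Ψ : DyadicInterval → DyadicInterval}
    {f : C(unitInterval, ℝ)} (h : IsIntervalFun Ψ f) (n : ℕ) :
    ∃ N : ℕ, ∀ J : DyadicInterval, (J.toSet ∩ Set.Icc 0 1).Nonempty →
      J.diam ≤ (((1 / 2 : ℝ) ^ N : ℝ) : EReal) →
      (Ψ J).diam ≤ (((1 / 2 : ℝ) ^ n : ℝ) : EReal) := by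
  refine IsCompact.induction_on (p := fun s : Set ℝ => ∃ N : ℕ, ∀ J : DyadicInterval,
      (J.toSet ∩ (s ∩ Set.Icc 0 1)).Nonempty → J.diam ≤ (((1 / 2 : ℝ) ^ N : ℝ) : EReal) →
      (Ψ J).diam ≤ (((1 / 2 : ℝ) ^ n : ℝ) : EReal)) (isCompact_Icc (a := (0 : ℝ)) (b := 1))
    ?_ ?_ ?_ ?_ |>.imp fun N hN J hJ => hN J (by rwa [Set.inter_self])
  · exact ⟨0, fun J hJ => by simp at hJ⟩
  · rintro s t hst ⟨N, hN⟩
    exact ⟨N, fun J hJ => hN J (hJ.mono (by gcongr))⟩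
  · rintro s t ⟨N, hN⟩ ⟨N', hN'⟩
    refine ⟨max N N', fun J hJ hd => ?_⟩
    have hp : ∀ k ≤ max N N', J.diam ≤ (((1 / 2 : ℝ) ^ k : ℝ) : EReal) := fun k hk =>
      hd.trans (EReal.coe_le_coe_iff.2 (pow_le_pow_of_le_one (by norm_num) (by norm_num) hk))
    obtain ⟨y, hy, hs | ht, hI⟩ := hJ
    · exact hN J ⟨y, hy, hs, hI⟩ (hp _ (le_max_left _ _))
    · exact hN' J ⟨y, hy, ht, hI⟩ (hp _ (le_max_right _ _))
  · intro x hx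
    obtain ⟨D, hD, -, hDx⟩ := exists_intervalName .whole (Set.mem_univ x)
    obtain ⟨m, hm⟩ := (h D ⟨x, hx⟩ hD).exists_diam_le n
    have hp : (0 : ℝ) < (1 / 2) ^ (m + 1) := by positivity
    have hp2 : ((1 : ℝ) / 2) ^ m = 2 * (1 / 2) ^ (m + 1) := by rw [pow_succ]; ring
    refine ⟨Metric.ball x ((1 / 2) ^ (m + 1)),
      mem_nhdsWithin_of_mem_nhds (Metric.ball_mem_nhds x hp), m + 1, fun J hJ hd => ?_⟩
    refine (DyadicInterval.diam_mono (h.mono (K := D m) ?_ ?_)).trans hm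
    · obtain ⟨y, hy, hyx, -⟩ := hJ
      rw [Real.ball_eq_Ioo] at hyx
      intro z hz
      apply hDx m
      refine ⟨Set.mem_univ z, ?_⟩
      cases J with
      | whole => exact absurd hd (by simp [DyadicInterval.diam])
      | fin lo hi h1 h2 h3 =>
        have hd' : hi - lo ≤ (1 / 2) ^ (m + 1) := EReal.coe_le_coe_iff.1 hd
        have := hy.1
        have := hy.2
        have := hz.1
        have := hz.2
        have := hyx.1
        have := hyx.2
        constructor <;> linarith
    · obtain ⟨y, hy, -, hI⟩ := hJ
      exact ⟨y, hy, hI⟩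

open Classical in
/-- A function on dyadic intervals that represents `f`: the outward rounding of the image. -/
noncomputable def hullFun (f : C(unitInterval, ℝ)) : DyadicInterval → DyadicInterval
  | .whole => .whole
  | .fin lo hi _ _ _ =>
    let S := f '' {y | (y : ℝ) ∈ Set.Icc lo hi}
    let k := ⌊1 / (hi - lo)⌋₊
    if h : sInf S ≤ sSup S then
      .fin (gridLo k (sInf S)) (gridHi k (sSup S)) (isDyadic_gridLo _ _) (isDyadic_gridHi _ _)
        ((gridLo_le _ _).trans_lt (h.trans_lt (lt_gridHi _ _)))
    else .whole

theorem bdd_image (f : C(unitInterval, ℝ)) (T : Set unitInterval) :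
    BddBelow (f '' T) ∧ BddAbove (f '' T) := by
  have := (isCompact_range f.continuous)
  exact ⟨this.bddBelow.mono (Set.image_subset_range _ _),
    this.bddAbove.mono (Set.image_subset_range _ _)⟩

theorem isIntervalFun_hullFun (f : C(unitInterval, ℝ)) : IsIntervalFun (hullFun f) f := by
  intro J x hJ
  have hmem : ∀ {lo hi : ℝ}, (x : ℝ) ∈ Set.Icc lo hi →
      sInf (f '' {y | (y : ℝ) ∈ Set.Icc lo hi}) ≤ f x ∧
      f x ≤ sSup (f '' {y | (y : ℝ) ∈ Set.Icc lo hi}) := fun h =>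
    ⟨csInf_le (bdd_image f _).1 ⟨x, h, rfl⟩, le_csSup (bdd_image f _).2 ⟨x, h, rfl⟩⟩
  have hset : ∀ {lo hi : ℝ} {h1 h2 h3}, (x : ℝ) ∈ Set.Icc lo hi →
      (hullFun f (.fin lo hi h1 h2 h3)).toSet =
        Set.Icc (gridLo ⌊1 / (hi - lo)⌋₊ (sInf (f '' {y | (y : ℝ) ∈ Set.Icc lo hi})))
          (gridHi ⌊1 / (hi - lo)⌋₊ (sSup (f '' {y | (y : ℝ) ∈ Set.Icc lo hi}))) := by
    intro lo hi h1 h2 h3 h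
    have := (hmem h).1.trans (hmem h).2
    simp only [hullFun, dif_pos this, DyadicInterval.toSet]
  refine ⟨fun n => ?_, Set.eq_singleton_iff_unique_mem.2 ⟨Set.mem_iInter.2 fun n => ?_, ?_⟩⟩
  · have hsub := hJ.1 n
    have hx0 := hJ.mem n
    have hx1 := hJ.mem (n + 1)
    change (hullFun f (J (n + 1))).toSet ⊆ (hullFun f (J n)).toSet
    revert hsub hx0 hx1
    generalize J n = A
    generalize J (n + 1) = B
    intro hsub hx0 hx1
    cases A with
    | whole => exact Set.subset_univ _
    | fin lo hi h1 h2 h3 =>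
      obtain ⟨lo', hi', h1', h2', h3', rfl, h4, h5⟩ := DyadicInterval.exists_of_subset hsub
      rw [hset hx0, hset hx1]
      have hk : ⌊1 / (hi - lo)⌋₊ ≤ ⌊1 / (hi' - lo')⌋₊ :=
        Nat.floor_mono (one_div_le_one_div_of_le (by linarith) (by linarith))
      have hS : f '' {y | (y : ℝ) ∈ Set.Icc lo' hi'} ⊆ f '' {y | (y : ℝ) ∈ Set.Icc lo hi} :=
        Set.image_mono fun y hy => hsub hy
      have hne : (f '' {y | (y : ℝ) ∈ Set.Icc lo' hi'}).Nonempty := ⟨f x, x, hx1, rfl⟩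
      exact Set.Icc_subset_Icc
        (gridLo_mono hk (csInf_le_csInf (bdd_image f _).1 hne hS))
        (gridHi_anti hk (csSup_le_csSup (bdd_image f _).2 hne hS))
  · have hx0 := hJ.mem n
    change f x ∈ (hullFun f (J n)).toSet
    revert hx0
    generalize J n = A
    intro hx0
    cases A with
    | whole => exact Set.mem_univ _
    | fin lo hi h1 h2 h3 =>
      rw [hset hx0]
      exact ⟨(gridLo_le _ _).trans (hmem hx0).1, (hmem hx0).2.trans (lt_gridHi _ _).le⟩
  · intro z hz
    by_contra hne
    have hη : 0 < |z - f x| := abs_pos.2 (sub_ne_zero.2 hne)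
    set η := |z - f x| with hηdef
    obtain ⟨δ, hδ, hf⟩ := Metric.continuous_iff.1 f.continuous x (η / 2) (half_pos hη)
    obtain ⟨k, hk⟩ := exists_pow_lt_of_lt_one (half_pos hη) (by norm_num : (1 / 2 : ℝ) < 1)
    have hk1 : (0 : ℝ) < 1 / (2 * (k + 1)) := by positivity
    obtain ⟨n, hn⟩ := hJ.shrink (lt_min hδ hk1)
    have hzn : z ∈ (hullFun f (J n)).toSet := Set.mem_iInter.1 hz n
    have hx0 := hJ.mem n
    revert hzn hn hx0
    generalize J n = A
    intro hn hzn hx0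
    obtain ⟨lo, hi, h1, h2, h3, rfl, -, -⟩ :=
      DyadicInterval.exists_of_subset (hn.trans Set.Ioo_subset_Icc_self)
    rw [hset hx0] at hzn
    have hlo : lo ∈ Set.Icc lo hi := ⟨le_refl _, h3.le⟩
    have hhi : hi ∈ Set.Icc lo hi := ⟨h3.le, le_refl _⟩
    have hd : hi - lo ≤ 1 / (k + 1) := by
      have e1 := (hn hlo).1
      have e2 := (hn hhi).2
      have e3 := min_le_right δ (1 / (2 * ((k : ℝ) + 1)))
      have e4 : (1 : ℝ) / (k + 1) = 2 * (1 / (2 * (k + 1))) := by field_simp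
      linarith
    have hkK : k ≤ ⌊1 / (hi - lo)⌋₊ := by
      apply Nat.le_floor
      rw [le_div_iff₀ (by linarith)]
      have hk0 : (0 : ℝ) < k + 1 := by positivity
      rw [le_div_iff₀ hk0] at hd
      nlinarith
    have hpow : (1 / 2 : ℝ) ^ ⌊1 / (hi - lo)⌋₊ < η / 2 :=
      (pow_le_pow_of_le_one (by norm_num) (by norm_num) hkK).trans_lt hk
    have hfy : ∀ y : unitInterval, (y : ℝ) ∈ Set.Icc lo hi → |f y - f x| < η / 2 := by
      intro y hy
      have hy' := hn hy
      have e3 := min_le_left δ (1 / (2 * ((k : ℝ) + 1)))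
      refine hf y ?_
      rw [Subtype.dist_eq, Real.dist_eq, abs_lt]
      constructor <;> linarith [hy'.1, hy'.2]
    have hne' : (f '' {y | (y : ℝ) ∈ Set.Icc lo hi}).Nonempty := ⟨f x, x, hx0, rfl⟩
    have hm : f x - η / 2 ≤ sInf (f '' {y | (y : ℝ) ∈ Set.Icc lo hi}) := by
      refine le_csInf hne' ?_
      rintro _ ⟨y, hy, rfl⟩
      linarith [(abs_lt.1 (hfy y hy)).1]
    have hM : sSup (f '' {y | (y : ℝ) ∈ Set.Icc lo hi}) ≤ f x + η / 2 := by
      refine csSup_le hne' ?_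
      rintro _ ⟨y, hy, rfl⟩
      linarith [(abs_lt.1 (hfy y hy)).2]
    have e1 := lt_gridHi ⌊1 / (hi - lo)⌋₊ (sInf (f '' {y | (y : ℝ) ∈ Set.Icc lo hi}))
    rw [gridHi_eq] at e1
    have e2 := gridLo_le ⌊1 / (hi - lo)⌋₊ (sSup (f '' {y | (y : ℝ) ∈ Set.Icc lo hi}))
    have e3 := hzn.2
    rw [gridHi_eq] at e3
    have e4 := hzn.1
    have : |z - f x| < η := by
      rw [abs_lt]
      constructor <;> linarith
    exact lt_irrefl _ this

/-- The space of interval functions on `[0, 1]`. The parameter of a name of `f` at `n` is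
`⌈log₂ (‖f‖ + 1)⌉` plus the least `N` such that intervals of diameter at most `2 ^ (-N)` that meet
`[0, 1]` are taken to intervals of diameter at most `2 ^ (-n)`. -/
noncomputable def intervalFunctions : PreparamSpace C(unitInterval, ℝ) where
  rep := graphFun IsFunName
  rep_surj := fun f => by
    obtain ⟨w, hw⟩ := exists_tracks (hullFun f)
    exact ⟨w, (mem_graphFun IsFunName.unique _ _).2 ⟨_, hw, isIntervalFun_hullFun f⟩⟩
  param := fun w n =>
    ⌈Real.logb 2 (‖(graphFun IsFunName).fn w.1 w.2‖ + 1)⌉₊ +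
      sInf {N : ℕ | ∃ Ψ, Tracks w.1 Ψ ∧ ∀ J : DyadicInterval,
        (J.toSet ∩ Set.Icc 0 1).Nonempty → J.diam ≤ (((1 / 2 : ℝ) ^ N : ℝ) : EReal) →
          (Ψ J).diam ≤ (((1 / 2 : ℝ) ^ n : ℝ) : EReal)}
  param_mono := fun w m n hmn => by
    obtain ⟨f, Ψ, hw, h⟩ := w.2
    obtain ⟨N, hN⟩ := h.exists_modulus n
    refine Nat.add_le_add_left (csInf_le_csInf (OrderBot.bddBelow _) (Set.nonempty_of_mem (x := N) ?_) ?_) _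
    · exact ⟨Ψ, hw, hN⟩
    rintro N ⟨Ψ', hΨ', hd⟩
    refine ⟨Ψ', hΨ', fun J h1 h2 => (hd J h1 h2).trans (EReal.coe_le_coe_iff.2 ?_)⟩
    exact pow_le_pow_of_le_one (by norm_num) (by norm_num) hmn

end IntervalComplexity

namespace IntervalComplexity

/-! ### Binary expansions -/

/-! A parameter controls rates of convergence and the logarithms of absolute values, but not the
length of the codes that a name returns. So the machine can neither read whole answers nor pass them
on as queries. The remedy is rounding. If an interval has radius less than `2 ^ (-(j + 3))`, its
center is cut after `j + 3` fractional bits, a one is appended, and the radius is replaced by `2 ^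
(-j)`. Every point of the old interval is then within `3 / 16 * 2 ^ (-j)` of the new center
(`roundOf_eq_some`). The radius can be tested in `O(j)` steps because the pairing interleaves the
symbols of center and radius. If the test succeeds, the center is within distance 1 of the
represented point, which bounds the length of its integer part (`length_le_of_abs_dyadicVal_le`). So
the rounding is cheap as well (`reach_round`).

The machine keeps a precision `p` for the argument and a precision `q` for the value, both initially
1, and runs one iteration for each symbol of the input. Iteration `N` asks for the `N`-th interval
of the argument. If it cannot be rounded to precision `p`, nothing happens. Otherwise `p` grows by
one and the rounded interval is given to the name of the function. If the answer can be rounded to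
precision `q`, the rounding becomes the output and `q` grows by one. This recursion is `stage`; by
`reach_iteration` the machine follows it with `O(N + B)` steps in iteration `N`, where `2 ^ B`
bounds `|x| + 1` and `|f x| + 1`. Since `B` can be the parameter at 0, the running time is a
second-order polynomial (`time_le`).

The output is a name of `f x`: radii halve from one output to the next, and the centers are so close
to `f x` that the intervals are nested (`exists_outputs`). The rate of convergence is the
quantitative core (`le_valPrec`). Let intervals of diameter at most `2 ^ (-K)` around `x` be taken
to intervals of diameter at most `2 ^ (-(n + 5))`. As soon as `p > K`, every rounding of the
argument is followed by a rounding of the value, as long as `q ≤ n + 2`; so `p - q ≤ K` until `q`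
exceeds `n + 2`. Once the argument intervals have diameter at most `2 ^ (-(K + n + 5))`, from index
`N₀` on, `p` grows in every iteration while `p ≤ K + n + 2`. Hence `q ≥ n + 2` after `N₀ + K + n +
1` iterations. With the parameter `l` one has `K ≤ l (n + 5)` and `N₀ ≤ l (K + n + 5)`, so
monotonicity of `l` yields a second-order polynomial bound. -/

theorem binVal_append_list (l l' : List Bool) :
    binVal (l ++ l') = binVal l * 2 ^ l'.length + binVal l' := by
  induction l' using List.reverseRecOn with
  | nil => simp [binVal]
  | append_singleton l' b ih =>
    rw [← List.append_assoc, binVal_append, ih, binVal_append, List.length_append,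
      List.length_singleton, pow_succ]
    ring

theorem binVal_lt (l : List Bool) : binVal l < 2 ^ l.length := by
  induction l using List.reverseRecOn with
  | nil => simp [binVal]
  | append_singleton l b ih =>
    rw [binVal_append, List.length_append, List.length_singleton, pow_succ]
    have := Bool.toNat_le b
    omega

/-- The number in `[0, 1)` with the given binary expansion. -/
noncomputable def fracVal (l : List Bool) : ℝ := binVal l / 2 ^ l.length

theorem fracVal_nonneg (l : List Bool) : 0 ≤ fracVal l := by
  unfold fracVal; positivity

theorem fracVal_lt_one (l : List Bool) : fracVal l < 1 := by
  rw [fracVal, div_lt_one (by positivity)]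
  exact_mod_cast binVal_lt l

theorem fracVal_append (l l' : List Bool) :
    fracVal (l ++ l') = fracVal l + fracVal l' / 2 ^ l.length := by
  rw [fracVal, fracVal, fracVal, binVal_append_list, List.length_append, pow_add]
  push_cast
  field_simp

theorem fracVal_replicate (n : ℕ) : fracVal (List.replicate n false) = 0 := by
  have : binVal (List.replicate n false) = 0 := by
    induction n with
    | zero => rfl
    | succ n ih => rw [List.replicate_succ', binVal_append, ih]; rfl
  simp [fracVal, this]

theorem fracVal_singleton_true : fracVal [true] = 1 / 2 := by
  norm_num [fracVal, binVal]

/-- The first `p` bits, after padding with zeros, followed by a one. -/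
def truncBits (p : ℕ) (l : List Bool) : List Bool :=
  (l ++ List.replicate p false).take p ++ [true]

theorem length_truncBits (p : ℕ) (l : List Bool) : (truncBits p l).length = p + 1 := by
  simp [truncBits]

/-- The dropped tail contributes between 0 and `2 ^ (-p)`, and the appended one stands for the
midpoint of this range. It also keeps the expansion free of trailing zeros, so no lookahead is
needed to form a legal code. -/
theorem abs_fracVal_sub_truncBits (p : ℕ) (l : List Bool) :
    |fracVal l - fracVal (truncBits p l)| ≤ 1 / 2 ^ (p + 1) := by
  have h1 : fracVal l = fracVal (l ++ List.replicate p false) := by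
    rw [fracVal_append, fracVal_replicate]; simp
  have h2 := fracVal_append ((l ++ List.replicate p false).take p)
    ((l ++ List.replicate p false).drop p)
  have h3 : ((l ++ List.replicate p false).take p).length = p := by simp
  rw [List.take_append_drop, h3] at h2
  rw [truncBits, fracVal_append, h1, h2, h3, fracVal_singleton_true]
  have h4 := fracVal_nonneg ((l ++ List.replicate p false).drop p)
  have h5 := fracVal_lt_one ((l ++ List.replicate p false).drop p)
  rw [add_sub_add_left_eq_sub, ← sub_div, abs_div, abs_of_pos (show (0 : ℝ) < 2 ^ p by positivity),
    pow_succ, mul_comm ((2 : ℝ) ^ p) 2, ← div_div]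
  gcongr
  rw [abs_le]
  constructor <;> linarith

theorem fracVal_lt_of_forall {p : ℕ} {l : List Bool} (h : ∀ i < p, l[i]? ≠ some true) :
    fracVal l < 1 / 2 ^ p := by
  have h1 : fracVal l = fracVal (l ++ List.replicate p false) := by
    rw [fracVal_append, fracVal_replicate]; simp
  have h2 : (l ++ List.replicate p false).take p = List.replicate p false := by
    refine List.ext_getElem (by simp) fun i hi hi' => ?_
    have hip : i < p := by simpa using hi'
    rw [List.getElem_take, List.getElem_replicate, List.getElem_append]
    split_ifs with hl
    · have := h i hip
      rw [List.getElem?_eq_getElem hl] at this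
      simpa using this
    · simp
  rw [h1, ← List.take_append_drop p (l ++ List.replicate p false), fracVal_append, h2,
    fracVal_replicate, zero_add, List.length_replicate]
  gcongr
  exact fracVal_lt_one _

theorem le_fracVal_of_getElem {i : ℕ} {l : List Bool} (h : l[i]? = some true) :
    1 / 2 ^ (i + 1) ≤ fracVal l := by
  obtain ⟨hi, h⟩ := List.getElem?_eq_some_iff.1 h
  have h2 := fracVal_append (l.take i) (l.drop i)
  rw [List.take_append_drop, List.drop_eq_getElem_cons hi, h, ← List.singleton_append,
    fracVal_append [true], List.length_take, min_eq_left hi.le, fracVal_singleton_true] at h2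
  rw [h2]
  have h3 := fracVal_nonneg (l.take i)
  have h4 := fracVal_nonneg (l.drop (i + 1))
  have : (1 : ℝ) / 2 ^ (i + 1) = 1 / 2 / 2 ^ i := by rw [pow_succ]; field_simp
  rw [this]
  refine le_add_of_nonneg_of_le h3 ?_
  gcongr
  have : 0 ≤ fracVal (l.drop (i + 1)) / 2 ^ [true].length := by positivity
  linarith

/-! ### Rounded intervals -/

/-- The string of a number with the given integer code and fractional bits. -/
def dyadicStr (a b : List Bool) : Str := a.map Sym.ofBit ++ Sym.sep :: b.map Sym.ofBit

/-- The number denoted by `dyadicStr a b`. -/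
noncomputable def dyadicVal (a b : List Bool) : ℝ := signVal a * (binVal a.tail + fracVal b)

theorem abs_signVal (a : List Bool) : |(signVal a : ℝ)| = 1 := by
  rcases a with _ | ⟨_ | _, _⟩ <;> simp [signVal]

theorem isDyadicCode_dyadicStr {a b : List Bool} (ha : IsIntCode a)
    (hb : b.getLast? ≠ some false) : IsDyadicCode (dyadicStr a b) (dyadicVal a b) :=
  ⟨a, b, ha, hb, rfl, rfl⟩

/-- The code of `2 ^ (-j)`, for positive `j`. -/
def radBits (j : ℕ) : List Bool := List.replicate (j - 1) false ++ [true]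

theorem isDyadicCode_radBits {j : ℕ} (hj : 1 ≤ j) :
    IsDyadicCode (dyadicStr [] (radBits j)) (1 / 2 ^ j) := by
  convert isDyadicCode_dyadicStr (a := []) (b := radBits j) (Or.inl (by simp)) (by simp [radBits])
  obtain ⟨j, rfl⟩ := Nat.exists_eq_add_of_le' hj
  rw [dyadicVal, radBits, fracVal_append, fracVal_replicate, fracVal_singleton_true]
  simp [signVal, binVal, pow_succ]
  ring

/-- The rounding of an interval with center `dyadicStr a b` to radius `2 ^ (-j)`. -/
def roundPair (j : ℕ) (a b : List Bool) : Str :=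
  strPair (dyadicStr a (truncBits (j + 3) b)) (dyadicStr [] (radBits j))

theorem abs_dyadicVal_sub_truncBits (p : ℕ) (a b : List Bool) :
    |dyadicVal a b - dyadicVal a (truncBits p b)| ≤ 1 / 2 ^ (p + 1) := by
  rw [dyadicVal, dyadicVal, ← mul_sub, add_sub_add_left_eq_sub, abs_mul, abs_signVal, one_mul]
  exact abs_fracVal_sub_truncBits p b

theorem isDyadic_dyadicVal (a b : List Bool) : IsDyadic (dyadicVal a b) := by
  refine ⟨signVal a * (binVal a.tail * 2 ^ b.length + binVal b), b.length, ?_⟩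
  rw [dyadicVal, fracVal]
  push_cast
  field_simp

theorem isDyadic_one_div_pow (j : ℕ) : IsDyadic (1 / 2 ^ j) := ⟨1, j, by simp⟩

/-- The interval with the given center and radius `2 ^ (-j)`. -/
noncomputable def ballInterval (j : ℕ) (c : ℝ) (hc : IsDyadic c) : DyadicInterval :=
  .fin (c - 1 / 2 ^ j) (c + 1 / 2 ^ j) (hc.sub (isDyadic_one_div_pow j))
    (hc.add (isDyadic_one_div_pow j)) (by
      have : (0 : ℝ) < 1 / 2 ^ j := by positivity
      linarith)

theorem ballInterval_toSet (j : ℕ) (c : ℝ) (hc : IsDyadic c) :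
    (ballInterval j c hc).toSet = Set.Icc (c - 1 / 2 ^ j) (c + 1 / 2 ^ j) := rfl

theorem ballInterval_diam (j : ℕ) (c : ℝ) (hc : IsDyadic c) :
    (ballInterval j c hc).diam = ((2 * (1 / 2) ^ j : ℝ) : EReal) := by
  rw [ballInterval, DyadicInterval.diam]
  congr 1
  rw [one_div_pow]
  ring

/-- Both fractional expansions end with a one, as the codes demand. The case `j = 0` is excluded
because the radius 1 would have an integer part. -/
theorem intervalCode_roundPair {j : ℕ} (hj : 1 ≤ j) {a : List Bool} (ha : IsIntCode a)
    (b : List Bool) : IntervalCode (roundPair j a b)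
      (ballInterval j (dyadicVal a (truncBits (j + 3) b)) (isDyadic_dyadicVal _ _)) := by
  refine ⟨_, _, ?_, ?_, rfl⟩
  · convert isDyadicCode_dyadicStr ha (b := truncBits (j + 3) b) (by simp [truncBits]) using 1
    ring
  · convert isDyadicCode_radBits hj using 1
    ring

/-! ### The size of a dyadic number as seen from its code -/

/-- The radius in a code of a positive number below `2 ^ (-p)` has no integer part and starts with
`p` zeros. -/
inductive IsSmall (p : ℕ) : List Bool → List Bool → Prop
  | nil {b} : (∀ i < p, b[i]? ≠ some true) → IsSmall p [] b
  | single {b} : (∀ i < p, b[i]? ≠ some true) → IsSmall p [false] b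

theorem IsSmall.frac {p : ℕ} {a b : List Bool} (h : IsSmall p a b) :
    ∀ i < p, b[i]? ≠ some true := by
  cases h <;> assumption

theorem IsSmall.dyadicVal_lt {p : ℕ} {a b : List Bool} (h : IsSmall p a b) :
    dyadicVal a b < 1 / 2 ^ p := by
  have h1 := fracVal_lt_of_forall h.frac
  cases h <;> simpa [dyadicVal, signVal, binVal] using h1

theorem IsIntCode.eq_cons_cons {a : List Bool} (ha : IsIntCode a) (hl : 2 ≤ a.length) :
    ∃ s t, a = s :: true :: t := by
  rcases a with _ | ⟨s, _ | ⟨c, t⟩⟩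
  · simp at hl
  · simp at hl
  · rcases ha with h | h
    · simp at h
    · exact ⟨s, t, by simpa using h⟩

theorem pow_le_binVal (t : List Bool) : 2 ^ t.length ≤ binVal (true :: t) := by
  rw [← List.singleton_append, binVal_append_list]
  simp [binVal]

theorem pow_le_abs_dyadicVal {s : Bool} (t b : List Bool) :
    2 ^ t.length ≤ |dyadicVal (s :: true :: t) b| := by
  rw [dyadicVal, abs_mul, abs_signVal, one_mul, List.tail_cons]
  refine le_trans ?_ (le_abs_self _)
  have h1 : ((2 ^ t.length : ℕ) : ℝ) ≤ binVal (true :: t) := by exact_mod_cast pow_le_binVal t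
  push_cast at h1
  linarith [fracVal_nonneg b]

/-- Together with `IsSmall.dyadicVal_lt` this turns the comparison of the radius with a power of two
into a test of `p` bits. A code with a nonzero integer part denotes a number of absolute value at
least 1. -/
theorem isSmall_of_lt {p : ℕ} {a b : List Bool} (ha : IsIntCode a) (h0 : 0 < dyadicVal a b)
    (h : dyadicVal a b < 1 / 2 ^ p) : IsSmall p a b := by
  have key : fracVal b < 1 / 2 ^ p → ∀ i < p, b[i]? ≠ some true := by
    intro h i hi hb
    have h1 := le_fracVal_of_getElem hb
    have h2 : (1 : ℝ) / 2 ^ p ≤ 1 / 2 ^ (i + 1) :=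
      one_div_le_one_div_of_le (by positivity) (pow_le_pow_right₀ (by norm_num) hi)
    linarith
  rcases a with _ | ⟨s, _ | ⟨c, t⟩⟩
  · exact .nil (key (by simpa [dyadicVal, signVal, binVal] using h))
  · cases s
    · exact .single (key (by simpa [dyadicVal, signVal, binVal] using h))
    -- A lone minus sign gives a value that is not positive.
    · have := fracVal_nonneg b
      simp [dyadicVal, signVal, binVal] at h0
      linarith
  · obtain ⟨s', t', h'⟩ := ha.eq_cons_cons (by simp)
    have h4 := abs_of_pos h0
    rw [h'] at h h4
    have h1 := pow_le_abs_dyadicVal (s := s') t' b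
    have h2 : (1 : ℝ) ≤ 2 ^ t'.length := one_le_pow₀ (by norm_num)
    have h3 : (1 : ℝ) / 2 ^ p ≤ 1 := by
      rw [div_le_one (by positivity)]
      exact one_le_pow₀ (by norm_num)
    linarith

/-- There are no leading zeros, so every bit after the sign and the leading one doubles the lower
bound for the absolute value. This limits the part of a center that has to be copied in full. -/
theorem length_le_of_abs_dyadicVal_le {a b : List Bool} {B : ℕ} (ha : IsIntCode a)
    (h : |dyadicVal a b| ≤ 2 ^ B) : a.length ≤ B + 2 := by
  by_cases hl : 2 ≤ a.length
  · obtain ⟨s, t, rfl⟩ := ha.eq_cons_cons hl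
    have h1 := (pow_le_abs_dyadicVal (s := s) t b).trans h
    have h2 : t.length ≤ B := (pow_le_pow_iff_right₀ (by norm_num : (1 : ℝ) < 2)).1 h1
    simp only [List.length_cons]
    omega
  · omega

/-- A finite interval has a pair of dyadic codes as its code. -/
theorem IntervalCode.exists_dyadicStr {w : Str} {lo hi : ℝ} {h1 h2 h3}
    (h : IntervalCode w (.fin lo hi h1 h2 h3)) :
    ∃ a b c d : List Bool, IsIntCode a ∧ IsIntCode c ∧ b.getLast? ≠ some false ∧
      d.getLast? ≠ some false ∧ w = strPair (dyadicStr a b) (dyadicStr c d) ∧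
      dyadicVal a b = (lo + hi) / 2 ∧ dyadicVal c d = (hi - lo) / 2 := by
  obtain ⟨_, _, ⟨a, b, ha, hb, rfl, h1⟩, ⟨c, d, hc, hd, rfl, h2⟩, rfl⟩ := h
  exact ⟨a, b, c, d, ha, hc, hb, hd, rfl, h1.symm, h2.symm⟩

/-! ### The layout of a pair -/

theorem getElem?_interleave : ∀ {c a b : Str}, a.length = c.length → b.length = c.length →
    ∀ i, (interleave c a b)[3 * i + 1]? = a[i]? ∧ (interleave c a b)[3 * i + 2]? = b[i]?
  | [], a, b, h1, h2, i => by
    rw [List.length_eq_zero_iff.1 h1, List.length_eq_zero_iff.1 h2]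
    simp [interleave]
  | c :: cs, [], _, h, _, _ => by simp at h
  | c :: cs, _ :: _, [], _, h, _ => by simp at h
  | c :: cs, a :: as, b :: bs, h1, h2, i => by
    have ih := getElem?_interleave (c := cs) (a := as) (b := bs) (by simpa using h1)
      (by simpa using h2)
    cases i with
    | zero => simp [interleave]
    | succ i =>
      have := ih i
      simp only [interleave, List.getElem?_cons_succ,
        show 3 * (i + 1) + 1 = 3 * i + 1 + 3 from by ring,
        show 3 * (i + 1) + 2 = 3 * i + 2 + 3 from by ring]
      exact this

/-- The channel value `o` is the `i`-th symbol of `u`, which may be padded with zeros. -/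
def PadGet (u : Str) (i : ℕ) (o : Option Sym) : Prop :=
  (∀ s, u[i]? = some s → o = some s) ∧ (u.length ≤ i → o = some .zero ∨ o = none)

theorem padGet_padTo (L : ℕ) (u : Str) (i : ℕ) : PadGet u i (padTo L u)[i]? := by
  constructor
  · intro s h
    obtain ⟨hi, h⟩ := List.getElem?_eq_some_iff.1 h
    rw [padTo, List.getElem?_append_left hi, List.getElem?_eq_getElem hi, h]
  · intro h
    rw [padTo, List.getElem?_append_right h, List.getElem?_replicate]
    split_ifs <;> simp

/-- The positions do not depend on the lengths of the components. Past the end of a component there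
is padding or a blank, and which of the two depends on the other component; the machine therefore
treats both alike. -/
theorem padGet_strPair (a b : Str) (i : ℕ) :
    PadGet a i (strPair a b)[3 * i + 1]? ∧ PadGet b i (strPair a b)[3 * i + 2]? := by
  have h := getElem?_interleave
    (c := padTo (max (max a.length b.length) (pairControl a b).length) (pairControl a b))
    (a := padTo (max (max a.length b.length) (pairControl a b).length) a)
    (b := padTo (max (max a.length b.length) (pairControl a b).length) b)
    (by rw [length_padTo (by simp), length_padTo (by simp)])
    (by rw [length_padTo (by simp), length_padTo (by simp)]) i
  rw [strPair, h.1, h.2]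
  exact ⟨padGet_padTo _ _ _, padGet_padTo _ _ _⟩

/-! ### The layout of a rounded interval -/

/-- Auxiliary tape symbols, which encode the control symbol of a pair together with the symbol of
its second component. -/
inductive Mark where
  | first
  | mid
  | last
  | gap
  deriving DecidableEq

instance : Fintype Mark :=
  ⟨{.first, .mid, .last, .gap}, fun m => by cases m <;> simp⟩

/-- The control symbol. -/
def Mark.ctl : Mark → Sym
  | .gap => .zero
  | _ => .one

/-- The symbol of the radius. -/
def Mark.rad : Mark → Sym
  | .first => .sep
  | .last => .one
  | _ => .zero

/-- The `i`-th mark for the radius `2 ^ (-j)`. -/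
def markAt (j i : ℕ) : Option Mark :=
  if i = 0 then some .first
  else if i < j then some .mid
  else if i = j then some .last
  else if i = j + 1 then some .gap
  else if i = j + 2 then some .mid
  else none

/-- The control symbol at position `i`. -/
def ctlAt (j i : ℕ) : Sym := ((markAt j i).map Mark.ctl).getD .zero

/-- The symbol of the radius at position `i`. -/
def radAt (j i : ℕ) : Sym := ((markAt j i).map Mark.rad).getD .zero

/-- The symbols of `l`, interleaved with the marks from position `i` on. -/
def markStr (j : ℕ) : ℕ → Str → Str
  | _, [] => []
  | i, s :: l => ctlAt j i :: s :: radAt j i :: markStr j (i + 1) l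

theorem length_markStr (j i : ℕ) (l : Str) : (markStr j i l).length = 3 * l.length := by
  induction l generalizing i with
  | nil => rfl
  | cons s l ih =>
    simp only [markStr, List.length_cons, ih]
    ring

theorem markStr_append (j i : ℕ) (l l' : Str) :
    markStr j i (l ++ l') = markStr j i l ++ markStr j (i + l.length) l' := by
  induction l generalizing i with
  | nil => simp [markStr]
  | cons s l ih =>
    simp only [markStr, List.cons_append, ih, List.length_cons]
    rw [show i + 1 + l.length = i + (l.length + 1) from by ring]

theorem markStr_eq_interleave (j i : ℕ) (l : Str) :
    markStr j i l = interleave ((List.range l.length).map fun t => ctlAt j (i + t)) l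
      ((List.range l.length).map fun t => radAt j (i + t)) := by
  induction l generalizing i with
  | nil => rfl
  | cons s l ih =>
    rw [markStr, ih, List.length_cons, List.range_succ_eq_map]
    simp only [List.map_cons, List.map_map, interleave, add_zero]
    congr 5 <;> · funext t; simp only [Function.comp]; congr 1; omega

theorem length_dyadicStr (a b : List Bool) : (dyadicStr a b).length = a.length + 1 + b.length := by
  simp [dyadicStr]
  ring

/-- The code of the center is longer than that of the radius, which has length `j + 1`. So the
control string consists of `j + 1` ones, a zero and a one, independently of the center, and the pair
can be written from left to right without knowing its length in advance. -/
theorem roundPair_eq_markStr {j : ℕ} (hj : 1 ≤ j) (a b : List Bool) :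
    roundPair j a b = markStr j 0 (dyadicStr a (truncBits (j + 3) b)) := by
  have hR : dyadicStr [] (radBits j) = Sym.sep :: (List.replicate (j - 1) .zero ++ [.one]) := by
    simp [dyadicStr, radBits, Sym.ofBit]
  have hRl : (dyadicStr [] (radBits j)).length = j + 1 := by
    rw [hR]; simp; omega
  have hAl : (dyadicStr a (truncBits (j + 3) b)).length = a.length + j + 5 := by
    rw [length_dyadicStr, length_truncBits]; ring
  rw [roundPair, markStr_eq_interleave]
  generalize dyadicStr a (truncBits (j + 3) b) = A at hAl
  generalize dyadicStr [] (radBits j) = B at hR hRl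
  have hC : pairControl A B = List.replicate (j + 1) .one ++ [.zero, .one] := by
    rw [pairControl, hRl, hAl, min_eq_right (by omega), decide_eq_true (by omega)]
    rfl
  -- The control string has length `j + 3` only, so the center determines the common length and is
  -- not padded itself.
  have hL : max (max A.length B.length) (pairControl A B).length = A.length := by
    rw [hC, hRl, hAl]; simp; omega
  simp only [strPair, hL]
  rw [hC, hR]
  congr 1
  · refine List.ext_getElem (by simp [padTo, hAl]; omega) fun i h1 h2 => ?_
    simp only [padTo, List.getElem_append, List.getElem_map, List.getElem_range, zero_add,
      List.length_append, List.length_replicate, List.getElem_replicate, List.length_cons,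
      List.length_nil, ctlAt, markAt]
    by_cases c1 : i < j + 1
    · rw [dif_pos (by omega), dif_pos c1]
      split_ifs <;> first | rfl | omega
    · by_cases c2 : i < j + 3
      · rw [dif_pos (by omega), dif_neg c1]
        obtain rfl | rfl : i = j + 1 ∨ i = j + 2 := by omega
        · simp [show ¬ j + 1 < j by omega, Mark.ctl]
        · simp [show ¬ j + 2 < j by omega, Mark.ctl, show j + 2 - (j + 1) = 1 by omega]
      · rw [dif_neg (by omega), if_neg (by omega), if_neg (by omega), if_neg (by omega),
          if_neg (by omega), if_neg (by omega)]
        rfl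
  · simp [padTo]
  · refine List.ext_getElem (by simp [padTo, hAl]; omega) fun i h1 h2 => ?_
    simp only [padTo, List.getElem_append, List.getElem_map, List.getElem_range, zero_add,
      List.length_append, List.length_replicate, List.getElem_replicate, List.length_cons,
      List.length_nil, radAt, markAt, List.getElem_cons]
    split_ifs <;> first | rfl | omega

open OracleMachine

/-! ### The evaluation machine -/

instance : DecidableEq Sym := fun a b => by
  cases a <;> cases b <;> first | exact isTrue rfl | exact isFalse (by simp)

/-- The tapes of the evaluation machine by their purpose. The Boolean argument is `true` for the
tapes used to round the real argument and `false` for those used to round the function value. -/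
inductive Reg where
  | inp
  | ans
  | clk
  | num
  | dst (m : Bool)
  | emi (m : Bool)
  | cnt (m : Bool)
  deriving DecidableEq

/-- The purpose of a tape. -/
def Reg.ofTape : TapeName 6 → Reg
  | .input => .inp
  | .output => .dst false
  | .query => .dst true
  | .answer => .ans
  | .work i => ![.clk, .num, .emi true, .emi false, .cnt true, .cnt false] i

/-- The tape with a given purpose. -/
def Reg.tape : Reg → TapeName 6
  | .inp => .input
  | .ans => .answer
  | .clk => .work 0
  | .num => .work 1
  | .dst true => .query
  | .dst false => .output
  | .emi true => .work 2
  | .emi false => .work 3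
  | .cnt true => .work 4
  | .cnt false => .work 5

theorem Reg.ofTape_tape (r : Reg) : Reg.ofTape r.tape = r := by
  rcases r with _ | _ | _ | _ | _ | _ | _ <;> first | rfl | (rename_i m; cases m <;> rfl)

/-- The contents of a cell of the evaluation machine. -/
abbrev MCell := Option (Sym ⊕ Mark)

/-- What happens after all heads have returned to the first cell. -/
inductive Ret where
  | loop
  | call
  | emit (m : Bool)
  | grow (m : Bool)
  deriving DecidableEq, Fintype

/-- The part of the center of an interval to which a symbol belongs. -/
inductive Phase where
  | int
  | sep
  | frac
  | last
  deriving DecidableEq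

instance : Fintype Phase :=
  ⟨{.int, .sep, .frac, .last}, fun m => by cases m <;> simp⟩

/-- The states of the evaluation machine. -/
inductive Label where
  | start (k : Fin 4)
  | rewind (r : Ret)
  | loop
  | copy
  | ask
  | scanCtl (m f : Bool)
  | scanNum (m f : Bool)
  | scanRad (m f : Bool)
  | emitStart (m : Bool)
  | emitCtl (m f : Bool)
  | emitNum (m f : Bool)
  | emitRad (m : Bool) (p : Phase)
  | emitEnd (m : Bool)
  | grow (m : Bool) (k : Fin 4)
  | halt
  deriving DecidableEq, Fintype

/-- The state after a rewinding. -/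
def Ret.label : Ret → Label
  | .loop => .loop
  | .call => .ask
  | .emit m => .emitStart m
  | .grow m => .grow m 0

/-- The state after the last symbol of a triple. -/
def Phase.label (m : Bool) : Phase → Label
  | .int => .emitCtl m false
  | .sep => .emitCtl m true
  | .frac => .emitCtl m true
  | .last => .emitEnd m

/-- The symbol of the center that is written, depending on the symbol that is read and on the
current cell of the counter. -/
def centerSym : Bool → MCell → MCell → Phase × MCell
  | false, some (.inl .sep), _ => (.sep, some (.inl .sep))
  | false, x, _ => (.int, x)
  -- The counter is used up after `j + 3` fractional bits; the center is then closed by a one.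
  | true, _, none => (.last, some (.inl .one))
  -- Behind the end of the answer, blanks stand for zero bits.
  | true, x, _ => (.frac, some (x.getD (.inl .zero)))

/-- The control symbol that belongs to a mark. -/
def ctlOf : MCell → MCell
  | some (.inr x) => some (.inl x.ctl)
  | _ => some (.inl .zero)

/-- The radius symbol that belongs to a mark. -/
def radOf : MCell → MCell
  | some (.inr x) => some (.inl x.rad)
  | _ => some (.inl .zero)

/-- No tape is written. -/
def noWrite : Reg → Option MCell := fun _ => none

/-- All tapes in a list receive the same cell. -/
def write (l : List Reg) (x : MCell) : Reg → Option MCell := fun r => if r ∈ l then some x else none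

/-- The heads of the tapes in a list move right. -/
def adv (l : List Reg) : Reg → Move := fun r => if r ∈ l then .right else .stay

/-- The marks written when a precision is increased. -/
def growMark : Fin 4 → Mark := ![.mid, .last, .gap, .mid]

/-- The marks written at the start. -/
def startMark : Fin 4 → Mark := ![.first, .last, .gap, .mid]

/-- The transition table. -/
def table : Label → (Reg → MCell) → Label × (Reg → Option MCell) × (Reg → Move)
  | .start k, _ =>
    (if k = 3 then .rewind .loop else .start (k + 1),
      fun r => match r with
        | .clk => if k = 0 then some (some (.inr .first)) else none
        | .num => if k = 3 then none else some (some (.inl (if k = 1 then .zero else .one)))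
        | .emi _ => some (some (.inr (startMark k)))
        | .cnt _ => some (some (.inr (startMark k)))
        | _ => none,
      adv [.clk, .num, .emi true, .emi false, .cnt true, .cnt false])
  | .rewind r, v =>
    -- The clock head moves along whenever another head other than the input head moves right, so it
    -- is never behind these. Heads that arrive earlier stay on their first cell.
    if v .clk = none then
      (.rewind r, noWrite, fun r => if r = .inp then .stay else .left)
    else (r.label, noWrite, adv [])
  | .loop, v =>
    if v .inp = none then (.halt, noWrite, adv []) else (.copy, noWrite, adv [.inp])
  | .copy, v =>
    match v .num with
    -- The appended zero turns the code of `2 ^ N` into that of `2 ^ (N + 1)`; the blank cuts the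
    -- query off from the remains of earlier ones.
    | none => (.rewind .call, fun r => match r with
        | .num => some (some (.inl .zero))
        | .dst true => some none
        | _ => none, adv [])
    | some x => (.copy, write [.dst true] (some x), adv [.num, .dst true, .clk])
  | .ask, v =>
    -- The first symbol of the query tells which component of the pair was asked, hence what the
    -- answer is used for.
    (.scanCtl (decide (v (.dst true) = some (.inl .one))) false, noWrite, adv [])
  | .scanCtl m f, v =>
    if f = true ∧ v (.cnt m) = none then (.rewind (.emit m), noWrite, adv [])
    else (.scanNum m f, noWrite, adv [.ans, .clk])
  | .scanNum m f, _ => (.scanRad m f, noWrite, adv [.ans, .clk])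
  | .scanRad m false, v =>
    match v .ans with
    | some (.inl .sep) => (.scanCtl m true, noWrite, adv [.ans, .clk])
    | some (.inl .zero) => (.scanCtl m false, noWrite, adv [.ans, .clk])
    -- A one before the separator means a nonzero integer part (or a minus sign); a blank means the
    -- infinite interval.
    | _ => (.rewind .loop, noWrite, adv [])
  | .scanRad m true, v =>
    match v .ans with
    | some (.inl .zero) => (.scanCtl m true, noWrite, adv [.ans, .clk, .cnt m])
    | none => (.scanCtl m true, noWrite, adv [.ans, .clk, .cnt m])
    | _ => (.rewind .loop, noWrite, adv [])
  | .emitStart true, _ =>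
    -- The leading zero addresses the name of the function. The output tape needs no such prefix.
    (.emitCtl true false, write [.dst true] (some (.inl .zero)), adv [.dst true, .clk])
  | .emitStart false, _ => (.emitCtl false false, noWrite, adv [])
  | .emitCtl m f, v =>
    (.emitNum m f, write [.dst m] (ctlOf (v (.emi m))), adv [.dst m, .ans, .clk])
  | .emitNum m f, v =>
    (.emitRad m (centerSym f (v .ans) (v (.cnt m))).1,
      write [.dst m] (centerSym f (v .ans) (v (.cnt m))).2, adv [.dst m, .ans, .clk])
  | .emitRad m p, v =>
    (p.label m, write [.dst m] (radOf (v (.emi m))),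
      if p = .frac then adv [.dst m, .ans, .clk, .emi m, .cnt m]
      else adv [.dst m, .ans, .clk, .emi m])
  | .emitEnd m, _ => (.rewind (.grow m), write [.dst m] none, adv [])
  | .grow m k, v =>
    if k = 0 ∧ v (.emi m) ≠ some (.inr .last) then
      (.grow m 0, noWrite, adv [.emi m, .cnt m, .clk])
    else
      (if k = 3 then .rewind (if m then .call else .loop) else .grow m (k + 1),
        write [.emi m, .cnt m] (some (.inr (growMark k))), adv [.emi m, .cnt m, .clk])
  | .halt, _ => (.halt, noWrite, adv [])

/-- The machine that evaluates a function, given by intervals, at a point. -/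
abbrev evalMachine : OracleMachine where
  State := Label
  Aux := Mark
  numWork := 6
  start := .start 0
  halt := .halt
  oracle := .ask
  δ s v :=
    let r := table s (fun x => v x.tape)
    (r.1, fun t => ((r.2.1 (Reg.ofTape t)).getD (v t), r.2.2 (Reg.ofTape t)))

/-! ### Configurations, single steps and reachability within a number of steps -/

/-- The configuration with given state, cells and heads. -/
def cfg (s : Label) (C : Reg → ℕ → MCell) (H : Reg → ℕ) : evalMachine.Config where
  state := s
  cells := fun t => C (Reg.ofTape t)
  head := fun t => H (Reg.ofTape t)

/-- The tapes after writing. -/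
def writeTo (C : Reg → ℕ → MCell) (H : Reg → ℕ) (w : Reg → Option MCell) : Reg → ℕ → MCell :=
  fun r => (w r).elim (C r) (Function.update (C r) (H r))

theorem move_cfg (s : Label) (C : Reg → ℕ → MCell) (H : Reg → ℕ) {s' : Label}
    {w : Reg → Option MCell} {d : Reg → Move} (h : table s (fun r => C r (H r)) = (s', w, d)) :
    move (cfg s C H) = cfg s' (writeTo C H w) (fun r => (d r).apply (H r)) := by
  simp only [move, cfg, Reg.ofTape_tape, h]
  congr 1
  funext t
  simp only [writeTo]
  cases w (Reg.ofTape t) with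
  | none => exact Function.update_eq_self _ _
  | some x => rfl

variable {φ : StrFun}

/-- Entering `.ask` triggers an oracle call within the same step; that case is left to
`step_cfg_ask`. -/
theorem step_cfg {s s' : Label} {C C' : Reg → ℕ → MCell} {H H' : Reg → ℕ}
    {w : Reg → Option MCell} {d : Reg → Move} (h : table s (fun r => C r (H r)) = (s', w, d))
    (hs : s ≠ .halt) (hs' : s' ≠ .ask) (hC : writeTo C H w = C')
    (hH : (fun r => (d r).apply (H r)) = H') : step φ (cfg s C H) = cfg s' C' H' := by
  have hm := move_cfg s C H h
  rw [step, if_neg (show (cfg s C H).state ≠ evalMachine.halt from hs), hm, if_neg, hC, hH]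
  exact hs'

theorem step_cfg_ask {s : Label} {C : Reg → ℕ → MCell} {H : Reg → ℕ}
    (h : table s (fun r => C r (H r)) = (.ask, noWrite, adv []))
    (hs : s ≠ .halt) : step φ (cfg s C H) =
      cfg .ask (Function.update C .ans
        (writeStr (M := evalMachine) (φ (readStr (M := evalMachine) (C (.dst true)))))) H := by
  have hm := move_cfg s C H h
  rw [step, if_neg (show (cfg s C H).state ≠ evalMachine.halt from hs), hm, if_pos (show (cfg .ask _ _).state = evalMachine.oracle from rfl), callOracle]
  simp only [cfg]
  congr 1
  funext t
  rcases t with _ | _ | _ | _ | i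
  · rfl
  · rfl
  · rfl
  · rfl
  · fin_cases i <;> rfl

theorem holds_unique {c : ℕ → MCell} {u v : Str} (hu : Holds (M := evalMachine) c u)
    (hv : Holds (M := evalMachine) c v) : u = v := by
  have key : ∀ {u v : Str}, Holds (M := evalMachine) c u → Holds (M := evalMachine) c v →
      v.length ≤ u.length := by
    intro u v hu hv
    by_contra! h
    exact hu.2 _ (hv.1 _ h)
  have hl : u.length = v.length := le_antisymm (key hv hu) (key hu hv)
  refine List.ext_getElem hl fun i h1 h2 => ?_
  simpa [hu.1 i h1] using hv.1 i h2

theorem readStr_eq {c : ℕ → MCell} {u : Str} (hu : Holds (M := evalMachine) c u) :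
    readStr (M := evalMachine) c = u := by
  have h : ∃ w, Holds (M := evalMachine) c w := ⟨u, hu⟩
  rw [readStr, dif_pos h]
  exact holds_unique h.choose_spec hu

theorem holds_apply_zero {c : ℕ → MCell} {u : Str} (hu : Holds (M := evalMachine) c u) :
    c 0 = some (.inl .one) ↔ u[0]? = some .one := by
  cases u with
  | nil => simpa using hu.2 .one
  | cons s u =>
    have h0 := hu.1 0 (by simp)
    simp [h0]

/-- One configuration is reached from another one in a bounded number of steps. -/
def Reach (φ : StrFun) (T : ℕ) (c c' : evalMachine.Config) : Prop :=
  ∃ t ≤ T, (step φ)^[t] c = c'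

theorem Reach.refl (c : evalMachine.Config) : Reach φ 0 c c := ⟨0, le_rfl, rfl⟩

theorem Reach.trans {T T' : ℕ} {c c' c'' : evalMachine.Config} (h : Reach φ T c c')
    (h' : Reach φ T' c' c'') : Reach φ (T + T') c c'' := by
  obtain ⟨t, ht, rfl⟩ := h
  obtain ⟨t', ht', rfl⟩ := h'
  exact ⟨t' + t, by omega, Function.iterate_add_apply _ _ _ _⟩

theorem Reach.mono {T T' : ℕ} {c c' : evalMachine.Config} (h : Reach φ T c c') (hT : T ≤ T') :
    Reach φ T' c c' := by
  obtain ⟨t, ht, h⟩ := h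
  exact ⟨t, ht.trans hT, h⟩

theorem Reach.of_step {c c' : evalMachine.Config} (h : step φ c = c') : Reach φ 1 c c' :=
  ⟨1, le_rfl, h⟩

/-- The head positions advance by one on the tapes in a list. -/
def dir (l : List Reg) : Reg → ℕ := fun r => if r ∈ l then 1 else 0

theorem apply_adv (l : List Reg) (H : Reg → ℕ) : (fun r => (adv l r).apply (H r)) = H + dir l := by
  funext r
  simp only [adv, dir, Pi.add_apply]
  split_ifs <;> rfl

theorem writeTo_write_singleton (C : Reg → ℕ → MCell) (H : Reg → ℕ) (r : Reg) (x : MCell) :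
    writeTo C H (write [r] x) = Function.update C r (Function.update (C r) (H r) x) := by
  funext r'
  by_cases h : r' = r
  · subst h; simp [writeTo, write]
  · simp [writeTo, write, h]

/-- A step that moves heads to the right and writes nothing. -/
theorem Reach.of_adv {s s' : Label} {C : Reg → ℕ → MCell} {H : Reg → ℕ} {l : List Reg}
    (h : table s (fun r => C r (H r)) = (s', noWrite, adv l))
    (hs : s ≠ .halt) (hs' : s' ≠ .ask) : Reach φ 1 (cfg s C H) (cfg s' C (H + dir l)) :=
  .of_step (step_cfg h hs hs' rfl (apply_adv l H))

/-- A step that moves heads to the right and writes on one tape. -/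
theorem Reach.of_write {s s' : Label} {C : Reg → ℕ → MCell} {H : Reg → ℕ} {l : List Reg}
    {r : Reg} {x : MCell} (h : table s (fun r => C r (H r)) = (s', write [r] x, adv l))
    (hs : s ≠ .halt) (hs' : s' ≠ .ask) : Reach φ 1 (cfg s C H)
      (cfg s' (Function.update C r (Function.update (C r) (H r) x)) (H + dir l)) :=
  .of_step (step_cfg h hs hs' (writeTo_write_singleton C H r x) (apply_adv l H))

/-! ### Returning the heads to the first cell -/

/-- All heads except that of the input tape are on the first cell. -/
def home (N : ℕ) : Reg → ℕ := fun r => if r = .inp then N else 0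

/-- The clock tape. -/
def clkCells : ℕ → MCell := fun i => if i = 0 then some (.inr .first) else none

theorem dir_nil : dir [] = 0 := by
  funext r; simp [dir]

/-- Induction on the position of the clock head. Truncated subtraction matches the rule that a left
move on the first cell has no effect, so the bound by `n` survives for all heads. -/
theorem reach_rewind_home {C : Reg → ℕ → MCell} (hC : C .clk = clkCells) (r : Ret) (n : ℕ) :
    ∀ H : Reg → ℕ, H .clk = n → (∀ x ≠ Reg.inp, H x ≤ n) →
      Reach φ n (cfg (.rewind r) C H) (cfg (.rewind r) C (home (H .inp))) := by
  induction n with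
  | zero =>
    intro H _ h
    have : H = home (H .inp) := by
      funext x
      by_cases hx : x = .inp
      · simp [hx, home]
      · simpa [hx, home] using h x hx
    rw [← this]
    exact .refl _
  | succ n ih =>
    intro H h0 h
    have h1 := ih (fun x => if x = .inp then H x else H x - 1) (by simp [h0]) (by
      intro x hx
      have := h x hx
      simp only [if_neg hx]
      omega)
    have h2 : Reach φ 1 (cfg (.rewind r) C H)
        (cfg (.rewind r) C (fun x => if x = .inp then H x else H x - 1)) := by
      refine .of_step (step_cfg (w := noWrite) (d := fun x => if x = .inp then .stay else .left)
        ?_ (by simp) (by simp) rfl ?_)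
      · simp [table, h0, hC, clkCells]
      · funext x
        split_ifs <;> rfl
    have := h2.trans h1
    simpa [add_comm] using this

theorem reach_rewind {C : Reg → ℕ → MCell} (hC : C .clk = clkCells) {r : Ret} (hr : r ≠ .call)
    {H : Reg → ℕ} (h : ∀ x ≠ Reg.inp, H x ≤ H .clk) :
    Reach φ (H .clk + 1) (cfg (.rewind r) C H) (cfg r.label C (home (H .inp))) := by
  refine (reach_rewind_home hC r _ H rfl h).trans ?_
  have := Reach.of_adv (φ := φ) (s := .rewind r) (s' := r.label) (C := C) (H := home (H .inp))
    (l := []) (by simp [table, home, hC, clkCells]) (by simp) (by cases r <;> simp_all [Ret.label])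
  simpa [dir_nil] using this

theorem reach_rewind_call {C : Reg → ℕ → MCell} (hC : C .clk = clkCells)
    {H : Reg → ℕ} (h : ∀ x ≠ Reg.inp, H x ≤ H .clk) {q : Str}
    (hq : Holds (M := evalMachine) (C (.dst true)) q) :
    Reach φ (H .clk + 2) (cfg (.rewind .call) C H)
      (cfg (.scanCtl (decide (q[0]? = some .one)) false)
        (Function.update C .ans (writeStr (M := evalMachine) (φ q))) (home (H .inp))) := by
  refine ((reach_rewind_home hC .call _ H rfl h).trans (T' := 1)
    (.of_step (step_cfg_ask ?_ (by simp)))).trans (T' := 1) ?_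
  · simp [table, home, hC, clkCells, Ret.label]
  · rw [readStr_eq hq]
    have := Reach.of_adv (φ := φ) (s := .ask) (s' := .scanCtl (decide (q[0]? = some .one)) false)
      (C := Function.update C .ans (writeStr (M := evalMachine) (φ q))) (H := home (H .inp))
      (l := []) ?_ (by simp) (by simp)
    · simpa [dir_nil] using this
    · simp only [table, home]
      simp [holds_apply_zero hq]

/-! ### Reading the radius -/

/-- A tape with the marks for the radius `2 ^ (-j)`. -/
def markCells (j : ℕ) : ℕ → MCell := fun i => (markAt j i).map .inr

/-- The same marks that serve as a template for control and radius symbols are also a unary counter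
for `j + 3`: the precision to which the radius is tested and the number of fractional bits that are
kept. -/
theorem markCells_ne_none {j i : ℕ} (h : i < j + 3) : markCells j i ≠ none := by
  simp only [markCells, markAt]
  split_ifs <;> first | omega | simp

theorem markCells_eq_none {j : ℕ} : markCells j (j + 3) = none := by
  simp [markCells, markAt]

theorem dir_le_clk {l : List Reg} (h : Reg.clk ∈ l) (x : Reg) : dir l x ≤ dir l .clk := by
  simp only [dir, if_pos h]
  split_ifs <;> omega

/-- The first two steps of reading a triple. -/
theorem reach_scanRad {m f : Bool} {C : Reg → ℕ → MCell} {H : Reg → ℕ}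
    (h : f = true → C (.cnt m) (H (.cnt m)) ≠ none) :
    Reach φ 2 (cfg (.scanCtl m f) C H) (cfg (.scanRad m f) C (H + 2 • dir [.ans, .clk])) := by
  have h1 : Reach φ 1 (cfg (.scanCtl m f) C H) (cfg (.scanNum m f) C (H + dir [.ans, .clk])) :=
    .of_adv (by simp only [table]; rw [if_neg (fun h' => h h'.1 h'.2)]) (by simp) (by simp)
  have h2 : Reach φ 1 (cfg (.scanNum m f) C (H + dir [.ans, .clk]))
      (cfg (.scanRad m f) C (H + dir [.ans, .clk] + dir [.ans, .clk])) :=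
    .of_adv rfl (by simp) (by simp)
  rw [two_nsmul, ← add_assoc]
  exact h1.trans h2

/-- A triple of the fractional part is read. -/
theorem reach_scan_frac {m : Bool} {C : Reg → ℕ → MCell} {H : Reg → ℕ}
    (h : C (.cnt m) (H (.cnt m)) ≠ none)
    (ha : C .ans (H .ans + 2) = none ∨ C .ans (H .ans + 2) = some (.inl .zero)) :
    Reach φ 3 (cfg (.scanCtl m true) C H)
      (cfg (.scanCtl m true) C (H + (3 • dir [.ans, .clk] + dir [.cnt m]))) := by
  refine (reach_scanRad fun _ => h).trans (T' := 1) ?_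
  have h1 : H + (3 • dir [.ans, .clk] + dir [.cnt m]) =
      H + 2 • dir [.ans, .clk] + dir [.ans, .clk, .cnt m] := by
    funext r
    simp only [Pi.add_apply, Pi.smul_apply, dir]
    cases r <;> simp
  rw [h1]
  refine .of_adv ?_ (by simp) (by simp)
  rcases ha with ha | ha <;> simp [table, dir, ha]

theorem reach_scan_frac_loop {m : Bool} {C : Reg → ℕ → MCell} (n : ℕ) : ∀ {H : Reg → ℕ},
    (∀ i < n, C (.cnt m) (H (.cnt m) + i) ≠ none) →
    (∀ i < n, C .ans (H .ans + (3 * i + 2)) = none ∨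
      C .ans (H .ans + (3 * i + 2)) = some (.inl .zero)) →
    Reach φ (3 * n) (cfg (.scanCtl m true) C H)
      (cfg (.scanCtl m true) C (H + n • (3 • dir [.ans, .clk] + dir [.cnt m]))) := by
  induction n with
  | zero => intro H _ _; simpa using Reach.refl _
  | succ n ih =>
    intro H h1 h2
    have h3 := reach_scan_frac (φ := φ) (h1 0 (by omega)) (h2 0 (by omega))
    have h4 := ih (H := H + (3 • dir [.ans, .clk] + dir [.cnt m])) ?_ ?_
    · have := h3.trans h4
      rwa [add_assoc, ← succ_nsmul', show 3 + 3 * n = 3 * (n + 1) by ring] at this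
    · intro i hi
      have := h1 (i + 1) (by omega)
      simpa [dir, add_assoc, add_comm 1 i] using this
    · intro i hi
      have := h2 (i + 1) (by omega)
      simpa [dir, add_assoc, show 3 + (3 * i + 2) = 3 * (i + 1) + 2 by ring] using this

/-- The heads that move while a radius is read are bounded by the clock. -/
theorem scan_le_clk (N k n e : ℕ) (m : Bool) :
    ∀ x ≠ Reg.inp, (home N + k • dir [.ans, .clk] + n • (3 • dir [.ans, .clk] + dir [.cnt m]) +
        e • dir [.ans, .clk]) x ≤
      (home N + k • dir [.ans, .clk] + n • (3 • dir [.ans, .clk] + dir [.cnt m]) +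
        e • dir [.ans, .clk]) .clk := by
  intro x hx
  simp only [Pi.add_apply, Pi.smul_apply, dir, home]
  cases x
  · exact absurd rfl hx
  all_goals simp
  split_ifs <;> omega

/-- All cells of a pair that belong to the second component. -/
theorem strPair_cell_rad {a b : Str} {i : ℕ} :
    (∀ s, b[i]? = some s → writeStr (M := evalMachine) (strPair a b) (3 * i + 2) = some (.inl s)) ∧
    (b.length ≤ i → writeStr (M := evalMachine) (strPair a b) (3 * i + 2) = none ∨
      writeStr (M := evalMachine) (strPair a b) (3 * i + 2) = some (.inl .zero)) := by
  obtain ⟨h1, h2⟩ := (padGet_strPair a b i).2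
  constructor
  · intro s hs
    simp [writeStr, h1 s hs]
  · intro h
    rcases h2 h with h | h <;> simp [writeStr, h]

theorem strPair_cell_num {a b : Str} {i : ℕ} :
    (∀ s, a[i]? = some s → writeStr (M := evalMachine) (strPair a b) (3 * i + 1) = some (.inl s)) ∧
    (a.length ≤ i → writeStr (M := evalMachine) (strPair a b) (3 * i + 1) = none ∨
      writeStr (M := evalMachine) (strPair a b) (3 * i + 1) = some (.inl .zero)) := by
  obtain ⟨h1, h2⟩ := (padGet_strPair a b i).1
  constructor
  · intro s hs
    simp [writeStr, h1 s hs]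
  · intro h
    rcases h2 h with h | h <;> simp [writeStr, h]

theorem dyadicStr_getElem?_frac (a b : List Bool) (i : ℕ) :
    (dyadicStr a b)[a.length + 1 + i]? = (b[i]?).map Sym.ofBit := by
  rw [dyadicStr, List.getElem?_append_right (by simp; omega), List.length_map,
    show a.length + 1 + i - a.length = i + 1 by omega, List.getElem?_cons_succ, List.getElem?_map]

theorem dyadicStr_getElem?_sep (a b : List Bool) : (dyadicStr a b)[a.length]? = some .sep := by
  rw [dyadicStr, List.getElem?_append_right (by simp), List.length_map, Nat.sub_self]
  rfl

theorem dyadicStr_getElem?_int {a : List Bool} (b : List Bool) {i : ℕ} {s : Bool}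
    (hs : a[i]? = some s) : (dyadicStr a b)[i]? = some (Sym.ofBit s) := by
  obtain ⟨hi, h⟩ := List.getElem?_eq_some_iff.1 hs
  rw [dyadicStr, List.getElem?_append_left (by simpa using hi), List.getElem?_map, hs]
  rfl

/-- The cells that hold the fractional part of the radius. -/
theorem strPair_cell_frac (u : Str) (c d : List Bool) (i : ℕ) :
    (d[i]? = some true → writeStr (M := evalMachine) (strPair u (dyadicStr c d))
      (3 * (c.length + 1 + i) + 2) = some (.inl .one)) ∧
    (d[i]? ≠ some true → writeStr (M := evalMachine) (strPair u (dyadicStr c d))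
        (3 * (c.length + 1 + i) + 2) = none ∨
      writeStr (M := evalMachine) (strPair u (dyadicStr c d)) (3 * (c.length + 1 + i) + 2) =
        some (.inl .zero)) := by
  have h := strPair_cell_rad (a := u) (b := dyadicStr c d) (i := c.length + 1 + i)
  rw [dyadicStr_getElem?_frac] at h
  constructor
  · intro hd
    exact h.1 _ (by simp [hd, Sym.ofBit])
  · intro hd
    rcases hdi : d[i]? with _ | s
    · apply h.2
      rw [length_dyadicStr]
      have := List.getElem?_eq_none_iff.1 hdi
      omega
    · cases s
      · exact .inr (h.1 _ (by simp [hdi, Sym.ofBit]))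
      · exact absurd hdi hd

/-- The separator of the radius is found. -/
theorem reach_scan_sep {m : Bool} {C : Reg → ℕ → MCell} {H : Reg → ℕ}
    (ha : C .ans (H .ans + 2) = some (.inl .sep)) :
    Reach φ 3 (cfg (.scanCtl m false) C H)
      (cfg (.scanCtl m true) C (H + 3 • dir [.ans, .clk])) := by
  refine (reach_scanRad (by simp)).trans (T' := 1) ?_
  rw [show (3 : ℕ) = 2 + 1 from rfl, add_nsmul, one_nsmul, ← add_assoc]
  refine .of_adv ?_ (by simp) (by simp)
  simp [table, dir, ha]

/-- A zero before the separator of the radius is skipped. -/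
theorem reach_scan_zero {m : Bool} {C : Reg → ℕ → MCell} {H : Reg → ℕ}
    (ha : C .ans (H .ans + 2) = some (.inl .zero)) :
    Reach φ 3 (cfg (.scanCtl m false) C H)
      (cfg (.scanCtl m false) C (H + 3 • dir [.ans, .clk])) := by
  refine (reach_scanRad (by simp)).trans (T' := 1) ?_
  rw [show (3 : ℕ) = 2 + 1 from rfl, add_nsmul, one_nsmul, ← add_assoc]
  refine .of_adv ?_ (by simp) (by simp)
  simp [table, dir, ha]

/-- The radius is too large. -/
theorem reach_scan_fail {m f : Bool} {C : Reg → ℕ → MCell} {H : Reg → ℕ}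
    (h : f = true → C (.cnt m) (H (.cnt m)) ≠ none)
    (ha : C .ans (H .ans + 2) = some (.inl .one) ∨ (f = false ∧ C .ans (H .ans + 2) = none)) :
    Reach φ 3 (cfg (.scanCtl m f) C H)
      (cfg (.rewind .loop) C (H + 2 • dir [.ans, .clk])) := by
  refine (reach_scanRad h).trans (T' := 1) ?_
  have := Reach.of_adv (φ := φ) (s := .scanRad m f) (s' := .rewind .loop) (C := C)
    (H := H + 2 • dir [.ans, .clk]) (l := []) ?_ (by simp) (by simp)
  · simpa [dir_nil] using this
  · rcases ha with ha | ⟨rfl, ha⟩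
    · cases f <;> simp [table, dir, ha]
    · simp [table, dir, ha]

/-- The fractional part of the radius is compared with `2 ^ (-(j + 3))`. -/
theorem reach_scan_frac_end {m : Bool} {C : Reg → ℕ → MCell} {N j k : ℕ}
    (hclk : C .clk = clkCells) (hcnt : C (.cnt m) = markCells j) {u : Str} {c d : List Bool}
    (hans : C .ans = writeStr (M := evalMachine) (strPair u (dyadicStr c d)))
    (hk : k = 3 * (c.length + 1)) :
    Reach φ (6 * (j + 3) + k + 6) (cfg (.scanCtl m true) C (home N + k • dir [.ans, .clk]))
      (cfg (if ∀ i < j + 3, d[i]? ≠ some true then .emitStart m else .loop) C (home N)) := by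
  set H := home N + k • dir [.ans, .clk] with hH
  have hHans : H .ans = k := by simp [hH, home, dir]
  have hHcnt : H (.cnt m) = 0 := by simp [hH, home, dir]
  -- The scan passes over zeros in parallel with the counter. Bits past the end of `d` appear as
  -- padding or as blanks and count as zeros.
  have loop : ∀ n ≤ j + 3, (∀ i < n, d[i]? ≠ some true) →
      Reach φ (3 * n) (cfg (.scanCtl m true) C H)
        (cfg (.scanCtl m true) C (H + n • (3 • dir [.ans, .clk] + dir [.cnt m]))) := by
    intro n hn hd
    refine reach_scan_frac_loop n ?_ ?_
    · intro i hi
      rw [hHcnt, hcnt]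
      exact markCells_ne_none (by omega)
    · intro i hi
      have := (strPair_cell_frac u c d i).2 (hd i hi)
      rw [hHans, hans, hk]
      rwa [show 3 * (c.length + 1) + (3 * i + 2) = 3 * (c.length + 1 + i) + 2 by ring]
  by_cases hd : ∀ i < j + 3, d[i]? ≠ some true
  · rw [if_pos hd]
    have h1 := loop _ le_rfl hd
    have h2 := Reach.of_adv (φ := φ) (s := .scanCtl m true) (s' := .rewind (.emit m)) (C := C)
      (H := H + (j + 3) • (3 • dir [.ans, .clk] + dir [.cnt m])) (l := []) ?_ (by simp) (by simp)
    · have h3 := reach_rewind (φ := φ) hclk (r := .emit m) (by simp)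
        (H := H + (j + 3) • (3 • dir [.ans, .clk] + dir [.cnt m]))
        (by rw [hH]; simpa using scan_le_clk N k (j + 3) 0 m)
      rw [dir_nil, add_zero] at h2
      have h4 := (h1.trans h2).trans h3
      have e1 : (H + (j + 3) • (3 • dir [.ans, .clk] + dir [.cnt m])) .inp = N := by
        simp [hH, home, dir]
      have e2 : (H + (j + 3) • (3 • dir [.ans, .clk] + dir [.cnt m])) .clk = k + (j + 3) * 3 := by
        simp [hH, home, dir]
      rw [e1, e2] at h4
      exact h4.mono (by omega)
    · have e3 : (H + (j + 3) • (3 • dir [.ans, .clk] + dir [.cnt m])) (.cnt m) = j + 3 := by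
        simp [hH, home, dir]
      simp only [table]
      rw [if_pos ⟨trivial, by rw [e3, hcnt, markCells_eq_none]⟩]
  · rw [if_neg hd]
    push Not at hd
    classical
    -- The scan stops at the first one, which is met before the counter runs out.
    obtain ⟨n, ⟨hn, hdn⟩, hmin⟩ : ∃ n, (n < j + 3 ∧ d[n]? = some true) ∧
        ∀ i < n, ¬ (i < j + 3 ∧ d[i]? = some true) :=
      ⟨Nat.find hd, Nat.find_spec hd, fun i hi => Nat.find_min hd hi⟩
    have h1 := loop n hn.le fun i hi h => hmin i hi ⟨hi.trans hn, h⟩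
    have h2 := reach_scan_fail (φ := φ) (m := m) (f := true) (C := C)
      (H := H + n • (3 • dir [.ans, .clk] + dir [.cnt m])) ?_ ?_
    · have h3 := reach_rewind (φ := φ) hclk (r := .loop) (by simp) (scan_le_clk N k n 2 m)
      have h4 := (h1.trans h2).trans h3
      have e1 : (H + n • (3 • dir [.ans, .clk] + dir [.cnt m]) + 2 • dir [.ans, .clk]) .inp = N := by
        simp [hH, home, dir]
      have e2 : (H + n • (3 • dir [.ans, .clk] + dir [.cnt m]) + 2 • dir [.ans, .clk]) .clk =
          k + n * 3 + 2 := by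
        simp [hH, home, dir]
      rw [← hH, e1, e2] at h4
      exact h4.mono (by omega)
    · intro _
      have e3 : (H + n • (3 • dir [.ans, .clk] + dir [.cnt m])) (.cnt m) = n := by
        simp [hH, home, dir]
      rw [e3, hcnt]
      exact markCells_ne_none hn
    · left
      have e3 : (H + n • (3 • dir [.ans, .clk] + dir [.cnt m])) .ans + 2 =
          3 * (c.length + 1 + n) + 2 := by
        simp [hH, home, dir, hk]; ring
      rw [e3, hans]
      exact (strPair_cell_frac u c d n).1 hdn

/-- The scan of a finite interval tells whether its radius is small. -/
theorem reach_scan {m : Bool} {C : Reg → ℕ → MCell} {N j : ℕ}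
    (hclk : C .clk = clkCells) (hcnt : C (.cnt m) = markCells j) {u : Str} {c d : List Bool}
    (hans : C .ans = writeStr (M := evalMachine) (strPair u (dyadicStr c d)))
    (hc : IsIntCode c) (h0 : 0 < dyadicVal c d) :
    (dyadicVal c d < 1 / 2 ^ (j + 3) ∧
      Reach φ (6 * j + 40) (cfg (.scanCtl m false) C (home N)) (cfg (.emitStart m) C (home N))) ∨
    (¬ dyadicVal c d < 1 / 2 ^ (j + 3) ∧
      Reach φ (6 * j + 40) (cfg (.scanCtl m false) C (home N)) (cfg .loop C (home N))) := by
  have hsep : writeStr (M := evalMachine) (strPair u (dyadicStr c d)) (3 * c.length + 2) =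
      some (.inl .sep) := strPair_cell_rad.1 _ (dyadicStr_getElem?_sep c d)
  have hint : ∀ i s, (c)[i]? = some s → writeStr (M := evalMachine) (strPair u (dyadicStr c d))
      (3 * i + 2) = some (.inl (Sym.ofBit s)) := fun i s hs =>
    strPair_cell_rad.1 _ (dyadicStr_getElem?_int d hs)
  -- This is the condition that the machine tests. For the code of a positive number it is
  -- equivalent to the inequality in the claim.
  by_cases hs : IsSmall (j + 3) c d
  · refine .inl ⟨hs.dyadicVal_lt, ?_⟩
    have hd := hs.frac
    obtain ⟨hd'⟩ | ⟨hd'⟩ := hs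
    · have h1 := reach_scan_sep (φ := φ) (m := m) (C := C) (H := home N)
        (by rw [hans]; exact hsep)
      have h2 := reach_scan_frac_end (φ := φ) (N := N) hclk hcnt hans rfl
      rw [if_pos hd] at h2
      exact (h1.trans h2).mono (by simp; omega)
    · have hz := reach_scan_zero (φ := φ) (m := m) (C := C) (H := home N)
        (by rw [hans]; exact hint 0 false rfl)
      have h1 := reach_scan_sep (φ := φ) (m := m) (C := C) (H := home N + 3 • dir [.ans, .clk])
        (by rw [hans]; simpa [home, dir] using hsep)
      rw [add_assoc, ← add_nsmul] at h1
      have h2 := reach_scan_frac_end (φ := φ) (N := N) hclk hcnt hans rfl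
      rw [if_pos hd] at h2
      exact ((hz.trans h1).trans h2).mono (by simp; omega)
  · refine .inr ⟨fun h => hs (isSmall_of_lt hc h0 h), ?_⟩
    -- Used for `k = 0` and `k = 3`: in a legal integer code, a one in front of the separator shows
    -- up among the first two bits, so rejecting takes constant time.
    have fail : ∀ k : ℕ, k ≤ 3 → C .ans (k + 2) = some (.inl .one) →
        Reach φ (k + 6) (cfg (.scanCtl m false) C (home N + k • dir [.ans, .clk]))
          (cfg .loop C (home N)) := by
      intro k hk ha
      have h2 := reach_scan_fail (φ := φ) (m := m) (f := false) (C := C)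
        (H := home N + k • dir [.ans, .clk]) (by simp) (.inl (by simpa [home, dir] using ha))
      have h3 := reach_rewind (φ := φ) hclk (r := .loop) (by simp)
        (by simpa using scan_le_clk N k 0 2 m)
      have h4 := h2.trans h3
      simp [home, dir, Ret.label] at h4
      exact h4.mono (by omega)
    rcases c with _ | ⟨s, c⟩
    · have h1 := reach_scan_sep (φ := φ) (m := m) (C := C) (H := home N)
        (by rw [hans]; exact hsep)
      have h2 := reach_scan_frac_end (φ := φ) (N := N) hclk hcnt hans rfl
      rw [if_neg fun hd => hs (.nil hd)] at h2
      exact (h1.trans h2).mono (by simp; omega)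
    · cases s
      · have hz := reach_scan_zero (φ := φ) (m := m) (C := C) (H := home N)
          (by rw [hans]; exact hint 0 false rfl)
        rcases c with _ | ⟨s, c⟩
        · have h1 := reach_scan_sep (φ := φ) (m := m) (C := C) (H := home N + 3 • dir [.ans, .clk])
            (by rw [hans]; simpa [home, dir] using hsep)
          rw [add_assoc, ← add_nsmul] at h1
          have h2 := reach_scan_frac_end (φ := φ) (N := N) hclk hcnt hans rfl
          rw [if_neg fun hd => hs (.single hd)] at h2
          exact ((hz.trans h1).trans h2).mono (by simp; omega)
        · obtain ⟨s', t', h'⟩ := hc.eq_cons_cons (by simp)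
          have hs1 : s = true := by simp_all
          have h1 := fail 3 le_rfl (by rw [hans]; exact hint 1 true (by simp [hs1]))
          exact (hz.trans h1).mono (by omega)
      · have h1 := fail 0 (by omega) (by rw [hans]; exact hint 0 true rfl)
        simp only [zero_nsmul, add_zero] at h1
        exact h1.mono (by omega)

/-- The scan of the infinite interval. -/
theorem reach_scan_nil {m : Bool} {C : Reg → ℕ → MCell} {N : ℕ}
    (hclk : C .clk = clkCells) (hans : C .ans = writeStr (M := evalMachine) []) :
    Reach φ 6 (cfg (.scanCtl m false) C (home N)) (cfg .loop C (home N)) := by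
  have h2 := reach_scan_fail (φ := φ) (m := m) (f := false) (C := C) (H := home N) (by simp)
    (by simp [hans, writeStr])
  have h3 := reach_rewind (φ := φ) hclk (r := .loop) (by simp)
    (by simpa using scan_le_clk N 0 0 2 m)
  have h4 := h2.trans h3
  simpa [home, dir, Ret.label] using h4

/-! ### Writing a rounded interval -/

/-- The cells after the string `w` was written from the first cell on. -/
def put (c : ℕ → MCell) (w : Str) : ℕ → MCell :=
  fun i => ((w[i]?).map fun s => some (.inl s)).getD (c i)

theorem put_nil (c : ℕ → MCell) : put c [] = c := by
  funext i; simp [put]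

theorem update_put (c : ℕ → MCell) (w : Str) (s : Sym) :
    Function.update (put c w) w.length (some (.inl s)) = put c (w ++ [s]) := by
  funext i
  simp only [Function.update_apply, put]
  split_ifs with h
  · simp [h]
  · rcases lt_or_gt_of_ne h with h | h
    · rw [List.getElem?_append_left h]
    · rw [List.getElem?_eq_none (by omega), List.getElem?_eq_none (by simp; omega)]

/-- Leftovers of a longer string need not be erased, as a single blank ends the string that the tape
holds. -/
theorem holds_update_put (c : ℕ → MCell) (w : Str) :
    Holds (M := evalMachine) (Function.update (put c w) w.length none) w := by
  constructor
  · intro i h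
    rw [Function.update_of_ne h.ne]
    simp [put, h]
  · simp

theorem ctlOf_markCells (j i : ℕ) : ctlOf (markCells j i) = some (.inl (ctlAt j i)) := by
  simp only [markCells, ctlAt]
  cases markAt j i <;> rfl

theorem radOf_markCells (j i : ℕ) : radOf (markCells j i) = some (.inl (radAt j i)) := by
  simp only [markCells, radAt]
  cases markAt j i <;> rfl

/-- The head movements while a triple is written. -/
def emitDir (m : Bool) (p : Phase) : Reg → ℕ :=
  3 • dir [.dst m, .ans, .clk] + dir [.emi m] + if p = .frac then dir [.cnt m] else 0

/-- A triple is written. -/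
theorem reach_emit {m f : Bool} {C : Reg → ℕ → MCell} {H : Reg → ℕ} {c : ℕ → MCell} {w : Str}
    {p : Phase} {s : Sym} {j i : ℕ} (hw : H (.dst m) = w.length) (hC : C (.dst m) = put c w)
    (hemi : C (.emi m) = markCells j) (hi : H (.emi m) = i)
    (hs : centerSym f (C .ans (H .ans + 1)) (C (.cnt m) (H (.cnt m))) = (p, some (.inl s))) :
    Reach φ 3 (cfg (.emitCtl m f) C H)
      (cfg (p.label m) (Function.update C (.dst m) (put c (w ++ markStr j i [s])))
        (H + emitDir m p)) := by
  have h1 : Reach φ 1 (cfg (.emitCtl m f) C H) (cfg (.emitNum m f) _ _) :=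
    .of_write (r := .dst m) (x := ctlOf (C (.emi m) (H (.emi m)))) (l := [.dst m, .ans, .clk])
      rfl (by simp) (by simp)
  rw [hC, hw, hemi, hi, ctlOf_markCells, update_put] at h1
  have h2 : Reach φ 1 (cfg (.emitNum m f) (Function.update C (.dst m) (put c (w ++ [ctlAt j i])))
      (H + dir [.dst m, .ans, .clk])) (cfg (.emitRad m p) _ _) :=
    .of_write (r := .dst m) (x := some (.inl s)) (l := [.dst m, .ans, .clk])
      (by simp only [table]; simp [dir, hs]) (by simp) (by simp)
  rw [Function.update_self, Function.update_idem, show (H + dir [.dst m, .ans, .clk]) (.dst m) =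
    (w ++ [ctlAt j i]).length by simp [dir, hw], update_put] at h2
  have h3 : Reach φ 1 (cfg (.emitRad m p) (Function.update C (.dst m)
      (put c (w ++ [ctlAt j i] ++ [s]))) (H + dir [.dst m, .ans, .clk] + dir [.dst m, .ans, .clk]))
      (cfg (p.label m) _ _) :=
    .of_write (r := .dst m) (x := some (.inl (radAt j i)))
      (l := if p = .frac then [.dst m, .ans, .clk, .emi m, .cnt m]
        else [.dst m, .ans, .clk, .emi m])
      (by
        simp only [table]
        have : Function.update C (.dst m) (put c (w ++ [ctlAt j i] ++ [s])) (.emi m)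
          ((H + dir [.dst m, .ans, .clk] + dir [.dst m, .ans, .clk]) (.emi m)) =
            markCells j i := by simp [hemi, hi, dir]
        rw [this, radOf_markCells]
        split_ifs <;> rfl) (by simp) (by cases p <;> simp [Phase.label])
  rw [Function.update_self, Function.update_idem,
    show (H + dir [.dst m, .ans, .clk] + dir [.dst m, .ans, .clk]) (.dst m) =
    (w ++ [ctlAt j i] ++ [s]).length by simp [dir, hw], update_put] at h3
  convert (h1.trans h2).trans h3 using 2
  · simp [markStr]
  · funext r
    simp only [emitDir, Pi.add_apply, Pi.smul_apply, add_assoc]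
    congr 1
    split_ifs <;> cases r <;> simp [dir] <;> split_ifs <;> rfl

/-- A sequence of triples is written in one phase. -/
theorem reach_emit_loop {m f : Bool} {p : Phase} (hp : p.label m = .emitCtl m f) {c : ℕ → MCell}
    {j : ℕ} (l : Str) : ∀ {C : Reg → ℕ → MCell} {H : Reg → ℕ} {w : Str} {i : ℕ},
    H (.dst m) = w.length → C (.dst m) = put c w →
    C (.emi m) = markCells j → H (.emi m) = i →
    (∀ k (hk : k < l.length), centerSym f (C .ans (H .ans + (3 * k + 1)))
      (C (.cnt m) (H (.cnt m) + if p = .frac then k else 0)) = (p, some (.inl l[k]))) →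
    Reach φ (3 * l.length) (cfg (.emitCtl m f) C H)
      (cfg (.emitCtl m f) (Function.update C (.dst m) (put c (w ++ markStr j i l)))
        (H + l.length • emitDir m p)) := by
  induction l with
  | nil =>
    intro C H w i hw hC _ _ _
    simpa [markStr, ← hC] using Reach.refl _
  | cons s l ih =>
    intro C H w i hw hC hemi hi hl
    have h1 := reach_emit (φ := φ) hw hC hemi hi (by simpa using hl 0 (by simp))
    rw [hp] at h1
    have h2 := ih (C := Function.update C (.dst m) (put c (w ++ markStr j i [s])))
      (H := H + emitDir m p) (w := w ++ markStr j i [s]) (i := i + 1) ?_ ?_ ?_ ?_ ?_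
    · rw [Function.update_idem, add_assoc, ← succ_nsmul', List.append_assoc] at h2
      have := h1.trans h2
      rw [show 3 + 3 * l.length = 3 * (s :: l).length by simp; ring] at this
      exact this
    · rw [List.length_append, length_markStr, Pi.add_apply, hw, emitDir]
      split_ifs <;> simp [dir]
    · simp
    · simp [hemi]
    · rw [Pi.add_apply, hi, emitDir]
      split_ifs <;> simp [dir]
    · intro k hk
      have := hl (k + 1) (by simpa using hk)
      rw [List.getElem_cons_succ] at this
      rw [← this, Function.update_of_ne (by simp), Function.update_of_ne (by simp)]
      congr 2
      · rw [Pi.add_apply, emitDir]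
        split_ifs <;> simp [dir] <;> ring
      · rw [Pi.add_apply, emitDir]
        split_ifs
        · simp [dir]; ring
        · simp [dir]

/-- The heads that move while an interval is written are bounded by the clock. -/
theorem emit_le_clk {m : Bool} {H : Reg → ℕ} (h : ∀ x ≠ Reg.inp, H x ≤ H .clk) (p : Phase) (n : ℕ) :
    ∀ x ≠ Reg.inp, (H + n • emitDir m p) x ≤ (H + n • emitDir m p) .clk := by
  intro x hx
  have := h x hx
  have h1 : emitDir m p x ≤ emitDir m p .clk := by
    simp only [emitDir, Pi.add_apply, Pi.smul_apply]
    split_ifs <;> cases x <;> simp [dir] <;> split_ifs <;> omega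
  simp only [Pi.add_apply, Pi.smul_apply, smul_eq_mul]
  gcongr

theorem emitDir_inp (m : Bool) (p : Phase) : emitDir m p .inp = 0 := by
  simp only [emitDir]
  split_ifs <;> simp [dir]

theorem emitDir_clk (m : Bool) (p : Phase) : emitDir m p .clk = 3 := by
  simp only [emitDir]
  split_ifs <;> simp [dir]

theorem emitDir_ans (m : Bool) (p : Phase) : emitDir m p .ans = 3 := by
  simp only [emitDir]
  split_ifs <;> simp [dir]

theorem emitDir_emi (m : Bool) (p : Phase) : emitDir m p (.emi m) = 1 := by
  simp only [emitDir]
  split_ifs <;> simp [dir]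

theorem emitDir_dst (m : Bool) (p : Phase) : emitDir m p (.dst m) = 3 := by
  simp only [emitDir]
  split_ifs <;> simp [dir]

theorem emitDir_cnt (m : Bool) (p : Phase) :
    emitDir m p (.cnt m) = if p = .frac then 1 else 0 := by
  simp only [emitDir]
  split_ifs <;> simp [dir]

/-- The string that precedes the code of the interval on the query tape. -/
def dstPrefix (m : Bool) : Str := if m then [.zero] else []

theorem reach_emitStart {m : Bool} {C : Reg → ℕ → MCell} {N : ℕ} :
    ∃ H : Reg → ℕ, Reach φ 1 (cfg (.emitStart m) C (home N)) (cfg (.emitCtl m false)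
      (Function.update C (.dst m) (put (C (.dst m)) (dstPrefix m))) H) ∧
      H .inp = N ∧ H .ans = 0 ∧ H (.dst m) = (dstPrefix m).length ∧ H (.emi m) = 0 ∧
      H (.cnt m) = 0 ∧ H .clk ≤ 1 ∧ ∀ x ≠ Reg.inp, H x ≤ H .clk := by
  cases m
  · refine ⟨home N, ?_, rfl, rfl, rfl, rfl, rfl, by simp [home],
      fun x hx => by simp [home, hx]⟩
    have := Reach.of_adv (φ := φ) (s := .emitStart false) (s' := .emitCtl false false) (C := C)
      (H := home N) (l := []) rfl (by simp) (by simp)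
    simpa [dir_nil, dstPrefix, put_nil] using this
  · refine ⟨home N + dir [.dst true, .clk], ?_, rfl, rfl, rfl, rfl, rfl, by simp [home, dir], ?_⟩
    · have := Reach.of_write (φ := φ) (s := .emitStart true) (s' := .emitCtl true false) (C := C)
        (H := home N) (r := .dst true) (x := some (.inl .zero)) (l := [.dst true, .clk]) rfl
        (by simp) (by simp)
      have e : Function.update (C (.dst true)) (home N (.dst true)) (some (.inl .zero)) =
          put (C (.dst true)) (dstPrefix true) := by
        have := update_put (C (.dst true)) [] .zero
        rwa [put_nil] at this
      rwa [e] at this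
    · intro x hx
      simp only [home, Pi.add_apply, if_neg hx, reduceCtorEq, if_false, zero_add]
      exact dir_le_clk (by simp) x

/-- The rounded interval is written. -/
theorem reach_emit_all {m : Bool} {C : Reg → ℕ → MCell} {N j : ℕ} (hj : 1 ≤ j)
    (hclk : C .clk = clkCells) (hcnt : C (.cnt m) = markCells j)
    (hemi : C (.emi m) = markCells j) {v : Str} {a b : List Bool}
    (hans : C .ans = writeStr (M := evalMachine) (strPair (dyadicStr a b) v)) :
    ∃ c, Holds (M := evalMachine) c (dstPrefix m ++ roundPair j a b) ∧
      Reach φ (6 * (a.length + j) + 40) (cfg (.emitStart m) C (home N))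
        (cfg (.grow m 0) (Function.update C (.dst m) c) (home N)) := by
  set w := dstPrefix m with hw
  set t := (b ++ List.replicate (j + 3) false).take (j + 3) with ht
  have htl : t.length = j + 3 := by simp [ht]
  obtain ⟨H, h0, hinp, hHans, hdst, hHemi, hHcnt, hHclk, hle⟩ :=
    reach_emitStart (φ := φ) (m := m) (C := C) (N := N)
  set c₀ := C (.dst m)
  -- integer part
  have h1 := reach_emit_loop (φ := φ) (m := m) (f := false) (p := .int) rfl (c := c₀) (j := j)
    (a.map Sym.ofBit) (C := Function.update C (.dst m) (put c₀ w)) (H := H) (w := w) (i := 0)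
    hdst (by simp) (by simpa using hemi) hHemi (by
      intro k hk
      have hk' : k < a.length := by simpa using hk
      have := strPair_cell_num (a := dyadicStr a b) (b := v) (i := k)
      have := this.1 _ (dyadicStr_getElem?_int b (List.getElem?_eq_getElem hk'))
      rw [Function.update_of_ne (by simp), hans, hHans, zero_add, this, List.getElem_map]
      cases a[k] <;> rfl)
  rw [Function.update_idem, List.length_map] at h1
  set H1 := H + a.length • emitDir m .int with hH1
  set w1 := w ++ markStr j 0 (a.map Sym.ofBit) with hw1
  have hw1l : w1.length = w.length + 3 * a.length := by simp [hw1, length_markStr]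
  -- separator
  have h2 := reach_emit (φ := φ) (m := m) (f := false) (p := .sep) (s := .sep)
    (C := Function.update C (.dst m) (put c₀ w1)) (H := H1) (c := c₀) (w := w1) (j := j)
    (i := a.length) (by
      rw [hw1l, hH1, Pi.add_apply, Pi.smul_apply, emitDir_dst, hdst, smul_eq_mul, mul_comm])
    (by simp) (by simpa using hemi) (by
      rw [hH1, Pi.add_apply, Pi.smul_apply, emitDir_emi, hHemi, smul_eq_mul]; ring) (by
      have := strPair_cell_num (a := dyadicStr a b) (b := v) (i := a.length)
      have := this.1 _ (dyadicStr_getElem?_sep a b)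
      rw [Function.update_of_ne (by simp), hans, hH1, Pi.add_apply, Pi.smul_apply, emitDir_ans,
        hHans, smul_eq_mul, zero_add, mul_comm, this]
      rfl)
  rw [Function.update_idem] at h2
  set H2 := H1 + emitDir m .sep with hH2
  set w2 := w1 ++ markStr j a.length [Sym.sep] with hw2
  have hw2l : w2.length = w.length + 3 * (a.length + 1) := by
    simp [hw2, length_markStr, hw1l]; ring
  have hH2ans : H2 .ans = 3 * (a.length + 1) := by
    rw [hH2, hH1, Pi.add_apply, Pi.add_apply, Pi.smul_apply, emitDir_ans, emitDir_ans, hHans,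
      smul_eq_mul]
    ring
  have hH2cnt : H2 (.cnt m) = 0 := by
    rw [hH2, hH1, Pi.add_apply, Pi.add_apply, Pi.smul_apply, emitDir_cnt, emitDir_cnt, hHcnt]
    simp
  have hH2emi : H2 (.emi m) = a.length + 1 := by
    rw [hH2, hH1, Pi.add_apply, Pi.add_apply, Pi.smul_apply, emitDir_emi, emitDir_emi, hHemi,
      smul_eq_mul]
    ring
  have hH2dst : H2 (.dst m) = w2.length := by
    rw [hH2, hH1, Pi.add_apply, Pi.add_apply, Pi.smul_apply, emitDir_dst, emitDir_dst, hdst,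
      smul_eq_mul, hw2l]
    ring
  -- fractional part
  have h3 := reach_emit_loop (φ := φ) (m := m) (f := true) (p := .frac) rfl (c := c₀) (j := j)
    (t.map Sym.ofBit) (C := Function.update C (.dst m) (put c₀ w2)) (H := H2) (w := w2)
    (i := a.length + 1) hH2dst (by simp) (by simpa using hemi) hH2emi (by
      intro k hk
      have hk' : k < j + 3 := by simpa [htl] using hk
      obtain ⟨x, hx⟩ := Option.ne_none_iff_exists'.1 (markCells_ne_none hk')
      have key := strPair_cell_num (a := dyadicStr a b) (b := v) (i := a.length + 1 + k)
      rw [dyadicStr_getElem?_frac] at key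
      rw [Function.update_of_ne (by simp), Function.update_of_ne (by simp), hcnt, hH2cnt, hans,
        hH2ans, if_pos rfl, zero_add, hx, List.getElem_map,
        show 3 * (a.length + 1) + (3 * k + 1) = 3 * (a.length + 1 + k) + 1 by ring]
      simp only [ht, List.getElem_take, List.getElem_append]
      -- Either a bit of `b` is copied, or its end has been passed and both padding and blanks are
      -- copied as zeros.
      split_ifs with hb
      · rw [key.1 _ (by rw [List.getElem?_eq_getElem hb]; rfl)]
        rfl
      · rw [List.getElem_replicate]
        rcases key.2 (by rw [length_dyadicStr]; omega) with h | h <;> rw [h] <;> rfl)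
  rw [Function.update_idem, List.length_map, htl] at h3
  set H3 := H2 + (j + 3) • emitDir m .frac with hH3
  set w3 := w2 ++ markStr j (a.length + 1) (t.map Sym.ofBit) with hw3
  have hw3l : w3.length = w2.length + 3 * (j + 3) := by simp [hw3, length_markStr, htl]
  -- final one
  have h4 := reach_emit (φ := φ) (m := m) (f := true) (p := .last) (s := .one)
    (C := Function.update C (.dst m) (put c₀ w3)) (H := H3) (c := c₀) (w := w3) (j := j)
    (i := a.length + 1 + (j + 3)) (by
      rw [hw3l, hH3, Pi.add_apply, Pi.smul_apply, emitDir_dst, hH2dst, smul_eq_mul, mul_comm])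
    (by simp) (by simpa using hemi) (by
      rw [hH3, Pi.add_apply, Pi.smul_apply, emitDir_emi, hH2emi, smul_eq_mul, mul_one]) (by
      have e : H3 (.cnt m) = j + 3 := by
        rw [hH3, Pi.add_apply, Pi.smul_apply, emitDir_cnt, hH2cnt]; simp
      rw [Function.update_of_ne (by simp), Function.update_of_ne (by simp), hcnt, e,
        markCells_eq_none]
      rfl)
  rw [Function.update_idem] at h4
  set H4 := H3 + emitDir m .last with hH4
  set w4 := w3 ++ markStr j (a.length + 1 + (j + 3)) [Sym.one] with hw4
  have hw4e : w4 = w ++ roundPair j a b := by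
    have e : dyadicStr a (truncBits (j + 3) b) =
        a.map Sym.ofBit ++ ([.sep] ++ (t.map Sym.ofBit ++ [.one])) := by
      simp [dyadicStr, truncBits, ← ht, Sym.ofBit]
    rw [roundPair_eq_markStr hj, e, markStr_append, markStr_append, markStr_append, hw4, hw3, hw2,
      hw1]
    simp only [List.length_map, List.length_singleton, htl, List.append_assoc, zero_add]
  have hw4l : w4.length = w3.length + 3 := by simp [hw4, length_markStr]
  have hH4dst : H4 (.dst m) = w4.length := by
    rw [hH4, hH3, Pi.add_apply, Pi.add_apply, Pi.smul_apply, emitDir_dst, emitDir_dst, hH2dst,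
      hw4l, hw3l, smul_eq_mul, mul_comm]
  have h5 : Reach φ 1 (cfg (.emitEnd m) (Function.update C (.dst m) (put c₀ w4)) H4)
      (cfg (.rewind (.grow m)) _ _) :=
    .of_write (r := .dst m) (x := none) (l := []) rfl (by simp) (by simp)
  rw [Function.update_self, Function.update_idem, dir_nil, add_zero, hH4dst] at h5
  -- The clock head dominates in every phase, so one rewinding brings all heads home.
  have hle4 : ∀ x ≠ Reg.inp, H4 x ≤ H4 .clk := by
    have e1 := emit_le_clk (m := m) hle .int a.length
    have e2 := emit_le_clk (m := m) e1 .sep 1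
    have e3 := emit_le_clk (m := m) e2 .frac (j + 3)
    have e4 := emit_le_clk (m := m) e3 .last 1
    simpa only [one_nsmul] using e4
  have hclk4 : H4 .clk = H .clk + 3 * (a.length + j + 5) := by
    rw [hH4, hH3, hH2, hH1]
    simp only [Pi.add_apply, Pi.smul_apply, emitDir_clk, smul_eq_mul]
    ring
  have hinp4 : H4 .inp = N := by
    rw [hH4, hH3, hH2, hH1]
    simp only [Pi.add_apply, Pi.smul_apply, emitDir_inp, smul_eq_mul, hinp]
    ring
  have h6 := reach_rewind (φ := φ)
    (C := Function.update C (.dst m) (Function.update (put c₀ w4) w4.length none))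
    (by simpa using hclk) (r := .grow m) (by simp) hle4
  rw [hinp4] at h6
  refine ⟨_, by rw [← hw4e]; exact holds_update_put c₀ w4, ?_⟩
  refine ((((((h0.trans h1).trans h2).trans h3).trans h4).trans h5).trans h6).mono ?_
  rw [hclk4]
  omega

/-! ### Increasing the precision -/

/-- The marks of one mode are replaced. -/
def setMarks (C : Reg → ℕ → MCell) (m : Bool) (X : ℕ → MCell) : Reg → ℕ → MCell :=
  fun r => if r = .emi m ∨ r = .cnt m then X else C r

theorem reach_grow_step {m : Bool} {C : Reg → ℕ → MCell} {X : ℕ → MCell} {H : Reg → ℕ} {h : ℕ}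
    {k : Fin 4} {s : Label} (hs : s = if k = 3 then .rewind (if m then .call else .loop)
      else .grow m (k + 1)) (hk : k = 0 → X h = some (.inr .last)) (he : H (.emi m) = h)
    (hc : H (.cnt m) = h) :
    Reach φ 1 (cfg (.grow m k) (setMarks C m X) H)
      (cfg s (setMarks C m (Function.update X h (some (.inr (growMark k)))))
        (H + dir [.emi m, .cnt m, .clk])) := by
  refine .of_step (step_cfg (w := write [.emi m, .cnt m] (some (.inr (growMark k)))) ?_ (by simp)
    ?_ ?_ (apply_adv _ H))
  · simp only [table]
    rw [if_neg, hs]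
    simp only [setMarks, true_or, if_true, he]
    tauto
  · rw [hs]
    split_ifs <;> simp
  · funext r
    by_cases h1 : r = .emi m
    · subst h1; simp [writeTo, write, setMarks, he]
    · by_cases h2 : r = .cnt m
      · subst h2; simp [writeTo, write, setMarks, hc]
      · simp [writeTo, write, setMarks, h1, h2]

/-- The last three marks move one cell to the right and the gap in front of them is filled, so four
writes that begin at the mark `last` suffice. -/
theorem markCells_succ {j : ℕ} (hj : 1 ≤ j) :
    Function.update (Function.update (Function.update (Function.update (markCells j)
      j (some (.inr (growMark 0)))) (j + 1) (some (.inr (growMark 1)))) (j + 1 + 1)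
      (some (.inr (growMark 2)))) (j + 1 + 1 + 1) (some (.inr (growMark 3))) =
      markCells (j + 1) := by
  funext i
  simp only [Function.update_apply, markCells, markAt, growMark]
  split_ifs <;> first | omega | rfl

theorem reach_grow {m : Bool} {C : Reg → ℕ → MCell} {N j : ℕ} (hj : 1 ≤ j)
    (hemi : C (.emi m) = markCells j) (hcnt : C (.cnt m) = markCells j) :
    ∃ H : Reg → ℕ, Reach φ (j + 4) (cfg (.grow m 0) C (home N))
      (cfg (.rewind (if m then .call else .loop)) (setMarks C m (markCells (j + 1))) H) ∧
      H .inp = N ∧ H .clk = j + 4 ∧ ∀ x ≠ Reg.inp, H x ≤ H .clk := by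
  have walk : ∀ n ≤ j, Reach φ n (cfg (.grow m 0) C (home N))
      (cfg (.grow m 0) C (home N + n • dir [.emi m, .cnt m, .clk])) := by
    intro n
    induction n with
    | zero => intro _; simpa using Reach.refl _
    | succ n ih =>
      intro hn
      refine (ih (by omega)).trans (T' := 1) ?_
      rw [succ_nsmul, ← add_assoc]
      refine .of_adv ?_ (by simp) (by simp)
      simp only [table]
      rw [if_pos]
      refine ⟨trivial, ?_⟩
      have e : (home N + n • dir [.emi m, .cnt m, .clk]) (.emi m) = n := by simp [home, dir]
      rw [e, hemi, markCells, markAt]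
      split_ifs <;> first | omega | simp
  -- Both tapes already carry these marks; in this form the four writes can be chained.
  have h0 : C = setMarks C m (markCells j) := by
    funext r
    simp only [setMarks]
    split_ifs with h
    · rcases h with rfl | rfl <;> assumption
    · rfl
  have h1 := walk j le_rfl
  nth_rw 2 [h0] at h1
  have h2 := reach_grow_step (φ := φ) (m := m) (C := C) (X := markCells j) (h := j) (k := 0) rfl
    (by intro _; simp [markCells, markAt, show j ≠ 0 by omega])
    (H := home N + j • dir [.emi m, .cnt m, .clk]) (by simp [home, dir]) (by simp [home, dir])
  have h3 := reach_grow_step (φ := φ) (m := m) (C := C) (h := j + 1) (k := 1) rfl (by simp)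
    (X := Function.update (markCells j) j (some (.inr (growMark 0))))
    (H := home N + j • dir [.emi m, .cnt m, .clk] + dir [.emi m, .cnt m, .clk])
    (by simp [home, dir]) (by simp [home, dir])
  have h4 := reach_grow_step (φ := φ) (m := m) (C := C) (h := j + 1 + 1) (k := 2) rfl (by simp)
    (X := Function.update (Function.update (markCells j) j (some (.inr (growMark 0)))) (j + 1)
      (some (.inr (growMark 1))))
    (H := home N + j • dir [.emi m, .cnt m, .clk] + dir [.emi m, .cnt m, .clk] +
      dir [.emi m, .cnt m, .clk])
    (by simp [home, dir]) (by simp [home, dir])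
  have h5 := reach_grow_step (φ := φ) (m := m) (C := C) (h := j + 1 + 1 + 1) (k := 3) rfl (by simp)
    (X := Function.update (Function.update (Function.update (markCells j) j
      (some (.inr (growMark 0)))) (j + 1) (some (.inr (growMark 1)))) (j + 1 + 1)
      (some (.inr (growMark 2))))
    (H := home N + j • dir [.emi m, .cnt m, .clk] + dir [.emi m, .cnt m, .clk] +
      dir [.emi m, .cnt m, .clk] + dir [.emi m, .cnt m, .clk])
    (by simp [home, dir]) (by simp [home, dir])
  rw [markCells_succ hj] at h5
  refine ⟨_, (((h1.trans h2).trans h3).trans h4).trans h5, by simp [home, dir],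
    by simp [home, dir], ?_⟩
  intro x hx
  simp only [Pi.add_apply, Pi.smul_apply, home, if_neg hx, smul_eq_mul, reduceCtorEq, if_false]
  have := dir_le_clk (l := [.emi m, .cnt m, .clk]) (by simp) x
  gcongr

/-! ### Rounding the answer of the oracle -/

open Classical in
/-- The rounding of an interval to radius `2 ^ (-j)`, if its radius is less than
`2 ^ (-(j + 3))`. -/
noncomputable def roundOf (j : ℕ) (w : Str) : Option Str :=
  if h : ∃ (p : List Bool × List Bool) (c d : List Bool), IsIntCode p.1 ∧
      p.2.getLast? ≠ some false ∧ d.getLast? ≠ some false ∧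
      w = strPair (dyadicStr p.1 p.2) (dyadicStr c d) ∧ dyadicVal c d < 1 / 2 ^ (j + 3) then
    some (roundPair j h.choose.1 h.choose.2)
  else none

theorem dyadicStr_getLast? (a : List Bool) {b : List Bool} (hb : b.getLast? ≠ some false) :
    (dyadicStr a b).getLast? ≠ some .zero := by
  rcases List.eq_nil_or_concat b with rfl | ⟨b, s, rfl⟩
  · simp [dyadicStr]
  · cases s
    · simp at hb
    · rw [dyadicStr, List.concat_eq_append, List.map_append, ← List.cons_append,
        ← List.append_assoc]
      simp only [List.map_cons, List.map_nil, List.getLast?_concat]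
      simp [Sym.ofBit]

theorem dyadicStr_inj {a b a' b' : List Bool} (h : dyadicStr a b = dyadicStr a' b') :
    a = a' ∧ b = b' := by
  obtain ⟨h1, h2⟩ := split_inj h
  exact ⟨h1, ofBit_inj.list_map h2⟩

/-- Codes without trailing zeros can be recovered from a padded pair, so the decomposition chosen in
`roundOf` has the given center and radius. -/
theorem roundOf_strPair {j : ℕ} {a b c d : List Bool} (ha : IsIntCode a)
    (hb : b.getLast? ≠ some false) (hd : d.getLast? ≠ some false) :
    (dyadicVal c d < 1 / 2 ^ (j + 3) →
      roundOf j (strPair (dyadicStr a b) (dyadicStr c d)) = some (roundPair j a b)) ∧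
    (¬ dyadicVal c d < 1 / 2 ^ (j + 3) →
      roundOf j (strPair (dyadicStr a b) (dyadicStr c d)) = none) := by
  constructor
  · intro h
    have hex : ∃ (p : List Bool × List Bool) (c' d' : List Bool), IsIntCode p.1 ∧
      p.2.getLast? ≠ some false ∧ d'.getLast? ≠ some false ∧
      strPair (dyadicStr a b) (dyadicStr c d) = strPair (dyadicStr p.1 p.2) (dyadicStr c' d') ∧
      dyadicVal c' d' < 1 / 2 ^ (j + 3) := ⟨(a, b), c, d, ha, hb, hd, rfl, h⟩
    rw [roundOf, dif_pos hex]
    obtain ⟨c', d', -, hb', hd', he, -⟩ := hex.choose_spec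
    obtain ⟨h1, -⟩ := strPair_inj (dyadicStr_getLast? a hb) (dyadicStr_getLast? c hd)
      (dyadicStr_getLast? _ hb') (dyadicStr_getLast? _ hd') he
    obtain ⟨h2, h3⟩ := dyadicStr_inj h1
    rw [← h2, ← h3]
  · intro h
    rw [roundOf, dif_neg]
    rintro ⟨p, c', d', -, hb', hd', he, hlt⟩
    obtain ⟨-, h1⟩ := strPair_inj (dyadicStr_getLast? a hb) (dyadicStr_getLast? c hd)
      (dyadicStr_getLast? _ hb') (dyadicStr_getLast? _ hd') he
    obtain ⟨rfl, rfl⟩ := dyadicStr_inj h1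
    exact h hlt

theorem roundOf_nil (j : ℕ) : roundOf j [] = none := by
  rw [roundOf, dif_neg]
  rintro ⟨p, c', d', -, -, -, he, -⟩
  exact strPair_ne_nil _ _ he.symm

/-- The rounding contains the points of the interval well inside. -/
theorem roundOf_eq_some {j : ℕ} (hj : 1 ≤ j) {w v : Str} {J : DyadicInterval}
    (hw : IntervalCode w J) (h : roundOf j w = some v) {y : ℝ} (hy : y ∈ J.toSet) :
    ∃ (c : ℝ) (hc : IsDyadic c), IntervalCode v (ballInterval j c hc) ∧
      |y - c| ≤ 3 / 16 * (1 / 2) ^ j := by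
  cases J with
  | whole =>
    obtain rfl : w = [] := hw
    rw [roundOf_nil] at h
    cases h
  | fin lo hi h1 h2 h3 =>
    obtain ⟨a, b, c, d, ha, hc, hb, hd, rfl, hr, hε⟩ := hw.exists_dyadicStr
    have hlt : dyadicVal c d < 1 / 2 ^ (j + 3) := by
      by_contra hlt
      rw [(roundOf_strPair ha hb hd).2 hlt] at h
      cases h
    rw [(roundOf_strPair ha hb hd).1 hlt] at h
    obtain rfl : roundPair j a b = v := by simpa using h
    refine ⟨_, _, intervalCode_roundPair hj ha b, ?_⟩
    -- The distance `3 / 16` is `1 / 8` for the old radius plus `1 / 16` for the truncation of the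
    -- center.
    have e1 := abs_dyadicVal_sub_truncBits (j + 3) a b
    have e2 : |y - dyadicVal a b| ≤ dyadicVal c d := by
      rw [hr, hε, abs_le]
      constructor <;> linarith [hy.1, hy.2]
    have e3 := abs_sub_le y (dyadicVal a b) (dyadicVal a (truncBits (j + 3) b))
    have e4 : (1 : ℝ) / 2 ^ (j + 3) = 1 / 8 * (1 / 2) ^ j := by
      rw [one_div_pow, pow_add]; field_simp; norm_num
    have e5 : (1 : ℝ) / 2 ^ (j + 3 + 1) = 1 / 16 * (1 / 2) ^ j := by
      rw [one_div_pow, add_assoc, pow_add]; field_simp; norm_num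
    linarith

/-- The radius is half the diameter, hence strictly below the threshold. This is how bounds on
diameters in the parameters guarantee progress. -/
theorem roundOf_ne_none {j : ℕ} {w : Str} {J : DyadicInterval} (hw : IntervalCode w J)
    (h : J.diam ≤ (((1 / 2 : ℝ) ^ (j + 3) : ℝ) : EReal)) : roundOf j w ≠ none := by
  cases J with
  | whole => exact absurd h (by simp [DyadicInterval.diam])
  | fin lo hi h1 h2 h3 =>
    have h' : hi - lo ≤ (1 / 2) ^ (j + 3) := EReal.coe_le_coe_iff.1 h
    obtain ⟨a, b, c, d, ha, hc, hb, hd, rfl, hr, hε⟩ := hw.exists_dyadicStr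
    rw [(roundOf_strPair ha hb hd).1]
    · simp
    · rw [hε, ← one_div_pow]
      have : (0 : ℝ) < (1 / 2) ^ (j + 3) := by positivity
      linarith

/-- The answer of the oracle is scanned and rounded. -/
theorem reach_round {m : Bool} {C : Reg → ℕ → MCell} {N j B : ℕ} (hj : 1 ≤ j)
    (hclk : C .clk = clkCells) (hemi : C (.emi m) = markCells j)
    (hcnt : C (.cnt m) = markCells j) {w : Str} {J : DyadicInterval} (hw : IntervalCode w J)
    (hans : C .ans = writeStr (M := evalMachine) w) {y : ℝ} (hy : y ∈ J.toSet)
    (hB : |y| + 1 ≤ 2 ^ B) :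
    (roundOf j w = none →
      Reach φ (6 * j + 40) (cfg (.scanCtl m false) C (home N)) (cfg .loop C (home N))) ∧
    (∀ v, roundOf j w = some v → ∃ (c : ℕ → MCell) (H : Reg → ℕ),
      Holds (M := evalMachine) c (dstPrefix m ++ v) ∧
      Reach φ (13 * j + 6 * B + 100) (cfg (.scanCtl m false) C (home N))
        (cfg (.rewind (if m then .call else .loop))
          (setMarks (Function.update C (.dst m) c) m (markCells (j + 1))) H) ∧
      H .inp = N ∧ H .clk = j + 4 ∧ ∀ x ≠ Reg.inp, H x ≤ H .clk) := by
  cases J with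
  | whole =>
    obtain rfl : w = [] := hw
    rw [roundOf_nil]
    exact ⟨fun _ => (reach_scan_nil hclk hans).mono (by omega), by simp⟩
  | fin lo hi h1 h2 h3 =>
    obtain ⟨a, b, c, d, ha, hc, hb, hd, rfl, hr, hε⟩ := hw.exists_dyadicStr
    have h0 : 0 < dyadicVal c d := by rw [hε]; linarith
    obtain ⟨hlt, hs⟩ | ⟨hlt, hs⟩ := reach_scan (φ := φ) (N := N) hclk hcnt hans hc h0
    · rw [(roundOf_strPair ha hb hd).1 hlt]
      refine ⟨by simp, ?_⟩
      intro v hv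
      obtain rfl : roundPair j a b = v := by simpa using hv
      obtain ⟨e, he, hE⟩ := reach_emit_all (φ := φ) (N := N) hj hclk hcnt hemi hans
      obtain ⟨H, hG, hinp, hHclk, hle⟩ := reach_grow (φ := φ) (m := m) (N := N)
        (C := Function.update C (.dst m) e) hj (by simpa using hemi) (by simpa using hcnt)
      refine ⟨e, H, he, ((hs.trans hE).trans hG).mono ?_, hinp, hHclk, hle⟩
      -- The center differs from `y` by less than 1, so its absolute value is at most `2 ^ B`.
      have hal : a.length ≤ B + 2 := by
        refine length_le_of_abs_dyadicVal_le (b := b) ha (le_trans ?_ hB)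
        have e1 : |dyadicVal a b - y| ≤ dyadicVal c d := by
          rw [hr, hε, abs_le]
          constructor <;> linarith [hy.1, hy.2]
        have e2 : (1 : ℝ) / 2 ^ (j + 3) ≤ 1 := by
          rw [div_le_one (by positivity)]
          exact one_le_pow₀ (by norm_num)
        have e3 := abs_add_le (dyadicVal a b - y) y
        rw [sub_add_cancel] at e3
        linarith
      omega
    · rw [(roundOf_strPair ha hb hd).2 hlt]
      exact ⟨fun _ => hs, by simp⟩

/-! ### The iteration -/

/-- The precisions reached so far for the argument and for the value, and the output. -/
structure Stage where
  argPrec : ℕ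
  valPrec : ℕ
  out : Str

/-- The stage after processing the first `N` intervals of the real argument. -/
noncomputable def stage (φ : StrFun) : ℕ → Stage
  | 0 => ⟨1, 1, []⟩
  | N + 1 =>
    let s := stage φ N
    match roundOf s.argPrec (φ (.one :: natCode N)) with
    | none => s
    | some v =>
      match roundOf s.valPrec (φ (.zero :: v)) with
      | none => ⟨s.argPrec + 1, s.valPrec, s.out⟩
      | some v' => ⟨s.argPrec + 1, s.valPrec + 1, v'⟩

theorem stage_succ_of_none {N : ℕ}
    (h : roundOf (stage φ N).argPrec (φ (.one :: natCode N)) = none) :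
    stage φ (N + 1) = stage φ N := by
  rw [stage, h]

theorem stage_succ_of_some_none {N : ℕ} {v : Str}
    (h : roundOf (stage φ N).argPrec (φ (.one :: natCode N)) = some v)
    (h' : roundOf (stage φ N).valPrec (φ (.zero :: v)) = none) :
    stage φ (N + 1) = ⟨(stage φ N).argPrec + 1, (stage φ N).valPrec, (stage φ N).out⟩ := by
  rw [stage, h]
  simp only [h']

theorem stage_succ_of_some_some {N : ℕ} {v v' : Str}
    (h : roundOf (stage φ N).argPrec (φ (.one :: natCode N)) = some v)
    (h' : roundOf (stage φ N).valPrec (φ (.zero :: v)) = some v') :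
    stage φ (N + 1) = ⟨(stage φ N).argPrec + 1, (stage φ N).valPrec + 1, v'⟩ := by
  rw [stage, h]
  simp only [h']

/-- One of the three cases of an iteration. -/
theorem stage_succ_cases (φ : StrFun) (N : ℕ) :
    stage φ (N + 1) = stage φ N ∨
    stage φ (N + 1) = ⟨(stage φ N).argPrec + 1, (stage φ N).valPrec, (stage φ N).out⟩ ∨
    ∃ v', stage φ (N + 1) = ⟨(stage φ N).argPrec + 1, (stage φ N).valPrec + 1, v'⟩ := by
  rcases h : roundOf (stage φ N).argPrec (φ (.one :: natCode N)) with _ | v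
  · exact .inl (stage_succ_of_none h)
  · rcases h' : roundOf (stage φ N).valPrec (φ (.zero :: v)) with _ | v'
    · exact .inr (.inl (stage_succ_of_some_none h h'))
    · exact .inr (.inr ⟨v', stage_succ_of_some_some h h'⟩)

/-- Precisions grow at most by one per iteration. The upper bounds make the cost of iteration `N`
linear in `N`, whatever the oracle answers. -/
theorem stage_prec (φ : StrFun) (N : ℕ) : 1 ≤ (stage φ N).argPrec ∧ 1 ≤ (stage φ N).valPrec ∧
    (stage φ N).argPrec ≤ N + 1 ∧ (stage φ N).valPrec ≤ N + 1 := by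
  induction N with
  | zero => exact ⟨le_rfl, le_rfl, le_rfl, le_rfl⟩
  | succ N ih =>
    rcases stage_succ_cases φ N with h | h | ⟨v', h⟩
    · rw [h]; omega
    · rw [h]; dsimp only; omega
    · rw [h]; dsimp only; omega

/-- The tapes represent a stage of the computation. -/
structure Represents (a : Str) (C : Reg → ℕ → MCell) (N : ℕ) (s : Stage) : Prop where
  inp : C .inp = writeStr (M := evalMachine) a
  clk : C .clk = clkCells
  num : C .num = writeStr (M := evalMachine) (.one :: natCode N)
  emi : ∀ m, C (.emi m) = markCells (if m then s.argPrec else s.valPrec)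
  cnt : ∀ m, C (.cnt m) = markCells (if m then s.argPrec else s.valPrec)
  out : Holds (M := evalMachine) (C (.dst false)) s.out

theorem update_writeStr (w : Str) (s : Sym) :
    Function.update (writeStr (M := evalMachine) w) w.length (some (.inl s)) =
      writeStr (M := evalMachine) (w ++ [s]) := by
  have h : ∀ u : Str, writeStr (M := evalMachine) u = put (fun _ => none) u := by
    intro u
    funext i
    simp only [writeStr, put]
    cases u[i]? <;> rfl
  rw [h, h, update_put]

/-- The number of the interval is copied to the query tape, and increased. -/
theorem reach_copy {C : Reg → ℕ → MCell} {N : ℕ} {u : Str}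
    (hnum : C .num = writeStr (M := evalMachine) u) :
    ∃ c, Holds (M := evalMachine) c u ∧
      Reach φ (u.length + 1) (cfg .copy C (home N)) (cfg (.rewind .call)
        (Function.update (Function.update C (.dst true) c) .num
          (writeStr (M := evalMachine) (u ++ [.zero])))
        (home N + u.length • dir [.num, .dst true, .clk])) := by
  have loop : ∀ k ≤ u.length, Reach φ k (cfg .copy C (home N)) (cfg .copy
      (Function.update C (.dst true) (put (C (.dst true)) (u.take k)))
      (home N + k • dir [.num, .dst true, .clk])) := by
    intro k
    induction k with
    | zero => intro _; simpa [put_nil] using Reach.refl _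
    | succ k ih =>
      intro hk
      refine (ih (by omega)).trans (T' := 1) ?_
      have h1 : Reach φ 1 (cfg .copy (Function.update C (.dst true)
          (put (C (.dst true)) (u.take k))) (home N + k • dir [.num, .dst true, .clk]))
          (cfg .copy _ _) :=
        .of_write (r := .dst true) (x := some (.inl u[k])) (l := [.num, .dst true, .clk]) (by
          have e : Function.update C (.dst true) (put (C (.dst true)) (u.take k)) .num
              ((home N + k • dir [.num, .dst true, .clk]) .num) = some (.inl u[k]) := by
            simp [hnum, home, dir, writeStr, List.getElem?_eq_getElem hk]
          simp only [table, e]) (by simp) (by simp)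
      have e : (home N + k • dir [.num, .dst true, .clk]) (.dst true) = (u.take k).length := by
        simp [home, dir]; omega
      rw [Function.update_self, Function.update_idem, e, update_put, List.take_append_getElem,
        add_assoc, ← succ_nsmul] at h1
      exact h1
  refine ⟨_, holds_update_put (C (.dst true)) u, (loop _ le_rfl).trans (T' := 1) ?_⟩
  rw [List.take_length]
  refine .of_step (step_cfg (w := fun r => match r with
        | .num => some (some (.inl .zero))
        | .dst true => some none
        | _ => none) (d := adv []) ?_ (by simp) (by simp) ?_ ?_)
  · have e : Function.update C (.dst true) (put (C (.dst true)) u) .num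
        ((home N + u.length • dir [.num, .dst true, .clk]) .num) = none := by
      simp [hnum, home, dir, writeStr]
    simp only [table, e]
  · funext r
    rcases r with _ | _ | _ | _ | m | m | m
    · rfl
    · rfl
    · rfl
    · rw [Function.update_self, ← update_writeStr, ← hnum]
      simp [writeTo, home, dir]
    · cases m
      · rfl
      · simp [writeTo, home, dir]
    · rfl
    · rfl
  · rw [apply_adv, dir_nil, add_zero]

/-- The oracle answers queries with intervals that contain the argument and the value. -/
structure Answers (φ : StrFun) (x y : ℝ) : Prop where
  arg : ∀ N, ∃ J, IntervalCode (φ (.one :: natCode N)) J ∧ x ∈ J.toSet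
  val : ∀ v K, IntervalCode v K → x ∈ K.toSet → ∃ J, IntervalCode (φ (.zero :: v)) J ∧ y ∈ J.toSet

theorem mem_ballInterval {j : ℕ} {c y : ℝ} (hc : IsDyadic c)
    (h : |y - c| ≤ 3 / 16 * (1 / 2) ^ j) : y ∈ (ballInterval j c hc).toSet := by
  have hp : (0 : ℝ) < (1 / 2) ^ j := by positivity
  have h2 := abs_le.1 (h.trans (by linarith : 3 / 16 * (1 / 2 : ℝ) ^ j ≤ (1 / 2) ^ j))
  rw [ballInterval_toSet, ← one_div_pow]
  constructor <;> linarith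

theorem natCode_succ (N : ℕ) : Sym.one :: natCode N ++ [.zero] = .one :: natCode (N + 1) := by
  simp [natCode, List.replicate_succ']

/-- One iteration of the machine. -/
theorem reach_iteration {a : Str} {C : Reg → ℕ → MCell} {N B : ℕ} {x y : ℝ}
    (hφ : Answers φ x y) (hx : |x| + 1 ≤ 2 ^ B) (hy : |y| + 1 ≤ 2 ^ B)
    (hC : Represents a C N (stage φ N)) (hN : N < a.length) :
    ∃ C', Represents a C' (N + 1) (stage φ (N + 1)) ∧
      Reach φ (40 * N + 12 * B + 400) (cfg .loop C (home N)) (cfg .loop C' (home (N + 1))) := by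
  obtain ⟨hj1, hj2, hj3, hj4⟩ := stage_prec φ N
  set s := stage φ N with hs
  -- the interval of the argument
  have h1 : Reach φ 1 (cfg .loop C (home N)) (cfg .copy C (home (N + 1))) := by
    have := Reach.of_adv (φ := φ) (s := .loop) (s' := .copy) (C := C) (H := home N) (l := [.inp])
      (by simp [table, hC.inp, home, writeStr, hN]) (by simp) (by simp)
    convert this using 2
    funext r
    simp only [home, Pi.add_apply, dir]
    cases r <;> simp
  obtain ⟨c, hc, h2⟩ := reach_copy (φ := φ) (N := N + 1) hC.num
  rw [natCode_succ] at h2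
  have hul : (Sym.one :: natCode N).length = N + 3 := by simp [natCode]
  rw [hul] at h2
  set C1 := Function.update (Function.update C (.dst true) c) .num
    (writeStr (M := evalMachine) (.one :: natCode (N + 1))) with hC1
  have h3 := reach_rewind_call (φ := φ) (C := C1) (q := .one :: natCode N)
    (H := home (N + 1) + (N + 3) • dir [.num, .dst true, .clk])
    (by simpa [hC1] using hC.clk) (by
      intro r hr
      simp only [Pi.add_apply, Pi.smul_apply, home, if_neg hr, smul_eq_mul, reduceCtorEq, if_false]
      have := dir_le_clk (l := [.num, .dst true, .clk]) (by simp) r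
      gcongr) (by simpa [hC1] using hc)
  have e1 : (home (N + 1) + (N + 3) • dir [.num, .dst true, .clk]) .clk = N + 3 := by
    simp [home, dir]
  have e2 : (home (N + 1) + (N + 3) • dir [.num, .dst true, .clk]) .inp = N + 1 := by
    simp [home, dir]
  rw [e1, e2] at h3
  simp only [List.getElem?_cons_zero, decide_true] at h3
  set C2 := Function.update C1 .ans (writeStr (M := evalMachine) (φ (.one :: natCode N))) with hC2
  have h4 := (h1.trans h2).trans h3
  obtain ⟨J, hJ, hxJ⟩ := hφ.arg N
  obtain ⟨hnone, hsome⟩ := reach_round (φ := φ) (m := true) (C := C2) (N := N + 1)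
    (j := s.argPrec) (B := B) hj1 (by simpa [hC2, hC1] using hC.clk)
    (by simpa [hC2, hC1] using hC.emi true) (by simpa [hC2, hC1] using hC.cnt true) hJ
    (by simp [hC2]) hxJ hx
  rcases hv : roundOf s.argPrec (φ (.one :: natCode N)) with _ | v
  · refine ⟨C2, ?_, (h4.trans (hnone hv)).mono (by omega)⟩
    rw [stage_succ_of_none hv]
    exact ⟨by simpa [hC2, hC1] using hC.inp, by simpa [hC2, hC1] using hC.clk,
      by simp [hC2, hC1], by simpa [hC2, hC1] using hC.emi, by simpa [hC2, hC1] using hC.cnt,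
      by simpa [hC2, hC1] using hC.out⟩
  -- the interval of the value
  obtain ⟨q, H, hq, h5, hHinp, hHclk, hHle⟩ := hsome v hv
  set C3 := setMarks (Function.update C2 (.dst true) q) true (markCells (s.argPrec + 1)) with hC3
  have h6 := reach_rewind_call (φ := φ) (C := C3) (q := .zero :: v) (H := H)
    (by simpa [hC3, hC2, hC1, setMarks] using hC.clk) hHle
    (by simpa [hC3, setMarks, dstPrefix] using hq)
  rw [hHclk, hHinp] at h6
  simp only [List.getElem?_cons_zero, Option.some.injEq, reduceCtorEq, decide_false] at h6
  simp only [if_true] at h5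
  set C4 := Function.update C3 .ans (writeStr (M := evalMachine) (φ (.zero :: v))) with hC4
  have h7 := (h4.trans h5).trans h6
  obtain ⟨c₁, hc₁, hcode, hdist⟩ := roundOf_eq_some hj1 hJ hv hxJ
  -- The rounded interval still contains `x`, so the answer about the function contains `y`.
  obtain ⟨K, hK, hyK⟩ := hφ.val _ _ hcode (mem_ballInterval hc₁ hdist)
  have r1 : C4 .clk = clkCells := by simpa [hC4, hC3, hC2, hC1, setMarks] using hC.clk
  have r2 : C4 .inp = writeStr (M := evalMachine) a := by
    simpa [hC4, hC3, hC2, hC1, setMarks] using hC.inp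
  have r3 : C4 .num = writeStr (M := evalMachine) (.one :: natCode (N + 1)) := by
    simp [hC4, hC3, hC2, hC1, setMarks]
  have r4 : C4 (.emi true) = markCells (s.argPrec + 1) := by simp [hC4, hC3, setMarks]
  have r5 : C4 (.cnt true) = markCells (s.argPrec + 1) := by simp [hC4, hC3, setMarks]
  have r6 : C4 (.emi false) = markCells s.valPrec := by
    simpa [hC4, hC3, hC2, hC1, setMarks] using hC.emi false
  have r7 : C4 (.cnt false) = markCells s.valPrec := by
    simpa [hC4, hC3, hC2, hC1, setMarks] using hC.cnt false
  have r8 : C4 (.dst false) = C (.dst false) := by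
    simp [hC4, hC3, hC2, hC1, setMarks]
  obtain ⟨hnone', hsome'⟩ := reach_round (φ := φ) (m := false) (C := C4) (N := N + 1)
    (j := s.valPrec) (B := B) hj2 r1 r6 r7 hK (by simp [hC4]) hyK hy
  rcases hv' : roundOf s.valPrec (φ (.zero :: v)) with _ | v'
  · refine ⟨C4, ?_, (h7.trans (hnone' hv')).mono (by omega)⟩
    rw [stage_succ_of_some_none hv hv']
    refine ⟨r2, r1, r3, ?_, ?_, r8 ▸ hC.out⟩
    · rintro (_ | _) <;> simp [r4, r6, hs]
    · rintro (_ | _) <;> simp [r5, r7, hs]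
  · obtain ⟨q', H', hq', h8, hHinp', hHclk', hHle'⟩ := hsome' v' hv'
    simp only [Bool.false_eq_true, if_false] at h8
    have h9 := reach_rewind (φ := φ) (r := .loop) (H := H') (C :=
      setMarks (Function.update C4 (.dst false) q') false (markCells (s.valPrec + 1)))
      (by simpa [setMarks] using r1) (by simp) hHle'
    rw [hHinp', hHclk'] at h9
    refine ⟨_, ?_, ((h7.trans h8).trans h9).mono (by omega)⟩
    rw [stage_succ_of_some_some hv hv']
    refine ⟨by simpa [setMarks] using r2, by simpa [setMarks] using r1,
      by simpa [setMarks] using r3, ?_, ?_, by simpa [setMarks, dstPrefix] using hq'⟩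
    · rintro (_ | _) <;> simp [setMarks, r4, hs]
    · rintro (_ | _) <;> simp [setMarks, r5, hs]

/-! ### The whole computation -/

/-- The tapes after the first `k` steps. -/
def startCells (a : Str) (k : ℕ) : Reg → ℕ → MCell
  | .inp => writeStr (M := evalMachine) a
  | .clk => if k = 0 then fun _ => none else clkCells
  | .num => writeStr (M := evalMachine) ([Sym.one, .zero, .one].take k)
  | .emi _ => fun i => if i < k then markCells 1 i else none
  | .cnt _ => fun i => if i < k then markCells 1 i else none
  | _ => fun _ => none

theorem init_eq (a : Str) : evalMachine.init a = cfg (.start 0) (startCells a 0) (home 0) := by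
  rw [OracleMachine.init, cfg]
  congr 1
  · funext t
    rcases t with _ | _ | _ | _ | i
    · rfl
    · rfl
    · rfl
    · rfl
    · fin_cases i <;> rfl
  · funext t
    simp [home]

/-- For precision 1 there are exactly four marks, one for each of the four initial steps. The empty
output tape already holds the code of the infinite interval. -/
theorem reach_start (a : Str) : ∃ C, Represents a C 0 (stage φ 0) ∧
    Reach φ 9 (evalMachine.init a) (cfg .loop C (home 0)) := by
  set l : List Reg := [.clk, .num, .emi true, .emi false, .cnt true, .cnt false] with hl
  have mark : ∀ (k : Fin 4) (i h : ℕ), h = k → Function.update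
      (fun i => if i < (k : ℕ) then markCells 1 i else none) h (some (.inr (startMark k))) i =
      if i < (k : ℕ) + 1 then markCells 1 i else none := by
    rintro k i _ rfl
    rw [Function.update_apply]
    split_ifs with h1 h2 h3 h4
    · subst h1
      fin_cases k <;> rfl
    · omega
    · rfl
    · omega
    · omega
    · rfl
  have full : (fun i => if i < 4 then markCells 1 i else none) = markCells 1 := by
    funext i
    split_ifs with h
    · rfl
    · simp only [markCells, markAt]
      split_ifs <;> first | omega | rfl
  have st : ∀ k : Fin 4, Reach φ 1 (cfg (.start k) (startCells a k) (home 0 + (k : ℕ) • dir l))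
      (cfg (if k = 3 then .rewind .loop else .start (k + 1)) (startCells a (k + 1))
        (home 0 + ((k : ℕ) + 1) • dir l)) := by
    intro k
    refine .of_step (step_cfg rfl (by simp) (by split_ifs <;> simp) ?_ ?_)
    · funext r i
      rcases r with _ | _ | _ | _ | m | m | m
      · rfl
      · rfl
      · fin_cases k <;> simp [writeTo, startCells, home, dir, hl, Function.update_apply, clkCells]
      · fin_cases k
        · rcases i with _ | i <;> simp [writeTo, startCells, home, hl, writeStr]
        · rcases i with _ | _ | i <;> simp [writeTo, startCells, home, dir, hl, writeStr]
        · rcases i with _ | _ | _ | i <;> simp [writeTo, startCells, home, dir, hl, writeStr]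
        · simp [writeTo, startCells]
      · rfl
      · exact mark k i _ (by cases m <;> simp [home, dir, hl])
      · exact mark k i _ (by cases m <;> simp [home, dir, hl])
    · rw [apply_adv, add_assoc, ← succ_nsmul]
  rw [init_eq]
  refine ⟨startCells a 4, ?_, ?_⟩
  · refine ⟨rfl, rfl, rfl, ?_, ?_, ?_⟩
    · rintro (_ | _) <;> exact full
    · rintro (_ | _) <;> exact full
    · exact ⟨by simp [stage], by simp [startCells]⟩
  · have h0 := st 0
    have h1 := st 1
    have h2 := st 2
    have h3 := st 3
    have h4 := reach_rewind (φ := φ) (C := startCells a 4) rfl (r := .loop) (by simp)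
      (H := home 0 + 4 • dir l) ?_
    · have e1 : (home 0 + 4 • dir l) .clk = 4 := by simp [home, dir, hl]
      have e2 : (home 0 + 4 • dir l) .inp = 0 := by simp [home, dir, hl]
      rw [e1, e2] at h4
      have h5 := (((h0.trans h1).trans h2).trans h3).trans h4
      simpa [Ret.label] using h5
    · intro r hr
      simp only [Pi.add_apply, Pi.smul_apply, home, ite_self, zero_add, smul_eq_mul]
      have := dir_le_clk (l := l) (by simp [hl]) r
      gcongr

theorem reach_all {a : Str} {B : ℕ} {x y : ℝ}
    (hφ : Answers φ x y) (hx : |x| + 1 ≤ 2 ^ B) (hy : |y| + 1 ≤ 2 ^ B) :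
    ∃ (C : Reg → ℕ → MCell) (H : Reg → ℕ),
      Holds (M := evalMachine) (C (.dst false)) (stage φ a.length).out ∧
      Reach φ (10 + a.length * (40 * a.length + 12 * B + 400)) (evalMachine.init a)
        (cfg .halt C H) := by
  have loop : ∀ N ≤ a.length, ∃ C, Represents a C N (stage φ N) ∧
      Reach φ (9 + N * (40 * a.length + 12 * B + 400)) (evalMachine.init a)
        (cfg .loop C (home N)) := by
    intro N
    induction N with
    | zero =>
      intro _
      simpa using reach_start (φ := φ) a
    | succ N ih =>
      intro hN
      obtain ⟨C, hC, h⟩ := ih (by omega)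
      obtain ⟨C', hC', h'⟩ := reach_iteration hφ hx hy hC (by omega)
      refine ⟨C', hC', (h.trans h').mono ?_⟩
      rw [add_mul, one_mul]
      omega
  obtain ⟨C, hC, h⟩ := loop _ le_rfl
  refine ⟨C, home a.length, hC.out, (h.trans (T' := 1) ?_).mono (by omega)⟩
  have := Reach.of_adv (φ := φ) (s := .loop) (s' := .halt) (C := C) (H := home a.length) (l := [])
    (by simp [table, hC.inp, home, writeStr]) (by simp) (by simp)
  simpa [dir_nil] using this

/-! ### The computed function -/

/-- The result is read off at a halting time selected by choice; since the machine rests after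
halting, the selection does not matter. -/
theorem run_eq_of_halt {a : Str} {t t' : ℕ} (h : (evalMachine.run φ a t).state = .halt)
    (h' : (evalMachine.run φ a t').state = .halt) :
    evalMachine.run φ a t = evalMachine.run φ a t' := by
  have key : ∀ {t t' : ℕ}, t ≤ t' → (evalMachine.run φ a t).state = .halt →
      evalMachine.run φ a t = evalMachine.run φ a t' := by
    intro t t' htt h
    obtain ⟨d, rfl⟩ := Nat.exists_eq_add_of_le htt
    induction d with
    | zero => rfl
    | succ d ih =>
      have ih := ih (by omega)
      rw [ih] at h
      have e : evalMachine.run φ a (t + (d + 1)) = step φ (evalMachine.run φ a (t + d)) := by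
        simp only [OracleMachine.run]
        rw [← add_assoc, Function.iterate_succ_apply']
      rw [e, step, if_pos (show (evalMachine.run φ a (t + d)).state = evalMachine.halt from h), ih]
  rcases le_total t t' with h1 | h1
  · exact key h1 h
  · exact (key h1 h').symm

/-- The computed function maps strings of length `N` to the output after `N` iterations. -/
noncomputable def evalFun (φ : StrFun) : StrFun := fun a => (stage φ a.length).out

theorem mem_operator {B : ℕ} {x y : ℝ} (hφ : Answers φ x y) (hx : |x| + 1 ≤ 2 ^ B)
    (hy : |y| + 1 ≤ 2 ^ B) {ψ : StrFun} : ψ ∈ evalMachine.operator φ ↔ ψ = evalFun φ := by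
  have hres : ∀ a, ∃ h : (evalMachine.result φ a).Dom,
      (evalMachine.result φ a).get h = evalFun φ a := by
    intro a
    obtain ⟨C, H, hC, t, -, ht⟩ := reach_all (a := a) hφ hx hy
    have hh : (evalMachine.run φ a t).state = .halt := by
      rw [OracleMachine.run, ht]; rfl
    refine ⟨⟨t, hh⟩, ?_⟩
    have hd : ∃ t, (evalMachine.run φ a t).state = evalMachine.halt := ⟨t, hh⟩
    have e : evalMachine.run φ a hd.choose = cfg .halt C H := by
      rw [run_eq_of_halt hd.choose_spec hh, OracleMachine.run, ht]
    change readStr ((evalMachine.run φ a hd.choose).cells .output) = _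
    rw [e]
    exact readStr_eq hC
  constructor
  · rintro ⟨h, rfl⟩
    funext a
    obtain ⟨_, h2⟩ := hres a
    exact h2
  · rintro rfl
    refine ⟨fun a => (hres a).1, ?_⟩
    funext a
    exact (hres a).2

theorem time_le {a : Str} {B : ℕ} {x y : ℝ} (hφ : Answers φ x y) (hx : |x| + 1 ≤ 2 ^ B)
    (hy : |y| + 1 ≤ 2 ^ B) : evalMachine.time φ a ≤
      ((10 + a.length * (40 * a.length + 12 * B + 400) : ℕ) : ℕ∞) := by
  obtain ⟨C, H, -, t, hT, ht⟩ := reach_all (a := a) hφ hx hy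
  have hh : (evalMachine.run φ a t).state = evalMachine.halt := by
    rw [OracleMachine.run, ht]; rfl
  refine (iInf_le _ (⟨t, hh⟩ : {t : ℕ // (evalMachine.run φ a t).state = evalMachine.halt})).trans ?_
  exact_mod_cast hT

/-! ### The output is a name of the value -/

/-- The output of a stage is undefined, or well centered around the value. -/
def Stage.Sound (s : Stage) (y : ℝ) : Prop :=
  (s.valPrec = 1 ∧ s.out = []) ∨ ∃ (j : ℕ) (c : ℝ) (hc : IsDyadic c), s.valPrec = j + 1 ∧
    IntervalCode s.out (ballInterval j c hc) ∧ |y - c| ≤ 3 / 16 * (1 / 2) ^ j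

/-- For correctness of the output only the value matters: an iteration keeps the output, or replaces
it by a rounding at the old precision, which is then increased. -/
theorem stage_step {x y : ℝ} (hφ : Answers φ x y) (N : ℕ) :
    ((stage φ (N + 1)).valPrec = (stage φ N).valPrec ∧ (stage φ (N + 1)).out = (stage φ N).out) ∨
    ∃ (c : ℝ) (hc : IsDyadic c), (stage φ (N + 1)).valPrec = (stage φ N).valPrec + 1 ∧
      IntervalCode (stage φ (N + 1)).out (ballInterval (stage φ N).valPrec c hc) ∧
      |y - c| ≤ 3 / 16 * (1 / 2) ^ (stage φ N).valPrec := by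
  obtain ⟨hj1, hj2, -, -⟩ := stage_prec φ N
  obtain ⟨J, hJ, hxJ⟩ := hφ.arg N
  rcases hv : roundOf (stage φ N).argPrec (φ (.one :: natCode N)) with _ | v
  · rw [stage_succ_of_none hv]
    exact .inl ⟨rfl, rfl⟩
  · obtain ⟨c₁, hc₁, hcode, hdist⟩ := roundOf_eq_some hj1 hJ hv hxJ
    obtain ⟨K, hK, hyK⟩ := hφ.val _ _ hcode (mem_ballInterval hc₁ hdist)
    rcases hv' : roundOf (stage φ N).valPrec (φ (.zero :: v)) with _ | v'
    · rw [stage_succ_of_some_none hv hv']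
      exact .inl ⟨rfl, rfl⟩
    · rw [stage_succ_of_some_some hv hv']
      obtain ⟨c, hc, h1, h2⟩ := roundOf_eq_some hj2 hK hv' hyK
      exact .inr ⟨c, hc, rfl, h1, h2⟩

theorem stage_sound {x y : ℝ} (hφ : Answers φ x y) (N : ℕ) : (stage φ N).Sound y := by
  induction N with
  | zero => exact .inl ⟨rfl, rfl⟩
  | succ N ih =>
    rcases stage_step hφ N with ⟨h1, h2⟩ | ⟨c, hc, h1, h2, h3⟩
    · simpa only [Stage.Sound, h1, h2] using ih
    · exact .inr ⟨_, c, hc, h1, h2, h3⟩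

theorem valPrec_mono {x y : ℝ} (hφ : Answers φ x y) : Monotone fun N => (stage φ N).valPrec := by
  refine monotone_nat_of_le_succ fun N => ?_
  rcases stage_step hφ N with ⟨h1, -⟩ | ⟨c, hc, h1, -, -⟩ <;> rw [h1]
  omega

/-- The intervals that the machine puts out. -/
theorem exists_outputs {x y : ℝ} (hφ : Answers φ x y) :
    ∃ D : ℕ → DyadicInterval, (∀ N, IntervalCode (stage φ N).out (D N)) ∧
      (∀ N, (D (N + 1)).toSet ⊆ (D N).toSet) ∧ (∀ N, y ∈ (D N).toSet) ∧
      ∀ N k, k + 2 ≤ (stage φ N).valPrec → (D N).diam ≤ (((1 / 2 : ℝ) ^ k : ℝ) : EReal) := by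
  have hex : ∀ N, ∃ J, IntervalCode (stage φ N).out J := by
    intro N
    obtain ⟨-, h⟩ | ⟨j, c, hc, -, h, -⟩ := stage_sound hφ N
    · exact ⟨.whole, h⟩
    · exact ⟨_, h⟩
  choose D hD using hex
  refine ⟨D, hD, fun N => ?_, fun N => ?_, fun N k hk => ?_⟩
  · rcases stage_step hφ N with ⟨-, h⟩ | ⟨c, hc, -, h2, h3⟩
    · rw [(hD (N + 1)).unique (h ▸ hD N)]
    · obtain ⟨-, h⟩ | ⟨j, c', hc', h1', h2', h3'⟩ := stage_sound hφ N
      · rw [(hD N).unique (K := .whole) h]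
        exact Set.subset_univ _
      · rw [(hD N).unique h2', (hD (N + 1)).unique h2, ballInterval_toSet, ballInterval_toSet, h1',
          ← one_div_pow, ← one_div_pow]
        rw [h1'] at h3
        have hp : (0 : ℝ) < (1 / 2) ^ j := by positivity
        have e : (1 / 2 : ℝ) ^ (j + 1) = 1 / 2 * (1 / 2) ^ j := by rw [pow_succ]; ring
        rw [e] at h3 ⊢
        have h4 := abs_le.1 h3
        have h5 := abs_le.1 h3'
        -- In units of the old radius, the new radius is `1 / 2` and the centers differ by at most
        -- `3 / 16 + 3 / 32`, which leaves room to spare.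
        exact Set.Icc_subset_Icc (by linarith) (by linarith)
  · obtain ⟨-, h⟩ | ⟨j, c, hc, h1, h2, h3⟩ := stage_sound hφ N
    · rw [(hD N).unique (K := .whole) h]
      exact Set.mem_univ _
    · rw [(hD N).unique h2]
      exact mem_ballInterval hc h3
  · obtain ⟨h1, -⟩ | ⟨j, c, hc, h1, h2, h3⟩ := stage_sound hφ N
    · omega
    · rw [(hD N).unique h2, ballInterval_diam, EReal.coe_le_coe_iff]
      calc 2 * (1 / 2 : ℝ) ^ j ≤ 2 * (1 / 2) ^ (k + 1) := by
            gcongr 2 * ?_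
            exact pow_le_pow_of_le_one (by norm_num) (by norm_num) (by omega)
        _ = _ := by rw [pow_succ]; ring

/-- The precision of the output after sufficiently many iterations. -/
theorem le_valPrec {x y : ℝ} (hφ : Answers φ x y) {n K N₀ : ℕ}
    (hval : ∀ v J, IntervalCode v J → x ∈ J.toSet → J.diam ≤ (((1 / 2 : ℝ) ^ K : ℝ) : EReal) →
      ∃ J', IntervalCode (φ (.zero :: v)) J' ∧
        J'.diam ≤ (((1 / 2 : ℝ) ^ (n + 5) : ℝ) : EReal))
    (harg : ∀ N ≥ N₀, ∃ J, IntervalCode (φ (.one :: natCode N)) J ∧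
      J.diam ≤ (((1 / 2 : ℝ) ^ (K + n + 5) : ℝ) : EReal)) :
    n + 2 ≤ (stage φ (N₀ + K + n + 1)).valPrec := by
  have mono : ∀ {J : DyadicInterval} {p q : ℕ}, q ≤ p →
      J.diam ≤ (((1 / 2 : ℝ) ^ p : ℝ) : EReal) → J.diam ≤ (((1 / 2 : ℝ) ^ q : ℝ) : EReal) :=
    fun hpq h => h.trans (EReal.coe_le_coe_iff.2
      (pow_le_pow_of_le_one (by norm_num) (by norm_num) hpq))
  -- The precision of the value lags behind that of the argument by at most `K`, until it has passed
  -- `n + 2`.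
  have hA : ∀ N, n + 3 ≤ (stage φ N).valPrec ∨
      (stage φ N).argPrec ≤ K + (stage φ N).valPrec := by
    intro N
    induction N with
    | zero => exact .inr (by simp [stage])
    | succ N ih =>
      obtain ⟨hj1, hj2, -, -⟩ := stage_prec φ N
      obtain ⟨J, hJ, hxJ⟩ := hφ.arg N
      rcases hv : roundOf (stage φ N).argPrec (φ (.one :: natCode N)) with _ | v
      · rwa [stage_succ_of_none hv]
      · obtain ⟨c₁, hc₁, hcode, hdist⟩ := roundOf_eq_some hj1 hJ hv hxJ
        rcases hv' : roundOf (stage φ N).valPrec (φ (.zero :: v)) with _ | v'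
        · rw [stage_succ_of_some_none hv hv']
          dsimp only
          by_cases hK : (stage φ N).argPrec ≤ K
          · right; omega
          · left
            by_contra hlt
            -- For argument precision above `K` the query has diameter at most `2 ^ (-K)`. The
            -- answer is then fine enough for every value precision up to `n + 2`, against the
            -- assumed failure.
            obtain ⟨J', hJ', hd⟩ := hval _ _ hcode (mem_ballInterval hc₁ hdist) (by
              rw [ballInterval_diam, EReal.coe_le_coe_iff]
              calc 2 * (1 / 2 : ℝ) ^ (stage φ N).argPrec ≤ 2 * (1 / 2) ^ (K + 1) := by
                    gcongr 2 * ?_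
                    exact pow_le_pow_of_le_one (by norm_num) (by norm_num) (by omega)
                _ = _ := by rw [pow_succ]; ring)
            exact roundOf_ne_none hJ' (mono (by omega) hd) hv'
        · rw [stage_succ_of_some_some hv hv']
          dsimp only
          omega
  -- From `N₀` on no rounding of the argument fails while its precision is at most `K + n + 2`. No
  -- progress before `N₀` is assumed.
  have hB : ∀ t, min (K + n + 2) (t + 1) ≤ (stage φ (N₀ + t)).argPrec := by
    intro t
    induction t with
    | zero =>
      have := (stage_prec φ N₀).1
      simp only [add_zero]
      omega
    | succ t ih =>
      obtain ⟨J, hJ, hd⟩ := harg (N₀ + t) (by omega)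
      have hs : (stage φ (N₀ + t)).argPrec ≤ (stage φ (N₀ + t + 1)).argPrec := by
        rcases stage_succ_cases φ (N₀ + t) with h | h | ⟨v', h⟩ <;> rw [h]
        all_goals exact Nat.le_succ _
      rw [← add_assoc]
      by_cases hlt : (stage φ (N₀ + t)).argPrec ≤ K + n + 2
      · have hne := roundOf_ne_none hJ (j := (stage φ (N₀ + t)).argPrec) (mono (by omega) hd)
        obtain ⟨v, hv⟩ := Option.ne_none_iff_exists'.1 hne
        have : (stage φ (N₀ + t + 1)).argPrec = (stage φ (N₀ + t)).argPrec + 1 := by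
          rcases hv' : roundOf (stage φ (N₀ + t)).valPrec (φ (.zero :: v)) with _ | v'
          · rw [stage_succ_of_some_none hv hv']
          · rw [stage_succ_of_some_some hv hv']
        omega
      · omega
  have h1 := hA (N₀ + K + n + 1)
  have h2 := hB (K + n + 1)
  rw [show N₀ + (K + n + 1) = N₀ + K + n + 1 by ring] at h2
  omega

/-! ### Names of functions and arguments -/

/-- Any interval around `x` can be the first term of a name of `x`. So the condition on names also
governs single intervals such as the rounded ones, which need not come from the given name. -/
theorem IsIntervalFun.mem {Ψ : DyadicInterval → DyadicInterval} {f : C(unitInterval, ℝ)}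
    (h : IsIntervalFun Ψ f) {J : DyadicInterval} {x : unitInterval} (hx : (x : ℝ) ∈ J.toSet) :
    f x ∈ (Ψ J).toSet := by
  obtain ⟨D, hD, hDJ, -⟩ := exists_intervalName J hx
  exact (h _ x (hD.cons (hDJ 0))).mem 0

theorem answers_pairFun {ψ ρ : StrFun} {Ψ : DyadicInterval → DyadicInterval}
    {f : C(unitInterval, ℝ)} {x : unitInterval} {J : ℕ → DyadicInterval} (hψ : Tracks ψ Ψ)
    (hΨ : IsIntervalFun Ψ f) (hρ : ∀ n, IntervalCode (ρ (natCode n)) (J n))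
    (hJ : IsIntervalName J x) : Answers (pairFun ψ ρ) x (f x) where
  arg N := ⟨J N, hρ N, hJ.mem N⟩
  val v K hv hx := ⟨Ψ K, hψ v K hv, hΨ.mem hx⟩

theorem le_two_pow_ceil_logb {r : ℝ} (hr : 0 ≤ r) {B : ℕ} (h : ⌈Real.logb 2 (r + 1)⌉₊ ≤ B) :
    r + 1 ≤ 2 ^ B := by
  have h1 : Real.logb 2 (r + 1) ≤ B := Nat.ceil_le.1 h
  rw [Real.logb_le_iff_le_rpow (by norm_num) (by linarith)] at h1
  exact_mod_cast h1

/-- What a name of a function and an argument and its parameter tell. -/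
theorem exists_of_dom
    (φ : (intervalFunctions.prod (intervalReals.restrict unitInterval)).rep.Dom) :
    ∃ (f : C(unitInterval, ℝ)) (x : unitInterval),
      (f, x) ∈ (intervalFunctions.prod (intervalReals.restrict unitInterval)).rep φ ∧
      Answers φ x (f x) ∧
      (∀ l, l = (intervalFunctions.prod (intervalReals.restrict unitInterval)).param φ →
        |(x : ℝ)| + 1 ≤ 2 ^ l 0 ∧ |f x| + 1 ≤ 2 ^ l 0 ∧
        ⌈Real.logb 2 (|f x| + 1)⌉₊ ≤ l 0 ∧
        ∀ n, n + 2 ≤ (stage φ (l (l (n + 5) + n + 5) + l (n + 5) + n + 1)).valPrec) := by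
  obtain ⟨φ, hφ⟩ := φ
  obtain ⟨⟨f, x⟩, hfx⟩ := Part.dom_iff_mem.1 hφ
  have hpair := (mem_graphFun (IsPairName.unique _ _) _ _).1 hfx
  obtain ⟨ψ, ρ, rfl, h1, h2⟩ := hpair
  have h1' := (mem_graphFun IsFunName.unique _ _).1 h1
  have h2' := (mem_graphFun IsRealName.unique _ _).1 ((mem_graphFun
    (R := fun φ (x : unitInterval) => (x : ℝ) ∈ intervalReals.rep φ)
    (fun _ _ _ hx hy => Subtype.ext (Part.mem_unique hx hy)) _ _).1 h2)
  obtain ⟨Ψ, hψ, hΨ⟩ := h1'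
  obtain ⟨J, hρ, hJ⟩ := h2'
  have hans := answers_pairFun hψ hΨ hρ hJ
  refine ⟨f, x, hfx, hans, ?_⟩
  rintro l hl
  have hlmono : Monotone l := by
    rw [hl]
    exact (intervalFunctions.prod (intervalReals.restrict unitInterval)).param_mono _
  have hψD : ψ ∈ intervalFunctions.rep.Dom := Part.dom_iff_mem.2 ⟨_, h1⟩
  have hρD : ρ ∈ (intervalReals.restrict unitInterval).rep.Dom := Part.dom_iff_mem.2 ⟨_, h2⟩
  have hρD' : ρ ∈ intervalReals.rep.Dom := hρD.choose_spec.1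
  have hl1 : ∀ k, intervalFunctions.param ⟨ψ, hψD⟩ k ≤ l k := fun k => by
    rw [hl]
    exact le_max_left _ _
  have hl2 : ∀ k, intervalReals.param ⟨ρ, hρD'⟩ k ≤ l k := fun k => by
    rw [hl]
    exact le_max_right _ _
  have hf : (graphFun IsFunName).fn ψ hψD = f :=
    Part.mem_unique ⟨hψD, rfl⟩ h1
  have hx : (graphFun IsRealName).fn ρ hρD' = x :=
    IsRealName.unique _ _ _ ((mem_graphFun IsRealName.unique _ _).1 ⟨hρD', rfl⟩) ⟨J, hρ, hJ⟩
  simp only [intervalFunctions, hf] at hl1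
  simp only [intervalReals, hx] at hl2
  have hfx' : |f x| ≤ ‖f‖ := f.norm_coe_le_norm x
  have hc : ⌈Real.logb 2 (|f x| + 1)⌉₊ ≤ l 0 := by
    -- The size of the value is controlled by the norm of `f`, which is part of the parameter of the
    -- function at every index, in particular at 0.
    refine le_trans (Nat.ceil_mono ?_) ((Nat.le_add_right _ _).trans (hl1 0))
    exact Real.logb_le_logb_of_le (by norm_num) (by positivity) (by linarith)
  refine ⟨le_two_pow_ceil_logb (abs_nonneg _) ((Nat.le_add_left _ _).trans (hl2 0)),
    le_two_pow_ceil_logb (abs_nonneg _) hc, hc, fun n => ?_⟩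
  -- the modulus of the function
  set S := {N : ℕ | ∃ Ψ, Tracks ψ Ψ ∧ ∀ J : DyadicInterval,
        (J.toSet ∩ Set.Icc 0 1).Nonempty → J.diam ≤ (((1 / 2 : ℝ) ^ N : ℝ) : EReal) →
          (Ψ J).diam ≤ (((1 / 2 : ℝ) ^ (n + 5) : ℝ) : EReal)} with hS
  have hSne : S.Nonempty := by
    obtain ⟨N, hN⟩ := hΨ.exists_modulus (n + 5)
    exact ⟨N, Ψ, hψ, hN⟩
  obtain ⟨Ψ', hΨ', hmod⟩ := Nat.sInf_mem hSne
  obtain rfl := hΨ'.unique hψ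
  set K := sInf S with hK
  have hKl : K ≤ l (n + 5) := (Nat.le_add_left _ _).trans (hl1 (n + 5))
  -- the rate of convergence of the argument
  set R := {N : ℕ | ∃ J, IntervalCode (ρ (natCode N)) J ∧
        J.diam ≤ (((1 / 2 : ℝ) ^ (K + n + 5) : ℝ) : EReal)} with hR
  have hRne : R.Nonempty := by
    obtain ⟨N, hN⟩ := hJ.exists_diam_le (K + n + 5)
    exact ⟨N, J N, hρ N, hN⟩
  obtain ⟨J', hJ', hd⟩ := Nat.sInf_mem hRne
  obtain rfl := hJ'.unique (hρ _)
  set N₀ := sInf R with hN₀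
  -- Here the function argument is nested: the accuracy needed for the argument depends on the
  -- modulus of the function. Monotonicity of `l` allows `K` to be replaced by its bound.
  have hN₀l : N₀ ≤ l (l (n + 5) + n + 5) :=
    ((Nat.le_add_right _ _).trans (hl2 (K + n + 5))).trans (hlmono (by omega))
  refine (le_valPrec (n := n) (K := K) (N₀ := N₀) hans ?_ ?_).trans
    (valPrec_mono hans (by omega))
  · intro v D hv hxD hdD
    exact ⟨_, hψ v D hv, hmod D ⟨x, hxD, x.2⟩ hdD⟩
  -- The intervals of the argument are nested, so the bound at `N₀` persists.
  · intro N hN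
    exact ⟨J N, hρ N, (DyadicInterval.diam_mono (hJ.anti hN)).trans hd⟩

theorem mem_rep_evalFun {x y : ℝ} (hφ : Answers φ x y)
    (h : ∀ n, ∃ N, n + 2 ≤ (stage φ N).valPrec) : y ∈ intervalReals.rep (evalFun φ) := by
  obtain ⟨D, hD, hsub, hy, hdiam⟩ := exists_outputs hφ
  -- The code of `2 ^ n` has length `n + 2`, and the output depends on the length of the input only.
  refine (mem_graphFun IsRealName.unique _ _).2 ⟨fun n => D (n + 2), fun n => ?_, fun n => hsub _,
    Set.eq_singleton_iff_unique_mem.2 ⟨Set.mem_iInter.2 fun n => hy _, fun z hz => ?_⟩⟩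
  · have := hD (n + 2)
    simpa [evalFun, natCode] using this
  · by_contra hne
    have hpos : 0 < |z - y| := abs_pos.2 (sub_ne_zero.2 hne)
    obtain ⟨n, hn⟩ := exists_pow_lt_of_lt_one hpos (by norm_num : (1 / 2 : ℝ) < 1)
    obtain ⟨N, hN⟩ := h n
    have h1 := hdiam (N + 2) n (hN.trans (valPrec_mono hφ (by omega)))
    have h2 := Set.mem_iInter.1 hz N
    have h3 := hy (N + 2)
    revert h1 h2 h3
    change (D (N + 2)).diam ≤ _ → z ∈ (D (N + 2)).toSet → _
    cases D (N + 2) with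
    | whole => intro h1; exact absurd h1 (by simp [DyadicInterval.diam])
    | fin lo hi e1 e2 e3 =>
      intro h1 h2 h3
      have h1' : hi - lo ≤ (1 / 2) ^ n := EReal.coe_le_coe_iff.1 h1
      have : |z - y| ≤ (1 / 2) ^ n := by
        rw [abs_le]
        constructor <;> linarith [h2.1, h2.2, h3.1, h3.2]
      linarith

/-- The precision reached after `N` iterations is still there after `N + 2`, the number of
iterations on input `natCode N`. So `N` competes in the minimum. -/
theorem param_evalFun_le {x y : ℝ} (hφ : Answers φ x y) {n N : ℕ}
    (h : n + 2 ≤ (stage φ N).valPrec) (ψ : intervalReals.rep.Dom) (hψ : (ψ : StrFun) = evalFun φ)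
    (hy : y ∈ intervalReals.rep (evalFun φ)) :
    intervalReals.param ψ n ≤ N + ⌈Real.logb 2 (|y| + 1)⌉₊ := by
  obtain ⟨ψ, hψD⟩ := ψ
  obtain rfl : ψ = evalFun φ := hψ
  have e : (graphFun IsRealName).fn (evalFun φ) hψD = y := Part.mem_unique ⟨hψD, rfl⟩ hy
  simp only [intervalReals, e]
  refine Nat.add_le_add_right (Nat.sInf_le ?_) _
  obtain ⟨D, hD, hsub, hy, hdiam⟩ := exists_outputs hφ
  refine ⟨D (N + 2), by simpa [evalFun, natCode] using hD (N + 2), hdiam _ _ ?_⟩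
  exact h.trans (valPrec_mono hφ (by omega))

/-! ### The bounds as second-order polynomials -/

/-- The bound for the running time. -/
noncomputable def timeBound (l : ℕ → ℕ) (n : ℕ) : ℕ :=
  (10 + .X * (.C 40 * .X + .C 400) : Polynomial ℕ).eval n +
    -- The zero polynomial gives access to `l 0`, the bound for the sizes of argument and value.
    (.C 12 * .X : Polynomial ℕ).eval n * l ((0 : Polynomial ℕ).eval n)

/-- The bound for the parameter. -/
noncomputable def paramBound (l : ℕ → ℕ) (n : ℕ) : ℕ :=
  l (l ((.X + .C 5 : Polynomial ℕ).eval n) + (.X + .C 5 : Polynomial ℕ).eval n) +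
    l ((.X + .C 5 : Polynomial ℕ).eval n) + (.X + .C 1 : Polynomial ℕ).eval n +
    l ((0 : Polynomial ℕ).eval n)

theorem isSOP_timeBound : IsSOP timeBound :=
  .add (.poly _) (.mul (.poly _) (.app (.poly _)))

theorem isSOP_paramBound : IsSOP paramBound :=
  .add (.add (.add (.app (.add (.app (.poly _)) (.poly _))) (.app (.poly _))) (.poly _))
    (.app (.poly _))

theorem timeBound_eq (l : ℕ → ℕ) (n : ℕ) :
    timeBound l n = 10 + n * (40 * n + 12 * l 0 + 400) := by
  simp [timeBound]
  ring

theorem paramBound_eq (l : ℕ → ℕ) (n : ℕ) :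
    paramBound l n = l (l (n + 5) + n + 5) + l (n + 5) + n + 1 + l 0 := by
  simp [paramBound, add_assoc]

end IntervalComplexity

theorem mainTheorem4 :
    IntervalComplexity.PolytimeComputable
      (IntervalComplexity.intervalFunctions.prod
        (IntervalComplexity.intervalReals.restrict unitInterval))
      IntervalComplexity.intervalReals
      (fun z : C(unitInterval, ℝ) × unitInterval => z.1 z.2) := by
  open IntervalComplexity in
  refine ⟨evalMachine, timeBound, paramBound, isSOP_timeBound, isSOP_paramBound, ?_, ?_, ?_⟩
  · intro φ z hz
    obtain ⟨f, x, hmem, hφ, h⟩ := exists_of_dom ⟨φ, Part.dom_iff_mem.2 ⟨z, hz⟩⟩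
    obtain ⟨hx, hy, -, hN⟩ := h _ rfl
    -- A name determines the pair, so the one extracted from the domain is the given one.
    obtain rfl := Part.mem_unique hz hmem
    exact ⟨_, (mem_operator hφ hx hy).2 rfl, mem_rep_evalFun hφ fun n => ⟨_, hN n⟩⟩
  · intro φ a
    obtain ⟨f, x, hmem, hφ, h⟩ := exists_of_dom φ
    obtain ⟨hx, hy, -, -⟩ := h _ rfl
    rw [timeBound_eq]
    exact time_le hφ hx hy
  · intro φ ψ hψ n
    obtain ⟨f, x, hmem, hφ, h⟩ := exists_of_dom φ
    obtain ⟨hx, hy, hc, hN⟩ := h _ rfl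
    rw [paramBound_eq]
    refine (param_evalFun_le hφ (hN n) ψ ((mem_operator hφ hx hy).1 hψ)
      (mem_rep_evalFun hφ fun n => ⟨_, hN n⟩)).trans ?_
    omega
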